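/- Call a map $p:V\to\mathbb{R}^2$ a \emph{straight-line embedding} of a simple graph $G$ with vertex set $V$ if $p$ is injective and, when every edge $uv$ of $G$ is drawn as the closed segment from $p(u)$ to $p(v)$, no edge passes through a vertex other than its two ends and any two distinct edges meet at most in a common end. A \emph{simultaneous geometric embedding} of two graphs $A$ and $B$ on $V$ is a single map $p:V\to\mathbb{R}^2$ that is a straight-line embedding of $A$ and a straight-line embedding of $B$ (an edge of $A$ may cross an edge of $B$). \textbf{Lemma.} Let $A$ and $B$ be two simple graphs on the same finite vertex set, each of maximum degree at most two (that is, each is a disjoint union of paths and cycles, where a path may be a single vertex). Then $A$ and $B$ have a simultaneous geometric embedding. Moreover, such an embedding can be found in $O(n)$ time, where $n$ is the number of vertices: there are a single program $P$ for the unit-cost real RAM (exact arithmetic $+,-,\cdot,/$ and comparisons on real numbers, and integer registers for counting and array indexing) and a constant $C$ such that for all $n\ge 0$, all graphs $A$, $B$ of maximum degree at most two with vertex set $\{0,\dots,n-1\}$, and all lists of the edges of $A$ and of the edges of $B$ (each edge listed once, in arbitrary order and with its ends in arbitrary order), $P$ halts on this input after at most $C(n+1)$ steps and outputs the coordinates of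 all vertices in a simultaneous geometric embedding of $A$ and $B$. -/

import Mathlib

/-! ### Straight-line drawings -/

/-- `p` is a crossing-free straight-line drawing of the graph `G` in the plane: distinct vertices are
distinct points, every edge `uv` is the closed segment from `p u` to `p v`, no edge passes through a
vertex other than its two ends, and two distinct edges meet at most in a common end. -/
structure IsStraightLineEmbedding {V : Type*} (G : SimpleGraph V) (p : V → ℝ × ℝ) : Prop where
  injective : Function.Injective p
  vertex_notMem_edge : ∀ u v w : V, G.Adj u v → w ≠ u → w ≠ v → p w ∉ segment ℝ (p u) (p v)
  edge_inter_edge : ∀ a b c d : V, G.Adj a b → G.Adj c d → s(a, b) ≠ s(c, d) →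
    segment ℝ (p a) (p b) ∩ segment ℝ (p c) (p d) ⊆ p '' (({a, b} : Set V) ∩ {c, d})

/-- One placement of the vertices that gives crossing-free straight-line drawings of both graphs. -/
def IsSimultaneousEmbedding {V : Type*} (A B : SimpleGraph V) (p : V → ℝ × ℝ) : Prop :=
  IsStraightLineEmbedding A p ∧ IsStraightLineEmbedding B p

/-! ### A real RAM

Programs of a unit-cost random access machine over the reals. A program is a finite piece of syntax, so
it names only finitely many registers and arrays. Integer registers can only be set to constants,
copied, incremented, decremented and compared, so in `t` steps no integer grows by more than
`t` plus a constant of the program: on inputs of size `n`, all integers used by a linear-time program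
fit into `O(log n)` bits. Real registers have the four arithmetic operations and comparisons; there
is no rounding and no conversion between reals and integers. -/

namespace RealRAM

/-- A memory configuration: integer registers, integer arrays (`arr a i` is the cell with index `i` of
the array number `a`), real registers and real arrays. -/
structure State where
  reg : ℕ → ℕ
  arr : ℕ → ℕ → ℕ
  rreg : ℕ → ℝ
  rarr : ℕ → ℕ → ℝ

/-- The elementary instructions. All arguments are register numbers, except `c`, a constant,
and `a`, the number of an array. -/
inductive Instr where
  | const (d c : ℕ)
  | copy (d x : ℕ)
  | succ (d x : ℕ)
  | pred (d x : ℕ)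
  | load (d a i : ℕ)
  | store (a i x : ℕ)
  | rconst (d : ℕ) (c : ℚ)
  | rcopy (d x : ℕ)
  | radd (d x y : ℕ)
  | rsub (d x y : ℕ)
  | rmul (d x y : ℕ)
  | rdiv (d x y : ℕ)
  | rload (d a i : ℕ)
  | rstore (a i x : ℕ)

/-- Assign the value `v` to the integer register `d`. -/
def State.setReg (s : State) (d v : ℕ) : State :=
  { s with reg := Function.update s.reg d v }

/-- Assign the value `v` to the real register `d`. -/
noncomputable def State.setRReg (s : State) (d : ℕ) (v : ℝ) : State :=
  { s with rreg := Function.update s.rreg d v }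

/-- The effect of an instruction. Decrementing `0` gives `0` and dividing by `0` gives `0`; both cases
can be recognized by a test. -/
noncomputable def Instr.run : Instr → State → State
  | .const d c, s => s.setReg d c
  | .copy d x, s => s.setReg d (s.reg x)
  | .succ d x, s => s.setReg d (s.reg x + 1)
  | .pred d x, s => s.setReg d (s.reg x - 1)
  | .load d a i, s => s.setReg d (s.arr a (s.reg i))
  | .store a i x, s =>
      { s with arr := Function.update s.arr a (Function.update (s.arr a) (s.reg i) (s.reg x)) }
  | .rconst d c, s => s.setRReg d (c : ℝ)
  | .rcopy d x, s => s.setRReg d (s.rreg x)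
  | .radd d x y, s => s.setRReg d (s.rreg x + s.rreg y)
  | .rsub d x y, s => s.setRReg d (s.rreg x - s.rreg y)
  | .rmul d x y, s => s.setRReg d (s.rreg x * s.rreg y)
  | .rdiv d x y, s => s.setRReg d (s.rreg x / s.rreg y)
  | .rload d a i, s => s.setRReg d (s.rarr a (s.reg i))
  | .rstore a i x, s =>
      { s with rarr := Function.update s.rarr a (Function.update (s.rarr a) (s.reg i) (s.rreg x)) }

/-- Tests: comparison of two integer registers or of two real registers, and negated tests. -/
inductive Test where
  | lt (x y : ℕ)
  | eq (x y : ℕ)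
  | rlt (x y : ℕ)
  | req (x y : ℕ)
  | not (b : Test)

/-- The outcome of a test. -/
def Test.Holds : Test → State → Prop
  | .lt x y, s => s.reg x < s.reg y
  | .eq x y, s => s.reg x = s.reg y
  | .rlt x y, s => s.rreg x < s.rreg y
  | .req x y, s => s.rreg x = s.rreg y
  | .not b, s => ¬ b.Holds s

/-- Structured programs: `branch b P Q` is "if `b` then `P` else `Q`", `loop b P` is "while `b` do
`P`". -/
inductive Program where
  | skip
  | instr (c : Instr)
  | seq (P Q : Program)
  | branch (b : Test) (P Q : Program)
  | loop (b : Test) (P : Program)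

/-- `Exec P s t s'`: started in `s`, the program `P` halts after exactly `t` steps, in the
configuration `s'`. Every executed instruction and every evaluation of a test is one step. -/
inductive Exec : Program → State → ℕ → State → Prop where
  | skip (s : State) : Exec .skip s 1 s
  | instr (c : Instr) (s : State) : Exec (.instr c) s 1 (c.run s)
  | seq {P Q : Program} {s s' s'' : State} {t t' : ℕ} :
      Exec P s t s' → Exec Q s' t' s'' → Exec (.seq P Q) s (t + t') s''
  | branch_true {b : Test} {P Q : Program} {s s' : State} {t : ℕ} :
      b.Holds s → Exec P s t s' → Exec (.branch b P Q) s (t + 1) s'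
  | branch_false {b : Test} {P Q : Program} {s s' : State} {t : ℕ} :
      ¬ b.Holds s → Exec Q s t s' → Exec (.branch b P Q) s (t + 1) s'
  | loop_true {b : Test} {P : Program} {s s' s'' : State} {t t' : ℕ} :
      b.Holds s → Exec P s t s' → Exec (.loop b P) s' t' s'' → Exec (.loop b P) s (t + 1 + t') s''
  | loop_false {b : Test} {P : Program} {s : State} :
      ¬ b.Holds s → Exec (.loop b P) s 1 s

end RealRAM

/-! ### Input and output -/

/-- `L` lists every edge of `G` exactly once, in an arbitrary order, each with its two ends in an
arbitrary order. -/
def IsEdgeList {n : ℕ} (G : SimpleGraph (Fin n)) (L : List (Fin n × Fin n)) : Prop :=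
  (L.map fun e => s(e.1, e.2)).Nodup ∧ ∀ u v : Fin n, s(u, v) ∈ L.map (fun e => s(e.1, e.2)) ↔ G.Adj u v

/-- The two ends of the entry number `i` of an edge list, and `(0, 0)` beyond the end of the list. -/
def edgeEntry {n : ℕ} (L : List (Fin n × Fin n)) (i : ℕ) : ℕ × ℕ :=
  match L[i]? with
  | some e => (e.1.val, e.2.val)
  | none => (0, 0)

/-- The initial configuration for two graphs with vertices `0, …, n - 1` given by edge lists: the integer
registers `0`, `1`, `2` hold `n` and the lengths of the two lists, the integer arrays `0`, `1` hold
the first and second ends of the edges in the first list, the arrays `2`, `3` those in the second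
list, and everything else is `0`. -/
noncomputable def inputState (n : ℕ) (LA LB : List (Fin n × Fin n)) : RealRAM.State where
  reg r := match r with
    | 0 => n
    | 1 => LA.length
    | 2 => LB.length
    | _ => 0
  arr a i := match a with
    | 0 => (edgeEntry LA i).1
    | 1 => (edgeEntry LA i).2
    | 2 => (edgeEntry LB i).1
    | 3 => (edgeEntry LB i).2
    | _ => 0
  rreg _ := 0
  rarr _ _ := 0

/-- The placement that is read off a final configuration: vertex `v` has its coordinates in the cells
with index `v` of the real arrays `0` and `1`. -/
def outputPlacement (n : ℕ) (s : RealRAM.State) : Fin n → ℝ × ℝ :=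
  fun v => (s.rarr 0 v.val, s.rarr 1 v.val)

/-! ### Drawings from coordinates -/

/-! Take two copies of each graph and join every vertex of degree less than two to its own copy
(twice if it is isolated). Both graphs become 2-regular multigraphs, that is, disjoint unions of
cycles, some of length two, and a drawing of these contains a drawing of the original graphs.

The first graph determines the first coordinates and the second graph the second coordinates. On its
own axis a cycle z_0, ..., z_m is a block of consecutive places: steps of a tiny gap δ, and a last
step longer than 1. A path edge then joins neighbouring places, so nothing lies between its ends;
only the closing edge z_0 z_m needs care. The inner vertices have distance at most Nδ from z_0 along
the axis, where the closing edge has hardly left the level of z_0. Hence it suffices that they all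
lie on the same side of z_0 with respect to the other axis, at a distance much larger than δ
(`closing_pos`).

This is achieved by breadth-first search in each component of the union. When the next vertex v in
the queue of one axis is missing on the other axis, its cycle there is placed, starting with v, and
with a gap ε times smaller than all gaps before. All vertices before v in the queue are already
present on the other axis, so the rest of the new cycle comes later than v in the queue (`Opened`),
and later vertices are on one side of v, at least the gap of v away (`Coords.exists_sign`). Thus the
closing edge is harmless (`edgeOK_normal_closing`).

The two cycles of the root u are exceptional: they open each other, and only the one with the
smaller gap is covered by this argument. If some neighbour of u in one graph lies on the cycle of u
in the other graph, the cycle is oriented so that the closing edge leads to that neighbour, which is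
at nearly the same level as u. Otherwise (`far`) the rest of each cycle of u is moved to distance
about X and listed backwards. The two edges at u become very long and nearly parallel to the axis,
and all vertices between their ends lie above them (`far_lowest`, `edgeOK_far_first`).

Successive components occupy disjoint intervals on both axes. For the running time, each vertex is
placed once and processed once per graph, which a linear potential (`pot`) pays for; the gaps become
exponentially small, but arithmetic is exact. -/

/-- An affine function is at most 0 on one segment and at least 0 on the other, so it vanishes at a
common point q. Ends of the second segment with a positive value have weight zero in q; hence q is
an end with value 0, which is shared by assumption. Both ends cannot be shared, since the edges
differ. -/
theorem segment_inter_segment_subset_of_separated {V : Type*} {p : V → ℝ × ℝ} {a b c d : V} (α β γ : ℝ)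
    (hab : a ≠ b) (hcd : c ≠ d) (hne : s(a, b) ≠ s(c, d))
    (ha : α * (p a).1 + β * (p a).2 + γ ≤ 0) (hb : α * (p b).1 + β * (p b).2 + γ ≤ 0)
    (hc : ((c = a ∨ c = b) ∧ 0 ≤ α * (p c).1 + β * (p c).2 + γ) ∨ 0 < α * (p c).1 + β * (p c).2 + γ)
    (hd : ((d = a ∨ d = b) ∧ 0 ≤ α * (p d).1 + β * (p d).2 + γ) ∨ 0 < α * (p d).1 + β * (p d).2 + γ) :
    segment ℝ (p a) (p b) ∩ segment ℝ (p c) (p d) ⊆ p '' (({a, b} : Set V) ∩ {c, d}) := by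
  rintro q ⟨⟨s, t, hs, ht, hst, hq⟩, ⟨s', t', hs', ht', hst', hq'⟩⟩
  have h1 := congrArg Prod.fst hq
  have h2 := congrArg Prod.snd hq
  have h1' := congrArg Prod.fst hq'
  have h2' := congrArg Prod.snd hq'
  simp only [Prod.fst_add, Prod.snd_add, Prod.smul_fst, Prod.smul_snd, smul_eq_mul] at h1 h2 h1' h2'
  have hle : α * q.1 + β * q.2 + γ ≤ 0 := by
    have e : α * q.1 + β * q.2 + γ = s * (α * (p a).1 + β * (p a).2 + γ)
        + t * (α * (p b).1 + β * (p b).2 + γ) := by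
      rw [← h1, ← h2]; linear_combination (-γ) * hst
    rw [e]
    linarith [mul_nonpos_of_nonneg_of_nonpos hs ha, mul_nonpos_of_nonneg_of_nonpos ht hb]
  have e : α * q.1 + β * q.2 + γ = s' * (α * (p c).1 + β * (p c).2 + γ)
      + t' * (α * (p d).1 + β * (p d).2 + γ) := by
    rw [← h1', ← h2']; linear_combination (-γ) * hst'
  rw [e] at hle
  have hc0 : 0 ≤ α * (p c).1 + β * (p c).2 + γ := by rcases hc with h | h <;> [exact h.2; exact h.le]
  have hd0 : 0 ≤ α * (p d).1 + β * (p d).2 + γ := by rcases hd with h | h <;> [exact h.2; exact h.le]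
  have m1 := mul_nonneg hs' hc0
  have m2 := mul_nonneg ht' hd0
  have z1 : 0 < α * (p c).1 + β * (p c).2 + γ → s' = 0 := fun h => by
    rcases mul_eq_zero.1 (le_antisymm (by linarith) m1) with h' | h' <;> [exact h'; exact absurd h' h.ne']
  have z2 : 0 < α * (p d).1 + β * (p d).2 + γ → t' = 0 := fun h => by
    rcases mul_eq_zero.1 (le_antisymm (by linarith) m2) with h' | h' <;> [exact h'; exact absurd h' h.ne']
  rcases hc with ⟨hc, -⟩ | hc
  · rcases hd with ⟨hd, -⟩ | hd
    · exfalso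
      apply hne
      rcases hc with rfl | rfl <;> rcases hd with rfl | rfl
      · exact absurd rfl hcd
      · rfl
      · exact Sym2.eq_swap
      · exact absurd rfl hcd
    · have := z2 hd
      obtain rfl : s' = 1 := by linarith
      subst this
      refine ⟨c, ⟨by simpa using hc, by simp⟩, ?_⟩
      rw [← hq']; simp
  · have hs0 := z1 hc
    rcases hd with ⟨hd, -⟩ | hd
    · obtain rfl : t' = 1 := by linarith
      subst hs0
      refine ⟨d, ⟨by simpa using hd, by simp⟩, ?_⟩
      rw [← hq']; simp
    · have := z2 hd
      linarith

/-- Every point of `P` whose first coordinate `c` is strictly between those of `a` and `b` has all its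
neighbours between `a` and `b`, and these points lie strictly on one side of the line `ab`. -/
def EdgeOK {V : Type*} (nb : V → V → Prop) (c d : V → ℝ) (P : Set V) (a b : V) : Prop :=
  ∃ s : ℝ, ∀ z ∈ P, c a < c z → c z < c b →
    (∀ w, nb z w → c a ≤ c w ∧ c w ≤ c b) ∧
      0 < s * ((d z - d a) * (c b - c a) - (d b - d a) * (c z - c a))

/-- First coordinates are distinct on `P` and all edges in `P` satisfy `EdgeOK`. -/
structure Drawn {V : Type*} (nb : V → V → Prop) (c d : V → ℝ) (P : Set V) : Prop where
  inj : Set.InjOn c P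
  edge : ∀ a ∈ P, ∀ b ∈ P, nb a b → c a < c b → EdgeOK nb c d P a b

namespace Drawn

variable {V : Type*} {nb : V → V → Prop} {c d : V → ℝ}

/-- Compare the intervals of first coordinates. If they overlap at most in a point, a vertical line
separates the edges. If one contains the other, the line of the longer edge separates, because the
ends of the shorter one are strictly on its good side or shared. A proper overlap cannot occur: the
left end of the second edge would lie strictly inside the first interval while its neighbour lies
outside. -/
theorem segment_inter_subset_aux (h : Drawn nb c d Set.univ) {a b e f : V} (hab : nb a b) (hef : nb e f)
    (cab : c a < c b) (cef : c e < c f) (hne : s(a, b) ≠ s(e, f)) (hle : c a ≤ c e) :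
    segment ℝ ((c a, d a) : ℝ × ℝ) (c b, d b) ∩ segment ℝ (c e, d e) (c f, d f) ⊆
      (fun v => ((c v, d v) : ℝ × ℝ)) '' (({a, b} : Set V) ∩ {e, f}) := by
  have inj : ∀ {v w}, c v = c w → v = w := fun h' => h.inj (Set.mem_univ _) (Set.mem_univ _) h'
  have nab : a ≠ b := fun h => cab.ne (congrArg c h)
  have nef : e ≠ f := fun h => cef.ne (congrArg c h)
  obtain ⟨s, hs⟩ := h.edge a trivial b trivial hab cab
  obtain ⟨s', hs'⟩ := h.edge e trivial f trivial hef cef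
  rcases le_or_gt (c b) (c e) with h1 | h1
  · refine segment_inter_segment_subset_of_separated (p := fun v => ((c v, d v) : ℝ × ℝ)) 1 0 (-c b)
      nab nef hne (by simp; linarith) (by simp) ?_ (Or.inr (by simp; linarith))
    rcases h1.eq_or_lt with h1 | h1
    · exact Or.inl ⟨Or.inr (inj h1.symm), by simp; linarith⟩
    · exact Or.inr (by simp; linarith)
  rcases le_or_gt (c f) (c b) with h2 | h2
  · refine segment_inter_segment_subset_of_separated (p := fun v => ((c v, d v) : ℝ × ℝ))
      (- s * (d b - d a)) (s * (c b - c a)) (s * ((d b - d a) * c a - (c b - c a) * d a))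
      nab nef hne (by apply le_of_eq; dsimp only; ring) (by apply le_of_eq; dsimp only; ring) ?_ ?_
    · rcases hle.eq_or_lt with h3 | h3
      · obtain rfl := inj h3
        exact Or.inl ⟨Or.inl rfl, by apply le_of_eq; dsimp only; ring⟩
      · refine Or.inr ((hs e trivial h3 h1).2.trans_le (le_of_eq ?_))
        dsimp only; ring
    · rcases h2.eq_or_lt with h3 | h3
      · obtain rfl := inj h3
        exact Or.inl ⟨Or.inr rfl, by apply le_of_eq; dsimp only; ring⟩
      · refine Or.inr ((hs f trivial (hle.trans_lt cef) h3).2.trans_le (le_of_eq ?_))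
        dsimp only; ring
  rcases hle.eq_or_lt with h3 | h3
  · obtain rfl := inj h3
    rw [Set.inter_comm, Set.inter_comm ({a, b} : Set V)]
    refine segment_inter_segment_subset_of_separated (p := fun v => ((c v, d v) : ℝ × ℝ))
      (- s' * (d f - d a)) (s' * (c f - c a)) (s' * ((d f - d a) * c a - (c f - c a) * d a))
      nef nab hne.symm (by apply le_of_eq; dsimp only; ring) (by apply le_of_eq; dsimp only; ring)
      (Or.inl ⟨Or.inl rfl, by apply le_of_eq; dsimp only; ring⟩) (Or.inr ?_)
    refine (hs' b trivial cab h2).2.trans_le (le_of_eq ?_)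
    dsimp only; ring
  · exact absurd ((hs e trivial h3 h1).1 f hef).2 h2.not_ge

theorem segment_inter_subset (h : Drawn nb c d Set.univ) {a b e f : V} (hab : nb a b) (hef : nb e f)
    (cab : c a < c b) (cef : c e < c f) (hne : s(a, b) ≠ s(e, f)) :
    segment ℝ ((c a, d a) : ℝ × ℝ) (c b, d b) ∩ segment ℝ (c e, d e) (c f, d f) ⊆
      (fun v => ((c v, d v) : ℝ × ℝ)) '' (({a, b} : Set V) ∩ {e, f}) := by
  rcases le_total (c a) (c e) with hle | hle
  · exact h.segment_inter_subset_aux hab hef cab cef hne hle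
  · rw [Set.inter_comm, Set.inter_comm ({a, b} : Set V)]
    exact h.segment_inter_subset_aux hef hab cef cab hne.symm hle

/-- A vertex on the segment would lie strictly between the ends, where the determinant in `EdgeOK`
is nonzero; on the line it is zero. -/
theorem notMem_segment (h : Drawn nb c d Set.univ) {a b w : V} (hab : nb a b) (cab : c a < c b)
    (hwa : w ≠ a) (hwb : w ≠ b) : ((c w, d w) : ℝ × ℝ) ∉ segment ℝ ((c a, d a) : ℝ × ℝ) (c b, d b) := by
  have inj : ∀ {v w}, c v = c w → v = w := fun h' => h.inj (Set.mem_univ _) (Set.mem_univ _) h'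
  rintro ⟨s, t, hs, ht, hst, hq⟩
  have h1 : s * c a + t * c b = c w := congrArg Prod.fst hq
  have h2 : s * d a + t * d b = d w := congrArg Prod.snd hq
  obtain rfl : s = 1 - t := by linarith
  have l1 : c a < c w := by
    refine lt_of_le_of_ne ?_ fun e => hwa (inj e.symm)
    nlinarith
  have l2 : c w < c b := by
    refine lt_of_le_of_ne ?_ fun e => hwb (inj e)
    nlinarith
  obtain ⟨s, hs'⟩ := h.edge a trivial b trivial hab cab
  have := (hs' w trivial l1 l2).2
  rw [← h1, ← h2] at this
  ring_nf at this
  exact lt_irrefl _ this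

/-- Coordinates as in `Drawn` give a crossing-free straight-line drawing. -/
theorem isStraightLineEmbedding {G : SimpleGraph V} (h : Drawn G.Adj c d Set.univ) :
    IsStraightLineEmbedding G fun v => (c v, d v) := by
  have inj : ∀ {v w}, c v = c w → v = w := fun h' => h.inj (Set.mem_univ _) (Set.mem_univ _) h'
  have lt_or : ∀ {v w}, G.Adj v w → c v < c w ∨ c w < c v := fun hvw =>
    lt_or_gt_of_ne fun e => hvw.ne (inj e)
  refine ⟨fun v w e => inj (congrArg Prod.fst e), ?_, ?_⟩
  · intro u v w huv hwu hwv
    rcases lt_or huv with l | l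
    · exact h.notMem_segment huv l hwu hwv
    · rw [segment_symm]
      exact h.notMem_segment huv.symm l hwv hwu
  · intro a b e f hab hef hne
    rcases lt_or hab with l | l <;> rcases lt_or hef with l' | l'
    · exact h.segment_inter_subset hab hef l l' hne
    · rw [segment_symm ℝ (c e, d e), Set.pair_comm e]
      exact h.segment_inter_subset hab hef.symm l l' (by rwa [Sym2.eq_swap (a := f)])
    · rw [segment_symm ℝ (c a, d a), Set.pair_comm a]
      exact h.segment_inter_subset hab.symm hef l l' (by rwa [Sym2.eq_swap (a := b)])
    · rw [segment_symm ℝ (c a, d a), Set.pair_comm a, segment_symm ℝ (c e, d e), Set.pair_comm e]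
      exact h.segment_inter_subset hab.symm hef.symm l l'
        (by rwa [Sym2.eq_swap (a := b), Sym2.eq_swap (a := f)])

end Drawn

/-- The second graph is monotone with respect to the second coordinate, so its drawing is obtained
from `Drawn` by reflection in the diagonal. -/
theorem IsStraightLineEmbedding.swap {V : Type*} {G : SimpleGraph V} {c d : V → ℝ}
    (h : IsStraightLineEmbedding G fun v => (c v, d v)) :
    IsStraightLineEmbedding G fun v => (d v, c v) := by
  let f : ℝ × ℝ →ₗ[ℝ] ℝ × ℝ := (LinearEquiv.prodComm ℝ ℝ ℝ).toLinearMap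
  have hf : Function.Injective f := (LinearEquiv.prodComm ℝ ℝ ℝ).injective
  have seg : ∀ u v, segment ℝ ((d u, c u) : ℝ × ℝ) (d v, c v) = f '' segment ℝ (c u, d u) (c v, d v) :=
    fun u v => (image_segment ℝ f.toAffineMap (c u, d u) (c v, d v)).symm
  refine ⟨fun v w e => h.injective (hf e), fun u v w huv hu hv hm => ?_, fun a b e g hab heg hne => ?_⟩
  · rw [seg] at hm
    obtain ⟨q, hq, e⟩ := hm
    obtain rfl : q = (c w, d w) := hf e
    exact h.vertex_notMem_edge u v w huv hu hv hq
  · rw [seg, seg, ← Set.image_inter hf]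
    rintro _ ⟨q, hq, rfl⟩
    obtain ⟨v, hv, rfl⟩ := h.edge_inter_edge a b e g hab heg hne hq
    exact ⟨v, hv, rfl⟩

/-! ### Layout of one axis -/

/-- Constants of the construction: `N` vertices, extent `S` of the ordinary blocks of a component, size `X`
of a component, quotient `ε` of successive gaps. -/
structure Consts (N S X ε : ℝ) : Prop where
  two_le : 2 ≤ N
  N_le : N ≤ S
  le_X : S * S + 2 ≤ X
  ε_pos : 0 < ε
  ε_lt : ε * (N * X) < 1

namespace Consts

variable {N S X ε : ℝ} (K : Consts N S X ε)
include K

theorem S_add_two_le : S + 2 ≤ X := by nlinarith [K.two_le, K.N_le, K.le_X]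

/-- Needed where two offsets, each at most N gaps, are multiplied: the product must stay below one
gap. -/
theorem ε_mul_lt : ε * N * N < 1 := by
  have h1 : N ≤ X := by linarith [K.N_le, K.S_add_two_le]
  have h2 : 0 ≤ ε * N := mul_nonneg K.ε_pos.le (by linarith [K.two_le])
  nlinarith [mul_le_mul_of_nonneg_left h1 h2, K.ε_lt]

theorem mul_N_le {δ : ℝ} (h : δ ≤ ε) : N * δ ≤ 1 := by
  have h2 := K.two_le
  have h3 : ε * N ≤ 1 := by
    have := K.ε_mul_lt
    have : 0 < ε * N := mul_pos K.ε_pos (by linarith)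
    nlinarith
  nlinarith

theorem le_one {δ : ℝ} (h : δ ≤ ε) : δ ≤ 1 := by
  have h2 := K.two_le
  have h3 := K.mul_N_le (le_refl ε)
  nlinarith [K.ε_pos]

end Consts

/-- The positions `o ≤ i < L` of the queue `q` are split into blocks `st i ≤ · ≤ en i`, each of which
lists a cycle of the graph `nb`. -/
structure PreBlocks (nb : ℕ → ℕ → Prop) (q st en : ℕ → ℕ) (o L : ℕ) : Prop where
  inj : ∀ i j, o ≤ i → i < L → o ≤ j → j < L → q i = q j → i = j
  le_st : ∀ i, o ≤ i → i < L → o ≤ st i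
  st_le : ∀ i, o ≤ i → i < L → st i ≤ i
  le_en : ∀ i, o ≤ i → i < L → i ≤ en i
  en_lt : ∀ i, o ≤ i → i < L → en i < L
  st_lt_en : ∀ i, o ≤ i → i < L → st i < en i
  st_eq : ∀ i j, o ≤ i → i < L → st i ≤ j → j ≤ en i → st j = st i
  en_eq : ∀ i j, o ≤ i → i < L → st i ≤ j → j ≤ en i → en j = en i
  nbr : ∀ i w, o ≤ i → i < L → nb (q i) w → ∃ j, st i ≤ j ∧ j ≤ en i ∧ w = q j ∧
    (j = i + 1 ∨ i = j + 1 ∨ (i = st i ∧ j = en i) ∨ (j = st i ∧ i = en i))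

/-- A nonempty sequence of blocks. -/
structure Blocks (nb : ℕ → ℕ → Prop) (q st en : ℕ → ℕ) (o L : ℕ) : Prop extends PreBlocks nb q st en o L where
  lt : o < L
  st_o : st o = o

/-- The coordinates `c` of the vertices in a component: the blocks are placed from left to right. If `far`
holds then the first vertex is placed at `base`, and the rest of the first block is placed at distance
about `X`, from right to left. -/
structure Coords (N S X ε : ℝ) (far : Prop) (base : ℝ) (c : ℕ → ℝ) (q st en : ℕ → ℕ) (dl : ℕ → ℝ)
    (o L : ℕ) : Prop where
  dl_pos : ∀ i, o ≤ i → i < L → 0 < dl i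
  dl_le : ∀ i, o ≤ i → i < L → dl i ≤ ε
  dl_eq : ∀ i, o ≤ i → i < L → dl i = dl (st i)
  base_le : ∀ i, o ≤ i → i < L → base ≤ c (q i)
  far_base_le : far → ∀ i, en o < i → i < L → base + 1 ≤ c (q i)
  le : ∀ i, o ≤ i → i < L → (far → en o < i) → c (q i) ≤ base + S
  mono : ∀ i j, o ≤ i → i < j → j < L → (far → en o < i) → c (q i) + dl i ≤ c (q j)
  near : ∀ i, o ≤ i → i < L → i < en i → (far → en o < i) → c (q i) ≤ c (q (st i)) + N * dl i
  gap : ∀ i, o ≤ i → i < L → (far → en o < i) → c (q (st i)) + 1 ≤ c (q (en i))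
  far_o : far → c (q o) = base
  far_eq : far → ∀ i, o < i → i ≤ en o → c (q i) = base + X - (i - o : ℝ) * dl o
  far_len : far → (en o - o : ℝ) ≤ N

namespace Blocks

variable {nb : ℕ → ℕ → Prop} {q st en : ℕ → ℕ} {o L : ℕ} (h : Blocks nb q st en o L)
include h

theorem en_st {i : ℕ} (hi : o ≤ i) (hL : i < L) : en (st i) = en i :=
  h.en_eq i _ hi hL le_rfl ((h.st_le i hi hL).trans (h.le_en i hi hL))

/-- The condition `far → en o < i` recurs below: it says that position `i` is ordinary, that is, not
in a far first block. This lemma expresses it through the block of `i`. -/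
theorem en_o_lt_iff {i : ℕ} (hi : o ≤ i) (hL : i < L) : en o < i ↔ st i ≠ o := by
  constructor
  · intro hlt e
    have h1 := h.en_st hi hL
    rw [e] at h1
    have := h.le_en i hi hL
    omega
  · intro hne
    by_contra hlt
    exact hne ((h.st_eq o i le_rfl h.lt (h.st_o.le.trans hi) (by omega)).trans h.st_o)

theorem en_o_lt_of_mem {i j : ℕ} (hi : o ≤ i) (hL : i < L) (h1 : st i ≤ j) (h2 : j ≤ en i)
    (hlt : en o < i) : en o < j := by
  have hj : o ≤ j := (h.le_st i hi hL).trans h1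
  have hjL : j < L := h2.trans_lt (h.en_lt i hi hL)
  rw [h.en_o_lt_iff hj hjL, h.st_eq i j hi hL h1 h2]
  exact (h.en_o_lt_iff hi hL).1 hlt

end Blocks

section

variable {N S X ε : ℝ} {far : Prop} {base : ℝ} {nb : ℕ → ℕ → Prop} {c : ℕ → ℝ} {q st en : ℕ → ℕ}
  {dl : ℕ → ℝ} {o L : ℕ}

namespace Coords

/-- At most N steps of a gap with N times gap at most 1 are made backwards from `base + X`. Since
`X` is at least `S + 2`, the far part stays beyond all ordinary blocks. -/
theorem far_lt (K : Consts N S X ε) (hB : Blocks nb q st en o L)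
    (h : Coords N S X ε far base c q st en dl o L) (hf : far) {i : ℕ} (h1 : o < i) (h2 : i ≤ en o) :
    base + X - 1 ≤ c (q i) := by
  rw [h.far_eq hf i h1 h2]
  have e1 : (i - o : ℝ) ≤ N := by
    have : (i : ℝ) ≤ en o := by exact_mod_cast h2
    linarith [h.far_len hf]
  have e2 := h.dl_pos o le_rfl hB.lt
  have e3 := K.mul_N_le (h.dl_le o le_rfl hB.lt)
  nlinarith

theorem le_add_X (K : Consts N S X ε) (hB : Blocks nb q st en o L)
    (h : Coords N S X ε far base c q st en dl o L) {i : ℕ} (hi : o ≤ i) (hL : i < L) :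
    c (q i) ≤ base + X := by
  have h1 := K.S_add_two_le
  by_cases hn : far → en o < i
  · linarith [h.le i hi hL hn]
  · rw [Classical.not_imp] at hn
    obtain ⟨hf, hn⟩ := hn
    rcases hi.eq_or_lt with rfl | hi
    · rw [h.far_o hf]; linarith [K.two_le, K.N_le]
    · rw [h.far_eq hf i hi (by omega)]
      have e1 : (0 : ℝ) ≤ i - o := sub_nonneg.2 (by exact_mod_cast hi.le)
      nlinarith [h.dl_pos o le_rfl hB.lt]

theorem abs_sub_le (K : Consts N S X ε) (hB : Blocks nb q st en o L)
    (h : Coords N S X ε far base c q st en dl o L) {i j : ℕ} (hi : o ≤ i) (hL : i < L) (hj : o ≤ j)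
    (hjL : j < L) : |c (q i) - c (q j)| ≤ X := by
  have := h.le_add_X K hB hi hL
  have := h.le_add_X K hB hj hjL
  have := h.base_le i hi hL
  have := h.base_le j hj hjL
  rw [abs_le]; constructor <;> linarith

/-- All later vertices are on one side of a vertex, at distance at least its gap. -/
theorem exists_sign (K : Consts N S X ε) (hB : Blocks nb q st en o L)
    (h : Coords N S X ε far base c q st en dl o L) {i : ℕ} (hi : o ≤ i) (hL : i < L) (hfo : far → i ≠ o) :
    ∃ s : ℝ, |s| = 1 ∧ ∀ j, i < j → j < L → dl i ≤ s * (c (q j) - c (q i)) := by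
  by_cases hn : far → en o < i
  · exact ⟨1, by simp, fun j hij hj => by linarith [h.mono i j hi hij hj hn]⟩
  · rw [Classical.not_imp] at hn
    obtain ⟨hf, hn⟩ := hn
    have hlt : o < i := lt_of_le_of_ne hi (hfo hf).symm
    have hd : dl i = dl o := by
      rw [h.dl_eq i hi hL, (hB.en_o_lt_iff hi hL).not_left.1 hn]
    -- The far part of the first block runs from right to left and the ordinary blocks are left of
    -- it, so everything later lies to the left.
    refine ⟨-1, by simp, fun j hij hj => ?_⟩
    rcases lt_or_ge (en o) j with hj' | hj'
    · have h1 := h.le j (by omega) hj fun _ => hj'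
      have h2 := h.far_lt K hB hf hlt (by omega)
      have h3 := K.S_add_two_le
      have h4 := K.le_one (h.dl_le i hi hL)
      linarith
    · rw [h.far_eq hf i hlt (by omega), h.far_eq hf j (by omega) hj', hd]
      have e1 : (i + 1 : ℝ) ≤ j := by exact_mod_cast hij
      nlinarith [h.dl_pos o le_rfl hB.lt]

theorem injOn (K : Consts N S X ε) (hB : Blocks nb q st en o L)
    (h : Coords N S X ε far base c q st en dl o L) {i j : ℕ} (hi : o ≤ i) (hL : i < L) (hj : o ≤ j)
    (hjL : j < L) (e : c (q i) = c (q j)) : i = j := by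
  by_contra hne
  wlog hij : i < j generalizing i j
  · exact this hj hjL hi hL e.symm (Ne.symm hne) (by omega)
  by_cases hfo : far → i ≠ o
  · obtain ⟨s, -, hs⟩ := h.exists_sign K hB hi hL hfo
    have := hs j hij hjL
    rw [e, sub_self, mul_zero] at this
    linarith [h.dl_pos i hi hL]
  · rw [Classical.not_imp, not_not] at hfo
    obtain ⟨hf, rfl⟩ := hfo
    rw [h.far_o hf] at e
    rcases lt_or_ge (en i) j with hj' | hj'
    · linarith [h.far_base_le hf j hj' hjL]
    · linarith [h.far_lt K hB hf hij hj', K.S_add_two_le, K.two_le, K.N_le]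

end Coords

end

/-! ### Edges of one component, and gluing of components -/

section

variable {N S X ε : ℝ} {far : Prop} {nb : ℕ → ℕ → Prop}
  {base : ℝ} {c : ℕ → ℝ} {q st en : ℕ → ℕ} {dl : ℕ → ℝ} {o L : ℕ}
  {nb' : ℕ → ℕ → Prop}
  {base' : ℝ} {d : ℕ → ℝ} {q' st' en' : ℕ → ℕ} {dl' : ℕ → ℝ} {o' L' : ℕ}

/-- Every block but the first starts with a vertex that is the first of the block on the other axis. -/
def Opened (ε : ℝ) (q st : ℕ → ℕ) (dl : ℕ → ℝ) (o L : ℕ) (q' : ℕ → ℕ) (dl' : ℕ → ℝ) (o' L' : ℕ) : Prop :=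
  ∀ i, o ≤ i → i < L → st i ≠ o → ∃ k, o' ≤ k ∧ k < L' ∧ q' k = q (st i) ∧ dl i ≤ ε * dl' k ∧
    ∀ k', o' ≤ k' → k' < k → ∃ j, o ≤ j ∧ j < st i ∧ q j = q' k'

/-- The condition on the first block. -/
structure RootOK (ε : ℝ) (far : Prop) (q en : ℕ → ℕ) (dl : ℕ → ℝ) (o : ℕ) (q' en' : ℕ → ℕ) (dl' : ℕ → ℝ)
    (o' : ℕ) : Prop where
  near : ¬ far → dl o ≤ ε * dl' o' ∨
    ∃ k, o' ≤ k ∧ k ≤ en' o' ∧ q' k = q (en o) ∧ (k < en' o' ∨ en' o' = o' + 1)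
  far : far → ∀ k, o' ≤ k → k ≤ en' o' → q' k ≠ q (o + 1) ∧ q' k ≠ q (en o)

/-- This is the estimate for a closing edge. Relative to its first vertex, an inner vertex has
offset `f` along the axis and `a` across it, and the far end has offsets `b` and `e`. The product `e
* f` is at most X·N·ε·g, which is less than `g`, whereas `s * a * b` is at least `g`. -/
theorem closing_pos {s a b e f g N X ε δ : ℝ} (hs : |s| = 1) (K : ε * (N * X) < 1) (hN : 0 ≤ N) (hX : 0 ≤ X)
    (hg : 0 < g) (hδ : δ ≤ ε * g) (h1 : g ≤ s * a) (h2 : 1 ≤ b) (h3 : |e| ≤ X) (h4 : 0 ≤ f)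
    (h5 : f ≤ N * δ) : 0 < s * (a * b - e * f) := by
  have h6 : s * e ≤ X := by
    calc s * e ≤ |s * e| := le_abs_self _
      _ = |e| := by rw [abs_mul, hs, one_mul]
      _ ≤ X := h3
  have h7 : s * e * f ≤ X * f := mul_le_mul_of_nonneg_right h6 h4
  have h8 : X * f ≤ X * (N * (ε * g)) :=
    mul_le_mul_of_nonneg_left (h5.trans (mul_le_mul_of_nonneg_left hδ hN)) hX
  have h9 : X * (N * (ε * g)) < g := by nlinarith
  have h10 : g ≤ s * a * b := by nlinarith
  nlinarith

/-- The vertices of the component. -/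
def Verts (q : ℕ → ℕ) (o L : ℕ) : Set ℕ := {z | ∃ i, o ≤ i ∧ i < L ∧ q i = z}

/-- The two vertices are consecutive on the axis, so the condition on vertices strictly between them
is vacuous. -/
theorem edgeOK_normal_succ (K : Consts N S X ε) (hB : Blocks nb q st en o L)
    (hC : Coords N S X ε far base c q st en dl o L) {i : ℕ} (hi : o ≤ i) (hL : i + 1 < L)
    (hn : far → en o < i) : EdgeOK nb c d (Verts q o L) (q i) (q (i + 1)) := by
  refine ⟨1, ?_⟩
  rintro z ⟨k, hk, hkL, rfl⟩ h1 h2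
  exfalso
  have hb := hC.le (i + 1) (by omega) hL fun hf => (hn hf).trans (Nat.lt_succ_self i)
  by_cases hkn : far → en o < k
  · rcases lt_trichotomy k i with h | rfl | h
    · linarith [hC.mono k i hk h (by omega) hkn, hC.dl_pos k hk hkL]
    · exact lt_irrefl _ h1
    · rcases Nat.eq_or_lt_of_le h with h | h
      · rw [← h] at h2; exact lt_irrefl _ h2
      · linarith [hC.mono (i + 1) k (by omega) h hkL fun hf => (hn hf).trans (Nat.lt_succ_self i),
          hC.dl_pos (i + 1) (by omega) hL]
  · rw [Classical.not_imp] at hkn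
    obtain ⟨hf, hkn⟩ := hkn
    rcases hk.eq_or_lt with rfl | hk
    · linarith [hC.far_o hf, hC.base_le i hi (by omega)]
    · linarith [hC.far_lt K hB hf hk (by omega), K.S_add_two_le]

/-- Ordinary blocks are placed one after the other, and a far first block is at `base` or beyond
`base + S`. So only inner vertices of the same block lie between its ends, and their neighbours
belong to the block as well. -/
theorem between_normal (K : Consts N S X ε) (hB : Blocks nb q st en o L)
    (hC : Coords N S X ε far base c q st en dl o L) {i k : ℕ} (hi : o ≤ i) (hL : i < L)
    (hn : far → en o < i) (hk : o ≤ k) (hkL : k < L) (h1 : c (q (st i)) < c (q k))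
    (h2 : c (q k) < c (q (en i))) :
    st i < k ∧ k < en i ∧ (far → en o < k) ∧ (∀ w, nb (q k) w → c (q (st i)) ≤ c w ∧ c w ≤ c (q (en i))) ∧
      c (q k) ≤ c (q (st i)) + N * dl i := by
  have hs := hB.le_st i hi hL
  have hsi := hB.st_le i hi hL
  have hie := hB.le_en i hi hL
  have heL := hB.en_lt i hi hL
  have hns : far → en o < st i := fun hf => hB.en_o_lt_of_mem hi hL le_rfl (hsi.trans hie) (hn hf)
  have hne : far → en o < en i := fun hf => hB.en_o_lt_of_mem hi hL (hsi.trans hie) le_rfl (hn hf)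
  have hkn : far → en o < k := by
    intro hf
    by_contra hkn
    rcases hk.eq_or_lt with rfl | hk
    · linarith [hC.far_o hf, hC.base_le (st i) hs (by omega)]
    · linarith [hC.far_lt K hB hf hk (by omega), K.S_add_two_le, hC.le (en i) (by omega) heL hne]
  have hk1 : st i < k := by
    by_contra hlt
    rcases (not_lt.1 hlt).eq_or_lt with rfl | hlt
    · exact lt_irrefl _ h1
    · linarith [hC.mono k (st i) hk hlt (by omega) hkn, hC.dl_pos k hk hkL]
  have hk2 : k < en i := by
    by_contra hlt
    rcases (not_lt.1 hlt).eq_or_lt with rfl | hlt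
    · exact lt_irrefl _ h2
    · linarith [hC.mono (en i) k (by omega) hlt hkL hne, hC.dl_pos (en i) (by omega) heL]
  have est := hB.st_eq i k hi hL hk1.le hk2.le
  have een := hB.en_eq i k hi hL hk1.le hk2.le
  refine ⟨hk1, hk2, hkn, ?_, ?_⟩
  · intro w hw
    obtain ⟨j, hj1, hj2, rfl, -⟩ := hB.nbr k w hk hkL hw
    rw [est] at hj1
    rw [een] at hj2
    constructor
    · rcases hj1.eq_or_lt with rfl | hj
      · exact le_rfl
      · linarith [hC.mono (st i) j hs hj (by omega) hns, hC.dl_pos (st i) hs (by omega)]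
    · rcases hj2.eq_or_lt with rfl | hj
      · exact le_rfl
      · linarith [hC.mono j (en i) (by omega) hj heL
          fun hf => hB.en_o_lt_of_mem hi hL hj1 hj2 (hn hf), hC.dl_pos j (by omega) (by omega)]
  · have := hC.near k hk hkL (by rw [een]; exact hk2) hkn
    rwa [est, hC.dl_eq k hk hkL, est, ← hC.dl_eq i hi hL] at this

/-- Except in one case, the block starts with its earliest vertex on the other axis, and its gap is
tiny compared with the gap there, so `closing_pos` applies. The exception is the first block with
the larger gap, where the position of its last vertex on the other axis helps. -/
theorem edgeOK_normal_closing (K : Consts N S X ε) (hB : Blocks nb q st en o L)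
    (hC : Coords N S X ε far base c q st en dl o L) (hB' : Blocks nb' q' st' en' o' L')
    (hC' : Coords N S X ε far base' d q' st' en' dl' o' L') (hV : Verts q o L = Verts q' o' L')
    (hq : q o = q' o') (hO : Opened ε q st dl o L q' dl' o' L') (hR : RootOK ε far q en dl o q' en' dl' o')
    {i : ℕ} (hi : o ≤ i) (hL : i < L) (hn : far → en o < i) :
    EdgeOK nb c d (Verts q o L) (q (st i)) (q (en i)) := by
  have hs := hB.le_st i hi hL
  have hsi := hB.st_le i hi hL
  have hie := hB.le_en i hi hL
  have heL := hB.en_lt i hi hL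
  have pos : ∀ {j}, o ≤ j → j < L → ∃ k, o' ≤ k ∧ k < L' ∧ q' k = q j := fun {j} h1 h2 => by
    have : q j ∈ Verts q' o' L' := hV ▸ ⟨j, h1, h2, rfl⟩
    exact this
  have hN := K.two_le
  have hX := K.S_add_two_le
  have hNS := K.N_le
  -- This alternative covers all blocks opened by the search, and the first block if its gap is the
  -- smaller one. The clause `far → k ≠ o'` is what `exists_sign` needs.
  by_cases hop : ∃ k, o' ≤ k ∧ k < L' ∧ q' k = q (st i) ∧ dl i ≤ ε * dl' k ∧ (far → k ≠ o') ∧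
      ∀ k', o' ≤ k' → k' < k → ∃ j, o ≤ j ∧ j < st i ∧ q j = q' k'
  · obtain ⟨k, hk, hkL, hkq, hδ, hko, hfirst⟩ := hop
    obtain ⟨s, hs1, hs2⟩ := hC'.exists_sign K hB' hk hkL hko
    refine ⟨s, ?_⟩
    rintro z ⟨j, hj, hjL, rfl⟩ h1 h2
    obtain ⟨a1, a2, -, a4, a5⟩ := between_normal K hB hC hi hL hn hj hjL h1 h2
    refine ⟨a4, ?_⟩
    obtain ⟨k', hk', hkL', hkq'⟩ := pos hj hjL
    have hkk : k < k' := by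
      rcases lt_trichotomy k k' with h | h | h
      · exact h
      · subst h
        rw [hkq] at hkq'
        exact absurd (hB.inj _ _ hs (by omega) hj hjL hkq') a1.ne
      · obtain ⟨j', e1, e2, e3⟩ := hfirst k' hk' h
        rw [hkq'] at e3
        have := hB.inj _ _ e1 (by omega) hj hjL e3
        omega
    obtain ⟨ke, hke, hkeL, hkeq⟩ := pos (hie.trans' hi) heL
    have hgap := hC.gap i hi hL hn
    refine closing_pos hs1 K.ε_lt (by linarith) (by linarith) (hC'.dl_pos k hk hkL) hδ ?_
      (by linarith) ?_ (by linarith) (δ := dl i) (by linarith)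
    · rw [← hkq, ← hkq']; exact hs2 k' hkk hkL'
    · rw [← hkq, ← hkeq]; exact hC'.abs_sub_le K hB' hke hkeL hk hkL
  -- What remains is the first block when `far` fails and its gap is not the smaller one.
  · have hst : st i = o := by
      by_contra hne
      obtain ⟨k, h1, h2, h3, h4, h5⟩ := hO i hi hL hne
      refine hop ⟨k, h1, h2, h3, h4, ?_, h5⟩
      rintro - rfl
      rw [← hq] at h3
      exact hne (hB.inj _ _ le_rfl hB.lt hs (by omega) h3).symm
    have hf : ¬ far := fun hf => (hB.en_o_lt_iff hi hL).1 (hn hf) hst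
    have hen : en i = en o := by rw [← hB.en_st hi hL, hst]
    have hdl : dl i = dl o := by rw [hC.dl_eq i hi hL, hst]
    rcases hR.near hf with h | ⟨k, hk1, hk2, hk3, hk4⟩
    · exact absurd ⟨o', le_rfl, hB'.lt, by rw [hst, hq], hdl ▸ h, fun h' => absurd h' hf,
        fun k' h1 h2 => absurd h1 (by omega)⟩ hop
    have hkL : k < L' := hk2.trans_lt (hB'.en_lt o' le_rfl hB'.lt)
    have hk0 : o' < k := by
      rcases hk1.eq_or_lt with rfl | h
      · rw [← hq] at hk3
        have := hB.inj _ _ le_rfl hB.lt (by omega) (hen ▸ heL) hk3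
        have := hB.st_lt_en o le_rfl hB.lt
        have := hB.st_o
        omega
      · exact h
    refine ⟨1, ?_⟩
    rintro z ⟨j, hj, hjL, rfl⟩ h1 h2
    obtain ⟨a1, a2, -, a4, a5⟩ := between_normal K hB hC hi hL hn hj hjL h1 h2
    refine ⟨a4, ?_⟩
    have hgap := hC.gap i hi hL hn
    obtain ⟨k', hk', hkL', hkq'⟩ := pos hj hjL
    have hk'0 : o' < k' := by
      rcases hk'.eq_or_lt with rfl | h
      · rw [← hq] at hkq'
        have := hB.inj _ _ le_rfl hB.lt hj hjL hkq'
        omega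
      · exact h
    have hnf : ∀ k, far → en' o' < k := fun _ h' => absurd h' hf
    have m1 := hC'.mono o' k' le_rfl hk'0 hkL' (hnf _)
    have m2 := hC'.mono o' k le_rfl hk0 hkL (hnf _)
    have p1 := hC'.dl_pos o' le_rfl hB'.lt
    have p2 := hC'.dl_le o' le_rfl hB'.lt
    have p3 := hC.dl_pos o le_rfl hB.lt
    have p4 := hC.dl_le o le_rfl hB.lt
    rw [hkq', ← hq] at m1
    rw [hk3, ← hq] at m2
    simp only [hst, hen, hdl] at hgap h1 h2 a5 ⊢
    rcases hk4 with hk4 | hk4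
    -- The far end lies inside the first block of the other axis, before its last vertex, hence at
    -- most `N * dl' o'` above the root. The rise over the inner vertices is then less than `dl'
    -- o'`, their least height.
    · have e1 := hB'.en_eq o' k le_rfl hB'.lt (hB'.st_o.le.trans hk1) hk2
      have e2 := hB'.st_eq o' k le_rfl hB'.lt (hB'.st_o.le.trans hk1) hk2
      have n1 := hC'.near k hk1 hkL (by rw [e1]; exact hk4) (hnf _)
      rw [hC'.dl_eq k hk1 hkL, e2, hB'.st_o, hk3, ← hq] at n1
      have t1 : (d (q (en o)) - d (q o)) * (c (q j) - c (q o)) ≤ N * dl' o' * (N * dl o) :=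
        mul_le_mul (by linarith) (by linarith) (by linarith) (by positivity)
      have t2 : N * dl' o' * (N * dl o) < dl' o' := by
        have := K.ε_mul_lt
        have : dl o * N * N ≤ ε * N * N := by gcongr
        nlinarith
      have t3 : dl' o' ≤ (d (q j) - d (q o)) * (c (q (en o)) - c (q o)) := by nlinarith
      linarith
    -- The first block of the other axis has only two vertices, the root and the far end. The far
    -- end is therefore second on that axis, and each inner vertex lies above it.
    · have hkk : k < k' := by
        rcases lt_trichotomy k k' with h | h | h
        · exact h
        · subst h
          rw [hk3] at hkq'
          have := hB.inj _ _ (by omega) (by omega) hj hjL hkq'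
          omega
        · omega
      have m3 := hC'.mono k k' hk1 hkk hkL' (hnf _)
      rw [hkq', hk3] at m3
      have p5 := hC'.dl_pos k hk1 hkL
      have t1 : (d (q (en o)) - d (q o)) * (c (q j) - c (q o)) ≤
          (d (q (en o)) - d (q o)) * (c (q (en o)) - c (q o)) :=
        mul_le_mul_of_nonneg_left (by linarith) (by linarith)
      have t2 : (d (q (en o)) - d (q o)) * (c (q (en o)) - c (q o)) <
          (d (q j) - d (q o)) * (c (q (en o)) - c (q o)) :=
        mul_lt_mul_of_pos_right (by linarith) (by linarith)
      linarith

/-- Consecutive places again, now in reversed order; the root and all ordinary blocks are to the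
left of both ends. -/
theorem edgeOK_far_succ (K : Consts N S X ε) (hB : Blocks nb q st en o L)
    (hC : Coords N S X ε far base c q st en dl o L) (hf : far) {i : ℕ} (hi : o < i) (hie : i + 1 ≤ en o) :
    EdgeOK nb c d (Verts q o L) (q (i + 1)) (q i) := by
  refine ⟨1, ?_⟩
  rintro z ⟨k, hk, hkL, rfl⟩ h1 h2
  exfalso
  have b1 := hC.far_lt K hB hf (i := i + 1) (by omega) hie
  have p := hC.dl_pos o le_rfl hB.lt
  rcases lt_or_ge (en o) k with hk' | hk'
  · linarith [hC.le k hk hkL fun _ => hk', K.S_add_two_le]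
  rcases hk.eq_or_lt with rfl | hk
  · linarith [hC.far_o hf, K.S_add_two_le, K.two_le, K.N_le]
  rw [hC.far_eq hf k hk hk', hC.far_eq hf (i + 1) (by omega) hie] at h1
  rw [hC.far_eq hf k hk hk', hC.far_eq hf i hi (by omega)] at h2
  rcases lt_or_ge i k with h | h
  · have : ((i + 1 : ℕ) : ℝ) ≤ k := by exact_mod_cast h
    nlinarith
  · have : (k : ℝ) ≤ i := by exact_mod_cast h
    nlinarith

/-- If `far` holds then the second vertex of the first block is the second one on the other axis. -/
theorem far_lowest (hB : Blocks nb q st en o L) (hB' : Blocks nb' q' st' en' o' L')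
    (hV : Verts q o L = Verts q' o' L') (hq : q o = q' o') (hO' : Opened ε q' st' dl' o' L' q dl o L)
    (hR : RootOK ε far q en dl o q' en' dl' o') (hf : far) : q' (en' o' + 1) = q (o + 1) ∧ en' o' + 1 < L' := by
  have hoL : o + 1 < L := by
    have := hB.st_lt_en o le_rfl hB.lt
    have := hB.en_lt o le_rfl hB.lt
    have := hB.st_o
    omega
  have : q (o + 1) ∈ Verts q' o' L' := hV ▸ ⟨o + 1, by omega, hoL, rfl⟩
  obtain ⟨k, hk, hkL, hkq⟩ := this
  have hek : en' o' < k := by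
    by_contra h
    exact (hR.far hf k hk (by omega)).1 hkq
  have he1 : en' o' + 1 < L' := by omega
  have hoe := hB'.le_en o' le_rfl hB'.lt
  obtain ⟨j, hj, hjL, hjq, -, hfirst⟩ := hO' k hk hkL ((hB'.en_o_lt_iff hk hkL).1 hek)
  have hs' := hB'.st_le k hk hkL
  have hs := hB'.le_st k hk hkL
  have hj0 : j ≠ o := by
    rintro rfl
    rw [hq] at hjq
    have := hB'.inj _ _ le_rfl hB'.lt hs (by omega) hjq
    exact (hB'.en_o_lt_iff hk hkL).1 hek this.symm
  have hstk : ∀ {m}, o' ≤ m → m < L' → en' o' < m → en' o' + 1 ≤ st' m := by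
    intro m hm hmL hlt
    by_contra h
    have a1 := hB'.le_st m hm hmL
    have a2 := hB'.st_eq o' (st' m) le_rfl hB'.lt (hB'.st_o.le.trans a1) (by omega)
    have a3 := hB'.st_eq m (st' m) hm hmL le_rfl ((hB'.st_le m hm hmL).trans (hB'.le_en m hm hmL))
    exact (hB'.en_o_lt_iff hm hmL).1 hlt (by rw [← a3, a2, hB'.st_o])
  obtain ⟨j1, hj1, hj1L, hj1q, -, hfirst1⟩ := hO' (en' o' + 1) (by omega) he1
    ((hB'.en_o_lt_iff (by omega) he1).1 (by omega))
  have hst1 : st' (en' o' + 1) = en' o' + 1 :=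
    le_antisymm (hB'.st_le _ (by omega) he1) (hstk (by omega) he1 (by omega))
  rw [hst1] at hj1q hfirst1
  refine ⟨?_, he1⟩
  have hj10 : j1 ≠ o := by
    rintro rfl
    rw [hq] at hj1q
    have := hB'.inj _ _ le_rfl hB'.lt (by omega) he1 hj1q
    omega
  by_contra hne
  have hj11 : j1 ≠ o + 1 := by
    rintro rfl
    exact hne hj1q.symm
  -- The second block on the other axis is opened by the earliest vertex of this queue outside the
  -- first block there. If that were later than position `o + 1`, the vertex at `o + 1` would belong
  -- to the first block of the other axis, which `RootOK` excludes.
  obtain ⟨m, hm1, hm2, hm3⟩ := hfirst1 (o + 1) (by omega) (by omega)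
  exact (hR.far hf m hm1 (by omega)).1 hm3

/-- The edge has length at least `X - 1` along the axis and rises by at most `S`, since `q j` is
outside the first block of the other axis. An ordinary vertex in between is at most `S` away from
the root along the axis and at least 1 above it, so S² < X - 1 puts it above the edge. Other far
vertices lie in between only for `j = o + 1`, the most distant one; they are above the edge because
that vertex is lower than all others but the root, by `far_lowest`. -/
theorem edgeOK_far_first (K : Consts N S X ε) (hB : Blocks nb q st en o L)
    (hC : Coords N S X ε far base c q st en dl o L) (hB' : Blocks nb' q' st' en' o' L')
    (hC' : Coords N S X ε far base' d q' st' en' dl' o' L') (hV : Verts q o L = Verts q' o' L')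
    (hq : q o = q' o') (hO' : Opened ε q' st' dl' o' L' q dl o L)
    (hR : RootOK ε far q en dl o q' en' dl' o') (hf : far) {j : ℕ} (hj : j = o + 1 ∨ j = en o) :
    EdgeOK nb c d (Verts q o L) (q o) (q j) := by
  have h0 := hB.st_o
  have hoe := hB.st_lt_en o le_rfl hB.lt
  have heL := hB.en_lt o le_rfl hB.lt
  have hNS := K.N_le
  have hN := K.two_le
  have hXS := K.le_X
  have hX := K.S_add_two_le
  obtain ⟨hlow, he1⟩ := far_lowest hB hB' hV hq hO' hR hf
  have pos : ∀ {j}, o ≤ j → j < L → ∃ k, o' ≤ k ∧ k < L' ∧ q' k = q j := fun {j} h1 h2 => by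
    have : q j ∈ Verts q' o' L' := hV ▸ ⟨j, h1, h2, rfl⟩
    exact this
  have hoj : o < j ∧ j ≤ en o := by omega
  have hcj := hC.far_lt K hB hf hoj.1 hoj.2
  have hco := hC.far_o hf
  have hdo : d (q o) = base' := by rw [hq]; exact hC'.far_o hf
  have hdj : d (q j) ≤ base' + S ∧ base' + 1 ≤ d (q j) := by
    obtain ⟨k, hk, hkL, hkq⟩ := pos (j := j) (by omega) (by omega)
    have hlt : en' o' < k := by
      by_contra h
      have := hR.far hf k hk (by omega)
      rcases hj with rfl | rfl
      · exact this.1 hkq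
      · exact this.2 hkq
    rw [← hkq]
    exact ⟨hC'.le k hk hkL fun _ => hlt, hC'.far_base_le hf k hlt hkL⟩
  refine ⟨1, ?_⟩
  rintro z ⟨k, hk, hkL, rfl⟩ h1 h2
  have hko : o < k := lt_of_le_of_ne hk (by rintro rfl; exact lt_irrefl _ h1)
  have hdk : base' + 1 ≤ d (q k) := by
    obtain ⟨k', hk', hkL', hkq'⟩ := pos hk hkL
    rw [← hkq']
    rcases lt_or_ge (en' o') k' with h | h
    · exact hC'.far_base_le hf k' h hkL'
    · rcases hk'.eq_or_lt with rfl | hk'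
      · rw [← hq] at hkq'
        exact absurd (hB.inj _ _ le_rfl hB.lt hk hkL hkq') hko.ne
      · linarith [hC'.far_lt K hB' hf hk' h]
  rcases lt_or_ge (en o) k with hlt | hle
  · constructor
    · intro w hw
      obtain ⟨m, hm1, hm2, rfl, -⟩ := hB.nbr k w hk hkL hw
      have hm := hB.en_o_lt_of_mem hk hkL hm1 hm2 hlt
      have hmL := hm2.trans_lt (hB.en_lt k hk hkL)
      exact ⟨hco.le.trans (hC.base_le m (by omega) hmL), by linarith [hC.le m (by omega) hmL fun _ => hm]⟩
    · have h3 := hC.le k hk hkL fun _ => hlt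
      have t1 : (d (q j) - d (q o)) * (c (q k) - c (q o)) ≤ S * S :=
        mul_le_mul (by linarith) (by linarith) (by linarith) (by linarith)
      have t2 : X - 1 ≤ (d (q k) - d (q o)) * (c (q j) - c (q o)) := by nlinarith
      linarith
  · have hj1 : j = o + 1 := by
      rcases hj with h | rfl
      · exact h
      · exfalso
        rw [hC.far_eq hf k hko hle, hC.far_eq hf (en o) hoj.1 le_rfl] at h2
        have : (k : ℝ) ≤ en o := by exact_mod_cast hle
        nlinarith [hC.dl_pos o le_rfl hB.lt]
    subst hj1
    constructor
    · intro w hw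
      obtain ⟨m, hm1, hm2, rfl, -⟩ := hB.nbr k w hk hkL hw
      rw [hB.st_eq o k le_rfl hB.lt (by omega) hle, h0] at hm1
      rw [hB.en_eq o k le_rfl hB.lt (by omega) hle] at hm2
      refine ⟨hco.le.trans (hC.base_le m hm1 (by omega)), ?_⟩
      rcases hm1.eq_or_lt with rfl | hm1
      · linarith
      · rw [hC.far_eq hf m hm1 hm2, hC.far_eq hf (o + 1) hoj.1 hoj.2]
        have : ((o + 1 : ℕ) : ℝ) ≤ m := by exact_mod_cast hm1
        nlinarith [hC.dl_pos o le_rfl hB.lt]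
    · have hdk' : d (q (o + 1)) < d (q k) := by
        obtain ⟨k', hk', hkL', hkq'⟩ := pos hk hkL
        have hoe' := hB'.le_en o' le_rfl hB'.lt
        rw [← hlow, ← hkq']
        rcases lt_or_ge (en' o') k' with h | h
        · have hne : k' ≠ en' o' + 1 := by
            rintro rfl
            rw [hkq'] at hlow
            rw [hlow] at h2
            exact lt_irrefl _ h2
          linarith [hC'.mono (en' o' + 1) k' (by omega) (by omega) hkL' fun _ => by omega,
            hC'.dl_pos (en' o' + 1) (by omega) he1]
        · rcases hk'.eq_or_lt with rfl | hk'
          · rw [← hq] at hkq'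
            exact absurd (hB.inj _ _ le_rfl hB.lt hk hkL hkq') hko.ne
          · linarith [hC'.far_lt K hB' hf hk' h, hC'.le (en' o' + 1) (by omega) he1 fun _ => by omega]
      have t1 : (d (q (o + 1)) - d (q o)) * (c (q k) - c (q o)) ≤
          (d (q (o + 1)) - d (q o)) * (c (q (o + 1)) - c (q o)) :=
        mul_le_mul_of_nonneg_left (by linarith) (by linarith)
      have t2 : (d (q (o + 1)) - d (q o)) * (c (q (o + 1)) - c (q o)) <
          (d (q k) - d (q o)) * (c (q (o + 1)) - c (q o)) :=
        mul_lt_mul_of_pos_right (by linarith) (by linarith)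
      linarith

/-- A component is drawn correctly. -/
theorem drawn_component (K : Consts N S X ε) (hB : Blocks nb q st en o L)
    (hC : Coords N S X ε far base c q st en dl o L) (hB' : Blocks nb' q' st' en' o' L')
    (hC' : Coords N S X ε far base' d q' st' en' dl' o' L') (hV : Verts q o L = Verts q' o' L')
    (hq : q o = q' o') (hO : Opened ε q st dl o L q' dl' o' L') (hO' : Opened ε q' st' dl' o' L' q dl o L)
    (hR : RootOK ε far q en dl o q' en' dl' o') : Drawn nb c d (Verts q o L) := by
  constructor
  · rintro _ ⟨i, hi, hL, rfl⟩ _ ⟨j, hj, hjL, rfl⟩ e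
    rw [hC.injOn K hB hi hL hj hjL e]
  rintro _ ⟨i, hi, hL, rfl⟩ _ - hnb hlt
  obtain ⟨j, hj1, hj2, rfl, hj⟩ := hB.nbr i _ hi hL hnb
  have hs := hB.le_st i hi hL
  have hsi := hB.st_le i hi hL
  have hie := hB.le_en i hi hL
  have heL := hB.en_lt i hi hL
  have p := hC.dl_pos o le_rfl hB.lt
  -- On ordinary positions coordinates increase with the position. In a far first block they
  -- decrease, except that the root comes before all others.
  by_cases hn : far → en o < i
  · have hnj : far → en o < j := fun hf => hB.en_o_lt_of_mem hi hL hj1 hj2 (hn hf)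
    have hij : i < j := by
      rcases lt_trichotomy i j with h | rfl | h
      · exact h
      · exact absurd hlt (lt_irrefl _)
      · linarith [hC.mono j i (by omega) h hL hnj, hC.dl_pos j (by omega) (by omega)]
    have : j = i + 1 ∨ (i = st i ∧ j = en i) := by omega
    rcases this with rfl | ⟨h1, h2⟩
    · exact edgeOK_normal_succ K hB hC hi (by omega) hn
    · rw [h2, h1, hB.en_st hi hL]
      exact edgeOK_normal_closing K hB hC hB' hC' hV hq hO hR hi hL hn
  · rw [Classical.not_imp] at hn
    obtain ⟨hf, hn⟩ := hn
    have hsto : st i = o := (hB.en_o_lt_iff hi hL).not_left.1 hn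
    have hen : en i = en o := by rw [← hB.en_st hi hL, hsto]
    rw [hsto] at hj hj1
    rw [hen] at hj hj2
    rcases hi.eq_or_lt with rfl | hi
    · refine edgeOK_far_first K hB hC hB' hC' hV hq hO' hR hf ?_
      have := hB.st_lt_en o le_rfl hB.lt
      rcases hj with h | h | h | h
      · exact Or.inl h
      · omega
      · exact Or.inr h.2
      · omega
    · have hjo : o < j := by
        rcases hj1.eq_or_lt with rfl | h
        · linarith [hC.far_o hf, hC.base_le i hi.le hL]
        · exact h
      have hji : j < i := by
        by_contra h
        rw [hC.far_eq hf i hi (by omega), hC.far_eq hf j hjo hj2] at hlt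
        have : (i : ℝ) ≤ j := by exact_mod_cast not_lt.1 h
        nlinarith
      obtain rfl : i = j + 1 := by omega
      exact edgeOK_far_succ K hB hC hf hjo (by omega)

end

/-- All of `P` is to the left of `Q`, and edges do not leave either set, so no vertex of one set
lies between the ends of an edge in the other. -/
theorem Drawn.union {V : Type*} {nb : V → V → Prop} {c d : V → ℝ} {P Q : Set V} (h1 : Drawn nb c d P)
    (h2 : Drawn nb c d Q) (c1 : ∀ z ∈ P, ∀ w, nb z w → w ∈ P) (c2 : ∀ z ∈ Q, ∀ w, nb z w → w ∈ Q)
    (hlt : ∀ z ∈ P, ∀ w ∈ Q, c z < c w) : Drawn nb c d (P ∪ Q) := by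
  constructor
  · rintro z (hz | hz) w (hw | hw) e
    · exact h1.inj hz hw e
    · exact absurd e (hlt z hz w hw).ne
    · exact absurd e (hlt w hw z hz).ne'
    · exact h2.inj hz hw e
  · rintro a (ha | ha) b - hab lt
    · have hb := c1 a ha b hab
      obtain ⟨s, hs⟩ := h1.edge a ha b hb hab lt
      refine ⟨s, ?_⟩
      rintro z (hz | hz) h3 h4
      · exact hs z hz h3 h4
      · exact absurd h4 (hlt b hb z hz).not_gt
    · have hb := c2 a ha b hab
      obtain ⟨s, hs⟩ := h2.edge a ha b hb hab lt
      refine ⟨s, ?_⟩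
      rintro z (hz | hz) h3 h4
      · exact absurd h3 (hlt z hz a ha).not_gt
      · exact hs z hz h3 h4

/-- `EdgeOK` only restricts the vertices between two ends and their neighbours, so it passes to
subgraphs. This leads back from the doubled graph to the original one. -/
theorem Drawn.comap {V W : Type*} {nb : V → V → Prop} {c d : V → ℝ} {P : Set V} (h : Drawn nb c d P)
    {nb' : W → W → Prop} (ι : W → V) (hι : Function.Injective ι) (hP : ∀ v, ι v ∈ P)
    (hnb : ∀ v w, nb' v w → nb (ι v) (ι w)) :
    Drawn nb' (fun v => c (ι v)) (fun v => d (ι v)) Set.univ := by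
  refine ⟨fun v _ w _ e => hι (h.inj (hP v) (hP w) e), fun a _ b _ hab lt => ?_⟩
  obtain ⟨s, hs⟩ := h.edge _ (hP a) _ (hP b) (hnb a b hab) lt
  exact ⟨s, fun z _ h1 h2 => ⟨fun w hw => (hs _ (hP z) h1 h2).1 _ (hnb z w hw), (hs _ (hP z) h1 h2).2⟩⟩

/-! ### Cycles in 2-regular multigraphs -/

/-- A 2-regular multigraph without loops on the vertices below `N`; the two neighbours of `v` are `f v` and
`g v`. -/
structure TwoRegular (N : ℕ) (nb : ℕ → ℕ → Prop) (f g : ℕ → ℕ) : Prop where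
  nb_iff : ∀ v w, v < N → (nb v w ↔ w = f v ∨ w = g v)
  lt : ∀ v w, v < N → nb v w → w < N
  ne : ∀ v, v < N → ¬ nb v v
  symm : ∀ v w, v < N → nb v w → nb w v
  dbl : ∀ v, v < N → f v = g v → f (f v) = g (f v)

namespace TwoRegular

variable {N : ℕ} {nb : ℕ → ℕ → Prop} {f g : ℕ → ℕ} (h : TwoRegular N nb f g)
include h

theorem eq_or_eq {v a b w : ℕ} (hv : v < N) (ha : nb v a) (hb : nb v b) (hab : a ≠ b) (hw : nb v w) :
    w = a ∨ w = b := by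
  rw [h.nb_iff v _ hv] at ha hb hw
  omega

theorem nb_f {v : ℕ} (hv : v < N) : nb v (f v) := (h.nb_iff v _ hv).2 (Or.inl rfl)

theorem nb_g {v : ℕ} (hv : v < N) : nb v (g v) := (h.nb_iff v _ hv).2 (Or.inr rfl)

/-- A maximal path is a cycle. -/
theorem cycle_of_maximal_path {z : ℕ → ℕ} {k : ℕ} {M : ℕ → Prop}
    (hinj : ∀ i j, i ≤ k → j ≤ k → z i = z j → i = j) (hlt : ∀ i, i ≤ k → z i < N)
    (hnb : ∀ i, i < k → nb (z i) (z (i + 1))) (hM : ∀ v w, v < N → M v → nb v w → M w)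
    (hzM : ∀ i, i ≤ k → ¬ M (z i)) (hz1 : 0 < k → z 1 = f (z 0))
    (hmax : ∀ w, nb (z k) w → M w ∨ ∃ i, i ≤ k ∧ w = z i) :
    1 ≤ k ∧ z k = g (z 0) ∧ ∀ i w, i ≤ k → nb (z i) w →
      ∃ j, j ≤ k ∧ w = z j ∧ (j = i + 1 ∨ i = j + 1 ∨ (i = 0 ∧ j = k) ∨ (j = 0 ∧ i = k)) := by
  -- A neighbour of `z k` in the closed set `M` would put `z k` itself into `M`.
  have hmax' : ∀ w, nb (z k) w → ∃ i, i ≤ k ∧ w = z i := by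
    intro w hw
    rcases hmax w hw with h' | h'
    · have hwN := h.lt _ _ (hlt k le_rfl) hw
      exact absurd (hM w _ hwN h' (h.symm _ _ (hlt k le_rfl) hw)) (hzM k le_rfl)
    · exact h'
  have hk : 1 ≤ k := by
    by_contra hk
    obtain rfl : k = 0 := by omega
    obtain ⟨i, hi, e⟩ := hmax' _ (h.nb_f (hlt 0 le_rfl))
    obtain rfl : i = 0 := by omega
    have e' := h.nb_f (hlt 0 le_rfl)
    rw [e] at e'
    exact h.ne _ (hlt 0 le_rfl) e'
  have back : ∀ i, i < k → nb (z (i + 1)) (z i) := fun i hi => h.symm _ _ (hlt i hi.le) (hnb i hi)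
  have interior : ∀ i, 0 < i → i < k → ∀ w, nb (z i) w → w = z (i - 1) ∨ w = z (i + 1) := by
    intro i h0 hik w hw
    refine h.eq_or_eq (hlt i hik.le) ?_ (hnb i hik) ?_ hw
    · have := back (i - 1) (by omega)
      rwa [Nat.sub_add_cancel h0] at this
    · intro e
      have := hinj _ _ (by omega) (by omega) e
      omega
  have last : ∀ w, nb (z k) w → w = z (k - 1) ∨ w = z 0 := by
    intro w hw
    obtain ⟨i, hi, rfl⟩ := hmax' w hw
    by_cases h0 : i = 0
    · exact Or.inr (by rw [h0])
    rcases hi.eq_or_lt with rfl | hi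
    · exact absurd hw (h.ne _ (hlt _ le_rfl))
    · left
      rcases interior i (by omega) hi _ (h.symm _ _ (hlt k le_rfl) hw) with e | e
      · have := hinj _ _ le_rfl (by omega) e
        omega
      · have := hinj _ _ le_rfl (by omega) e
        rw [this, Nat.add_sub_cancel]
  have hk1 : k - 1 + 1 = k := by omega
  -- Otherwise both slots of `z k` hold `z (k - 1)`, and by `dbl` the two slots of `z (k - 1)` agree
  -- as well. For `k ≥ 2` this forces `z (k - 2) = z k`; for `k = 1` the edge back to `z 0` is the
  -- one wanted.
  have close : nb (z k) (z 0) := by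
    by_contra hc
    have e1 : f (z k) = z (k - 1) := (last _ (h.nb_f (hlt k le_rfl))).resolve_right fun e => by
      exact hc (e ▸ h.nb_f (hlt k le_rfl))
    have e2 : g (z k) = z (k - 1) := (last _ (h.nb_g (hlt k le_rfl))).resolve_right fun e => by
      exact hc (e ▸ h.nb_g (hlt k le_rfl))
    have e3 := h.dbl _ (hlt k le_rfl) (e1.trans e2.symm)
    rw [e1] at e3
    by_cases hk2 : k = 1
    · subst hk2
      exact hc (back 0 one_pos)
    · have n1 := back (k - 2) (by omega)
      have n2 := hnb (k - 1) (by omega)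
      rw [show k - 2 + 1 = k - 1 by omega] at n1
      rw [hk1] at n2
      rw [h.nb_iff _ _ (hlt _ (by omega)), ← e3, or_self] at n1 n2
      have := hinj _ _ (by omega) (by omega) (n1.trans n2.symm)
      omega
  have close' : nb (z 0) (z k) := h.symm _ _ (hlt k le_rfl) close
  -- A cycle of length two is a double edge, so both slots of `z 0` hold `z 1`.
  have single : k = 1 → f (z 0) = z 1 ∧ g (z 0) = z 1 := by
    rintro rfl
    have e1 : f (z 1) = z 0 := (last _ (h.nb_f (hlt 1 le_rfl))).elim id id
    have e2 : g (z 1) = z 0 := (last _ (h.nb_g (hlt 1 le_rfl))).elim id id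
    have e3 := h.dbl _ (hlt 1 le_rfl) (e1.trans e2.symm)
    rw [e1] at e3
    rw [h.nb_iff _ _ (hlt _ (by omega)), ← e3, or_self] at close'
    exact ⟨close'.symm, e3.symm.trans close'.symm⟩
  refine ⟨hk, ?_, ?_⟩
  · rcases hk.eq_or_lt with rfl | hk2
    · exact (single rfl).2.symm
    · rw [h.nb_iff _ _ (hlt _ (by omega)), ← hz1 hk] at close'
      rcases close' with e | e
      · have := hinj _ _ le_rfl hk e
        omega
      · exact e
  · intro i w hi hw
    rcases Nat.eq_zero_or_pos i with rfl | h0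
    · rcases hk.eq_or_lt with rfl | hk2
      · rw [h.nb_iff _ _ (hlt _ (by omega)), (single rfl).1, (single rfl).2, or_self] at hw
        exact ⟨1, le_rfl, hw, by omega⟩
      · rcases h.eq_or_eq (hlt 0 hi) (hnb 0 hk) close' (fun e => by
          have := hinj _ _ hk le_rfl e
          omega) hw with rfl | rfl
        · exact ⟨1, hk, rfl, by omega⟩
        · exact ⟨k, le_rfl, rfl, by omega⟩
    · rcases hi.eq_or_lt with rfl | hi
      · rcases last w hw with rfl | rfl
        · exact ⟨i - 1, by omega, rfl, by omega⟩
        · exact ⟨0, by omega, rfl, by omega⟩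
      · rcases interior i h0 hi w hw with rfl | rfl
        · exact ⟨i - 1, by omega, rfl, by omega⟩
        · exact ⟨i + 1, by omega, rfl, by omega⟩

omit h in
theorem swap (h : TwoRegular N nb f g) {f' g' : ℕ → ℕ}
    (hs : ∀ v, v < N → (f' v = f v ∧ g' v = g v) ∨ (f' v = g v ∧ g' v = f v)) : TwoRegular N nb f' g' := by
  refine ⟨fun v w hv => ?_, h.lt, h.ne, h.symm, fun v hv e => ?_⟩
  · rw [h.nb_iff v w hv]
    rcases hs v hv with ⟨h1, h2⟩ | ⟨h1, h2⟩ <;> rw [h1, h2]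
    exact or_comm
  · have e1 : f v = g v := by rcases hs v hv with ⟨h1, h2⟩ | ⟨h1, h2⟩ <;> omega
    have e2 : f' v = f v := by rcases hs v hv with ⟨h1, h2⟩ | ⟨h1, h2⟩ <;> omega
    have e3 := h.dbl v hv e1
    have := hs (f v) (h.lt _ _ hv (h.nb_f hv))
    rw [e2]
    omega

end TwoRegular

/-! ### Running programs -/

namespace RealRAM

/-- `P` halts when started in `s`, and the number of steps and the final configuration satisfy `Q`. -/
def Run (P : Program) (s : State) (Q : ℕ → State → Prop) : Prop := ∃ t s', Exec P s t s' ∧ Q t s'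

theorem Run.mono {P : Program} {s : State} {Q Q' : ℕ → State → Prop} (h : Run P s Q)
    (hQ : ∀ t s', Q t s' → Q' t s') : Run P s Q' := by
  obtain ⟨t, s', h1, h2⟩ := h
  exact ⟨t, s', h1, hQ _ _ h2⟩

/-- This and the next three equivalences act as weakest preconditions: rewriting with them executes
a program symbolically and adds up its steps. -/
theorem run_skip {s : State} {Q : ℕ → State → Prop} : Run .skip s Q ↔ Q 1 s :=
  ⟨fun ⟨_, _, h, hQ⟩ => by cases h; exact hQ, fun h => ⟨_, _, .skip s, h⟩⟩

theorem run_instr {c : Instr} {s : State} {Q : ℕ → State → Prop} : Run (.instr c) s Q ↔ Q 1 (c.run s) :=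
  ⟨fun ⟨_, _, h, hQ⟩ => by cases h; exact hQ, fun h => ⟨_, _, .instr c s, h⟩⟩

theorem run_seq {P R : Program} {s : State} {Q : ℕ → State → Prop} :
    Run (.seq P R) s Q ↔ Run P s fun t s' => Run R s' fun t' s'' => Q (t + t') s'' := by
  constructor
  · rintro ⟨_, _, h, hQ⟩
    cases h with
    | seq h1 h2 => exact ⟨_, _, h1, _, _, h2, hQ⟩
  · rintro ⟨_, _, h1, _, _, h2, hQ⟩
    exact ⟨_, _, .seq h1 h2, hQ⟩

theorem run_branch {b : Test} {P R : Program} {s : State} {Q : ℕ → State → Prop} :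
    Run (.branch b P R) s Q ↔ (b.Holds s → Run P s fun t s' => Q (t + 1) s') ∧
      (¬ b.Holds s → Run R s fun t s' => Q (t + 1) s') := by
  constructor
  · rintro ⟨_, _, h, hQ⟩
    cases h with
    | branch_true hb h => exact ⟨fun _ => ⟨_, _, h, hQ⟩, fun hb' => absurd hb hb'⟩
    | branch_false hb h => exact ⟨fun hb' => absurd hb' hb, fun _ => ⟨_, _, h, hQ⟩⟩
  · rintro ⟨h1, h2⟩
    by_cases hb : b.Holds s
    · obtain ⟨_, _, h, hQ⟩ := h1 hb
      exact ⟨_, _, .branch_true hb h, hQ⟩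
    · obtain ⟨_, _, h, hQ⟩ := h2 hb
      exact ⟨_, _, .branch_false hb h, hQ⟩

theorem run_loop_false {b : Test} {P : Program} {s : State} {Q : ℕ → State → Prop} (hb : ¬ b.Holds s)
    (hQ : Q 1 s) : Run (.loop b P) s Q := ⟨_, _, .loop_false hb, hQ⟩

theorem run_loop_true {b : Test} {P : Program} {s : State} {Q : ℕ → State → Prop} (hb : b.Holds s)
    (h : Run P s fun t s' => Run (.loop b P) s' fun t' s'' => Q (t + 1 + t') s'') : Run (.loop b P) s Q := by
  obtain ⟨_, _, h1, _, _, h2, hQ⟩ := h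
  exact ⟨_, _, .loop_true hb h1 h2, hQ⟩

/-- A loop with invariant `I` and potential `Φ`: each iteration is paid by the decrease of the potential. -/
theorem run_loop {b : Test} {P : Program} (I : State → Prop) (Φ : State → ℕ)
    (step : ∀ s, I s → b.Holds s → Run P s fun t s' => I s' ∧ t + 1 + Φ s' ≤ Φ s) {s : State} (hI : I s) :
    Run (.loop b P) s fun t s' => I s' ∧ ¬ b.Holds s' ∧ t + Φ s' ≤ Φ s + 1 := by
  induction hn : Φ s using Nat.strong_induction_on generalizing s with
  | _ n ih =>
    by_cases hb : b.Holds s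
    · refine run_loop_true hb ((step s hI hb).mono ?_)
      rintro t s' ⟨hI', hle⟩
      refine (ih (Φ s') (by omega) hI' rfl).mono ?_
      rintro t' s'' ⟨h1, h2, h3⟩
      exact ⟨h1, h2, by omega⟩
    · exact run_loop_false hb ⟨hI, hb, by omega⟩

infixr:60 " ;; " => Program.seq

/-! ### Memory layout

The argument `b` selects the first or the second graph. -/

/-- The arrays of the first neighbours. -/
def aF (b : Bool) : ℕ := cond b 8 6
/-- The arrays of the second neighbours. -/
def aG (b : Bool) : ℕ := cond b 9 7
/-- The arrays of marks; `p` selects the component numbers (`false`) or the marks of placed vertices. -/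
def aMk (b p : Bool) : ℕ := cond b (cond p 13 11) (cond p 12 10)
/-- The queues. -/
def aQ (b : Bool) : ℕ := cond b 15 14
/-- The lengths of the queues. -/
def rLen (b : Bool) : ℕ := cond b 15 14
/-- The first unprocessed positions of the queues. -/
def rPtr (b : Bool) : ℕ := cond b 17 16
/-- The real arrays of coordinates, and the real registers with the next coordinate. -/
def rX (b : Bool) : ℕ := cond b 1 0

/-- Place the vertex in register `10` and move on to its first free neighbour. -/
def walkBody (b p : Bool) : Program :=
  .instr (.store (aMk b p) 10 18) ;; .instr (.store (aQ b) (rLen b) 10) ;; .instr (.succ (rLen b) (rLen b)) ;;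
  .instr (.rstore (rX b) 10 (rX b)) ;; .instr (.radd (rX b) (rX b) 2) ;;
  .instr (.load 8 (aF b) 10) ;; .instr (.load 9 (aMk b p) 8) ;;
  .branch (.eq 9 3) (.instr (.copy 10 8)) (
    .instr (.load 8 (aG b) 10) ;; .instr (.load 9 (aMk b p) 8) ;;
    .branch (.eq 9 3) (.instr (.copy 10 8)) (.instr (.copy 13 3)))

/-- Place the cycle of the vertex in register `10`. -/
def walk (b p : Bool) : Program :=
  .instr (.copy 13 4) ;; .loop (.not (.eq 13 3)) (walkBody b p)

/-- `s'` differs from `s` only where `walk b p` writes. -/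
structure WalkFrame (b p : Bool) (s s' : State) : Prop where
  reg : ∀ r, r ≠ 8 → r ≠ 9 → r ≠ 10 → r ≠ 13 → r ≠ rLen b → s'.reg r = s.reg r
  arr : ∀ a, a ≠ aMk b p → a ≠ aQ b → s'.arr a = s.arr a
  rreg : ∀ r, r ≠ rX b → s'.rreg r = s.rreg r
  rarr : ∀ a, a ≠ rX b → s'.rarr a = s.rarr a

theorem WalkFrame.trans {b p : Bool} {s s' s'' : State} (h : WalkFrame b p s s') (h' : WalkFrame b p s' s'') :
    WalkFrame b p s s'' :=
  ⟨fun r h1 h2 h3 h4 h5 => (h'.reg r h1 h2 h3 h4 h5).trans (h.reg r h1 h2 h3 h4 h5),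
    fun a h1 h2 => (h'.arr a h1 h2).trans (h.arr a h1 h2), fun r h1 => (h'.rreg r h1).trans (h.rreg r h1),
    fun a h1 => (h'.rarr a h1).trans (h.rarr a h1)⟩

/-- The three outcomes are: the first slot leads to an unmarked vertex, only the second does, or
neither. The marks are read after the current vertex has been marked; in the last case register `13`
is cleared, which ends the loop. -/
theorem run_walkBody (b p : Bool) (s : State) (h3 : s.reg 3 = 0) :
    Run (walkBody b p) s fun t s' => t ≤ 13 ∧ WalkFrame b p s s' ∧ s'.reg (rLen b) = s.reg (rLen b) + 1 ∧
      s'.arr (aMk b p) = Function.update (s.arr (aMk b p)) (s.reg 10) (s.reg 18) ∧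
      s'.arr (aQ b) = Function.update (s.arr (aQ b)) (s.reg (rLen b)) (s.reg 10) ∧
      s'.rarr (rX b) = Function.update (s.rarr (rX b)) (s.reg 10) (s.rreg (rX b)) ∧
      s'.rreg (rX b) = s.rreg (rX b) + s.rreg 2 ∧
      ((s'.arr (aMk b p) (s.arr (aF b) (s.reg 10)) = 0 ∧ s'.reg 10 = s.arr (aF b) (s.reg 10) ∧
          s'.reg 13 = s.reg 13) ∨
        (s'.arr (aMk b p) (s.arr (aF b) (s.reg 10)) ≠ 0 ∧ s'.arr (aMk b p) (s.arr (aG b) (s.reg 10)) = 0 ∧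
          s'.reg 10 = s.arr (aG b) (s.reg 10) ∧ s'.reg 13 = s.reg 13) ∨
        (s'.arr (aMk b p) (s.arr (aF b) (s.reg 10)) ≠ 0 ∧ s'.arr (aMk b p) (s.arr (aG b) (s.reg 10)) ≠ 0 ∧
          s'.reg 10 = s.reg 10 ∧ s'.reg 13 = 0)) := by
  have frame : ∀ s' : State, (∀ r, r ≠ 8 → r ≠ 9 → r ≠ 10 → r ≠ 13 → r ≠ rLen b → s'.reg r = s.reg r) →
      (∀ a, a ≠ aMk b p → a ≠ aQ b → s'.arr a = s.arr a) → (∀ r, r ≠ rX b → s'.rreg r = s.rreg r) →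
      (∀ a, a ≠ rX b → s'.rarr a = s.rarr a) → WalkFrame b p s s' := fun s' h1 h2 h3 h4 => ⟨h1, h2, h3, h4⟩
  cases b <;> cases p <;>
  · simp only [walkBody, aF, aG, aMk, aQ, rLen, rX, cond] at frame ⊢
    simp only [run_seq, run_instr, run_branch, Test.Holds, Instr.run, State.setReg, State.setRReg,
      Function.update_apply, h3, Nat.reduceEqDiff, if_true, if_false]
    refine ⟨fun h => ⟨by omega, frame _ ?_ ?_ ?_ ?_, ?_⟩, fun h => ⟨fun h' => ⟨by omega, frame _ ?_ ?_ ?_ ?_, ?_⟩,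
      fun h' => ⟨by omega, frame _ ?_ ?_ ?_ ?_, ?_⟩⟩⟩ <;>
    simp +contextual [h] <;> simp_all

end RealRAM

/-! ### Tracing a cycle -/

namespace RealRAM

theorem aF_ne_aMk (b b' p : Bool) : aF b ≠ aMk b' p := by cases b <;> cases p <;> cases b' <;> decide
theorem aG_ne_aMk (b b' p : Bool) : aG b ≠ aMk b' p := by cases b <;> cases p <;> cases b' <;> decide
theorem aF_ne_aQ (b b' : Bool) : aF b ≠ aQ b' := by cases b <;> cases b' <;> decide
theorem aG_ne_aQ (b b' : Bool) : aG b ≠ aQ b' := by cases b <;> cases b' <;> decide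

/-- The state after `z 0, …, z (k - 1)` have been placed. -/
structure WalkDone (b p : Bool) (z : ℕ → ℕ) (s s' : State) (k : ℕ) : Prop extends WalkFrame b p s s' where
  len : s'.reg (rLen b) = s.reg (rLen b) + k
  q_old : ∀ i, i < s.reg (rLen b) → s'.arr (aQ b) i = s.arr (aQ b) i
  q_new : ∀ i, i < k → s'.arr (aQ b) (s.reg (rLen b) + i) = z i
  mk_new : ∀ i, i < k → s'.arr (aMk b p) (z i) = s.reg 18
  mk_old : ∀ w, (∀ i, i < k → z i ≠ w) → s'.arr (aMk b p) w = s.arr (aMk b p) w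
  x_new : ∀ i, i < k → s'.rarr (rX b) (z i) = s.rreg (rX b) + i * s.rreg 2
  x_old : ∀ w, (∀ i, i < k → z i ≠ w) → s'.rarr (rX b) w = s.rarr (rX b) w
  xc : s'.rreg (rX b) = s.rreg (rX b) + k * s.rreg 2

theorem WalkDone.zero (b p : Bool) (z : ℕ → ℕ) (s s' : State) (h : WalkFrame b p s s')
    (h1 : s'.reg (rLen b) = s.reg (rLen b)) (h2 : s'.arr = s.arr) (h3 : s'.rarr = s.rarr)
    (h4 : s'.rreg = s.rreg) : WalkDone b p z s s' 0 := by
  refine ⟨h, h1, ?_, ?_, ?_, ?_, ?_, ?_, ?_⟩ <;> simp [h2, h3, h4]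

theorem WalkDone.succ {b p : Bool} {z : ℕ → ℕ} {s s' s'' : State} {k : ℕ} (h : WalkDone b p z s s' k)
    (hinj : ∀ i, i < k → z i ≠ z k) (hcur : s'.reg 10 = z k) (hf : WalkFrame b p s' s'')
    (h1 : s''.reg (rLen b) = s'.reg (rLen b) + 1)
    (h2 : s''.arr (aMk b p) = Function.update (s'.arr (aMk b p)) (s'.reg 10) (s'.reg 18))
    (h3 : s''.arr (aQ b) = Function.update (s'.arr (aQ b)) (s'.reg (rLen b)) (s'.reg 10))
    (h4 : s''.rarr (rX b) = Function.update (s'.rarr (rX b)) (s'.reg 10) (s'.rreg (rX b)))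
    (h5 : s''.rreg (rX b) = s'.rreg (rX b) + s'.rreg 2) : WalkDone b p z s s'' (k + 1) := by
  have e18 : s'.reg 18 = s.reg 18 := h.reg _ (by decide) (by decide) (by decide) (by decide) (by cases b <;> decide)
  have e2 : s'.rreg 2 = s.rreg 2 := h.rreg _ (by cases b <;> decide)
  refine ⟨h.toWalkFrame.trans hf, by rw [h1, h.len, add_assoc], ?_, ?_, ?_, ?_, ?_, ?_, ?_⟩
  · intro i hi
    rw [h3, Function.update_of_ne (by rw [h.len]; omega), h.q_old i hi]
  · intro i hi
    rw [h3, h.len]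
    rcases Nat.lt_succ_iff_lt_or_eq.1 hi with hi | rfl
    · rw [Function.update_of_ne (by omega), h.q_new i hi]
    · rw [Function.update_self, hcur]
  · intro i hi
    rw [h2, hcur, e18]
    rcases Nat.lt_succ_iff_lt_or_eq.1 hi with hi | rfl
    · rw [Function.update_of_ne (hinj i hi), h.mk_new i hi]
    · rw [Function.update_self]
  · intro w hw
    rw [h2, hcur, Function.update_of_ne (hw k (by omega)).symm, h.mk_old w fun i hi => hw i (by omega)]
  · intro i hi
    rw [h4, hcur]
    rcases Nat.lt_succ_iff_lt_or_eq.1 hi with hi | rfl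
    · rw [Function.update_of_ne (hinj i hi), h.x_new i hi]
    · rw [Function.update_self, h.xc]
  · intro w hw
    rw [h4, hcur, Function.update_of_ne (hw k (by omega)).symm, h.x_old w fun i hi => hw i (by omega)]
  · rw [h5, h.xc, e2]; push_cast; ring

/-- What `walk` has achieved when it has placed the cycle `z 0, …, z m`. -/
structure WalkPost (b p : Bool) (N : ℕ) (nb : ℕ → ℕ → Prop) (z : ℕ → ℕ) (s s' : State) (m : ℕ) : Prop
    extends WalkDone b p z s s' (m + 1) where
  pos : 1 ≤ m
  head : z 0 = s.reg 10
  second : z 1 = s.arr (aF b) (z 0)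
  last : z m = s.arr (aG b) (z 0)
  cur : s'.reg 10 = z m
  inj : ∀ i j, i ≤ m → j ≤ m → z i = z j → i = j
  lt : ∀ i, i ≤ m → z i < N
  free : ∀ i, i ≤ m → s.arr (aMk b p) (z i) = 0
  succ : ∀ i, i < m → nb (z i) (z (i + 1))
  nbr : ∀ i w, i ≤ m → nb (z i) w →
    ∃ j, j ≤ m ∧ w = z j ∧ (j = i + 1 ∨ i = j + 1 ∨ (i = 0 ∧ j = m) ∨ (j = 0 ∧ i = m))

theorem le_of_injective_path {z : ℕ → ℕ} {k N : ℕ} (hinj : ∀ i j, i ≤ k → j ≤ k → z i = z j → i = j)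
    (hlt : ∀ i, i ≤ k → z i < N) : k + 1 ≤ N := by
  have := Finset.card_le_card_of_injOn (s := Finset.range (k + 1)) (t := Finset.range N) z
    (fun i hi => by simp at hi ⊢; exact hlt i (by omega))
    (fun i hi j hj e => by simp at hi hj; exact hinj i j (by omega) (by omega) e)
  simpa using this

/-- The vertices visited form an injective path below `N`, so at most `N` iterations are possible;
`d` bounds the number still to come. When no neighbour is free, the path is maximal outside the
vertices marked before, and `cycle_of_maximal_path` identifies it as a whole cycle. -/
theorem run_walk_loop {b p : Bool} {N : ℕ} {nb : ℕ → ℕ → Prop} {s : State}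
    (h3 : s.reg 3 = 0) (h18 : s.reg 18 ≠ 0) (hT : TwoRegular N nb (s.arr (aF b)) (s.arr (aG b)))
    (hM : ∀ v w, v < N → s.arr (aMk b p) v ≠ 0 → nb v w → s.arr (aMk b p) w ≠ 0) (d : ℕ) :
    ∀ (k : ℕ) (z : ℕ → ℕ) (s' : State), N ≤ k + d → WalkDone b p z s s' k → s'.reg 13 ≠ 0 → s'.reg 10 = z k →
      (∀ i j, i ≤ k → j ≤ k → z i = z j → i = j) → (∀ i, i ≤ k → z i < N) →
      (∀ i, i ≤ k → s.arr (aMk b p) (z i) = 0) → (∀ i, i < k → nb (z i) (z (i + 1))) →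
      (0 < k → z 1 = s.arr (aF b) (z 0)) → z 0 = s.reg 10 →
      Run (.loop (.not (.eq 13 3)) (walkBody b p)) s' fun t s'' =>
        ∃ z m, WalkPost b p N nb z s s'' m ∧ t + 14 * k ≤ 14 * (m + 1) + 1 := by
  induction d with
  | zero =>
    intro k z s' hk hD h13 hcur hinj hlt
    have := le_of_injective_path hinj hlt
    omega
  | succ d ih =>
    intro k z s' hk hD h13 hcur hinj hlt hfree hsucc hsec hhead
    have h3' : s'.reg 3 = 0 := by
      rw [hD.reg _ (by decide) (by decide) (by decide) (by decide) (by cases b <;> decide), h3]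
    have eF : s'.arr (aF b) = s.arr (aF b) := hD.arr _ (aF_ne_aMk _ _ _) (aF_ne_aQ _ _)
    have eG : s'.arr (aG b) = s.arr (aG b) := hD.arr _ (aG_ne_aMk _ _ _) (aG_ne_aQ _ _)
    have hzk := hlt k le_rfl
    refine run_loop_true (by simpa [Test.Holds, h3'] using h13) ((run_walkBody b p s' h3').mono ?_)
    rintro t s'' ⟨ht, hf, b1, b2, b3, b4, b5, hcase⟩
    have hD' := hD.succ (fun i hi e => by have := hinj i k hi.le le_rfl e; omega) hcur hf b1 b2 b3 b4 b5
    rw [eF, eG, hcur] at hcase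
    have h3'' : s''.reg 3 = 0 := by
      rw [hf.reg _ (by decide) (by decide) (by decide) (by decide) (by cases b <;> decide), h3']
    -- One more iteration: the path is prolonged by the free neighbour `w`, which is new because
    -- visited vertices carry the nonzero mark of register `18`.
    have go : ∀ w, nb (z k) w → s''.arr (aMk b p) w = 0 → s''.reg 10 = w → s''.reg 13 = s'.reg 13 →
        (k = 0 → w = s.arr (aF b) (z 0)) →
        Run (.loop (.not (.eq 13 3)) (walkBody b p)) s'' fun t' s'' =>
          ∃ z m, WalkPost b p N nb z s s'' m ∧ t + 1 + t' + 14 * k ≤ 14 * (m + 1) + 1 := by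
      intro w hw hmk hc h13' hsec'
      have hfresh : ∀ i, i < k + 1 → z i ≠ w := by
        rintro i hi rfl
        rw [hD'.mk_new i hi] at hmk
        exact h18 hmk
      have hz' : ∀ i, i < k + 1 → Function.update z (k + 1) w i = z i := fun i hi =>
        Function.update_of_ne (by omega) _ _
      have hz'' : Function.update z (k + 1) w (k + 1) = w := Function.update_self ..
      refine (ih (k + 1) (Function.update z (k + 1) w) s'' (by omega) ?_ (by rw [h13']; exact h13)
        (by rw [hc, hz'']) ?_ ?_ ?_ ?_ ?_ ?_).mono ?_
      · exact ⟨hD'.toWalkFrame, hD'.len, hD'.q_old, fun i hi => by rw [hz' i hi]; exact hD'.q_new i hi,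
          fun i hi => by rw [hz' i hi]; exact hD'.mk_new i hi,
          fun v hv => hD'.mk_old v fun i hi => by rw [← hz' i hi]; exact hv i hi,
          fun i hi => by rw [hz' i hi]; exact hD'.x_new i hi,
          fun v hv => hD'.x_old v fun i hi => by rw [← hz' i hi]; exact hv i hi, hD'.xc⟩
      · intro i j hi hj e
        rcases Nat.lt_or_eq_of_le hi with hi | rfl <;> rcases Nat.lt_or_eq_of_le hj with hj | rfl
        · rw [hz' i hi, hz' j hj] at e
          exact hinj i j (by omega) (by omega) e
        · rw [hz' i hi, hz''] at e
          exact absurd e (hfresh i hi)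
        · rw [hz' j hj, hz''] at e
          exact absurd e.symm (hfresh j hj)
        · rfl
      · intro i hi
        rcases Nat.lt_or_eq_of_le hi with hi | rfl
        · rw [hz' i hi]; exact hlt i (by omega)
        · rw [hz'']; exact hT.lt _ _ hzk hw
      · intro i hi
        rcases Nat.lt_or_eq_of_le hi with hi | rfl
        · rw [hz' i hi]; exact hfree i (by omega)
        · rw [hz'', ← hD'.mk_old w hfresh, hmk]
      · intro i hi
        rw [hz' i (by omega)]
        rcases Nat.lt_or_eq_of_le (Nat.lt_succ_iff.1 hi) with hi | rfl
        · rw [hz' (i + 1) (by omega)]; exact hsucc i hi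
        · rw [hz'']; exact hw
      · intro _
        rw [hz' 0 (by omega)]
        rcases Nat.eq_zero_or_pos k with rfl | hk0
        · rw [hz'']; exact hsec' rfl
        · rw [hz' 1 (by omega)]; exact hsec hk0
      · rw [hz' 0 (by omega), hhead]
      · rintro t' s3 ⟨z2, m, hp, hle⟩
        exact ⟨z2, m, hp, by omega⟩
    rcases hcase with ⟨c1, c2, c3⟩ | ⟨c1, c2, c3, c4⟩ | ⟨c1, c2, c3, c4⟩
    · refine go _ (hT.nb_f hzk) c1 c2 c3 ?_
      rintro rfl; rfl
    · refine go _ (hT.nb_g hzk) c2 c3 c4 ?_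
      rintro rfl
      -- The first vertex never leaves through its second slot: its first neighbour is a different
      -- vertex, and it is unmarked because the old marks are closed under adjacency.
      exfalso
      have hne : ∀ i, i < 0 + 1 → z i ≠ s.arr (aF b) (z 0) := by
        intro i hi e
        obtain rfl : i = 0 := by omega
        have := hT.nb_f hzk
        rw [← e] at this
        exact hT.ne _ hzk this
      rw [hD'.mk_old _ hne] at c1
      exact hM _ _ (hT.lt _ _ hzk (hT.nb_f hzk)) c1 (hT.symm _ _ hzk (hT.nb_f hzk)) (hfree 0 le_rfl)
    · refine run_loop_false (by simp [Test.Holds, h3'', c4]) ?_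
      have key : ∀ w, s''.arr (aMk b p) w ≠ 0 → s.arr (aMk b p) w ≠ 0 ∨ ∃ i, i ≤ k ∧ w = z i := by
        intro w hw
        by_cases hex : ∃ i, i ≤ k ∧ w = z i
        · exact Or.inr hex
        · left
          rwa [hD'.mk_old w fun i hi e => hex ⟨i, by omega, e.symm⟩] at hw
      obtain ⟨r1, r2, r3⟩ := hT.cycle_of_maximal_path (M := fun v => s.arr (aMk b p) v ≠ 0) hinj hlt hsucc hM
        (fun i hi h => h (hfree i hi)) hsec fun w hw => by
          rw [hT.nb_iff _ _ hzk] at hw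
          rcases hw with rfl | rfl
          · exact key _ c1
          · exact key _ c2
      exact ⟨z, k, ⟨hD', r1, hhead, hsec r1, r2, c3.trans rfl, hinj, hlt, hfree, hsucc, r3⟩, by omega⟩

theorem run_walk {b p : Bool} {N : ℕ} {nb : ℕ → ℕ → Prop} {s : State}
    (h3 : s.reg 3 = 0) (h4 : s.reg 4 = 1) (h18 : s.reg 18 ≠ 0)
    (hT : TwoRegular N nb (s.arr (aF b)) (s.arr (aG b)))
    (hM : ∀ v w, v < N → s.arr (aMk b p) v ≠ 0 → nb v w → s.arr (aMk b p) w ≠ 0)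
    (hlt : s.reg 10 < N) (hfree : s.arr (aMk b p) (s.reg 10) = 0) :
    Run (walk b p) s fun t s' => ∃ z m, WalkPost b p N nb z s s' m ∧ t ≤ 14 * (m + 1) + 2 := by
  rw [walk, run_seq, run_instr]
  refine (run_walk_loop h3 h18 hT hM N 0 (fun _ => s.reg 10) ((Instr.copy 13 4).run s) (by omega) (WalkDone.zero _ _ _ _ _ ?_ ?_ rfl rfl rfl)
    ?_ ?_ ?_ ?_ ?_ ?_ ?_ rfl).mono ?_
  · refine ⟨fun r h1 h2 h3 h4 h5 => ?_, fun _ _ _ => rfl, fun _ _ => rfl, fun _ _ => rfl⟩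
    simp [Instr.run, State.setReg, h4]
  · cases b <;> simp [Instr.run, State.setReg, rLen]
  · simp [Instr.run, State.setReg, h4]
  · simp [Instr.run, State.setReg]
  · intros; omega
  · exact fun _ _ => hlt
  · exact fun _ _ => hfree
  · intro i hi; omega
  · intro hi; omega
  · rintro t s' ⟨z, m, h, hle⟩
    exact ⟨z, m, h, by omega⟩

end RealRAM

/-! ### Appending a block -/

/-- `f` below `L` and `a` from `L` on. -/
def extend {α : Type*} (L : ℕ) (f : ℕ → α) (a : α) (i : ℕ) : α := if i < L then f i else a

theorem extend_lt {α : Type*} {L i : ℕ} {f : ℕ → α} {a : α} (h : i < L) : extend L f a i = f i := if_pos h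

theorem extend_ge {α : Type*} {L i : ℕ} {f : ℕ → α} {a : α} (h : L ≤ i) : extend L f a i = a :=
  if_neg h.not_gt

theorem PreBlocks.empty (nb : ℕ → ℕ → Prop) (q st en : ℕ → ℕ) (o : ℕ) : PreBlocks nb q st en o o := by
  constructor <;> intros <;> omega

theorem PreBlocks.append {nb : ℕ → ℕ → Prop} {q q' st en z : ℕ → ℕ} {o L m : ℕ} (h : PreBlocks nb q st en o L)
    (hoL : o ≤ L) (hm : 1 ≤ m) (hold : ∀ i, o ≤ i → i < L → q' i = q i) (hnew : ∀ i, i ≤ m → q' (L + i) = z i)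
    (hinj : ∀ i j, i ≤ m → j ≤ m → z i = z j → i = j) (hfresh : ∀ i j, o ≤ i → i < L → j ≤ m → q i ≠ z j)
    (hnbr : ∀ i w, i ≤ m → nb (z i) w → ∃ j, j ≤ m ∧ w = z j ∧
      (j = i + 1 ∨ i = j + 1 ∨ (i = 0 ∧ j = m) ∨ (j = 0 ∧ i = m))) :
    PreBlocks nb q' (extend L st L) (extend L en (L + m)) o (L + m + 1) := by
  have hnew' : ∀ i, L ≤ i → i < L + m + 1 → q' i = z (i - L) := fun i h1 h2 => by
    rw [← hnew (i - L) (by omega), Nat.add_sub_cancel' h1]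
  refine ⟨?_, ?_, ?_, ?_, ?_, ?_, ?_, ?_, ?_⟩
  · intro i j hi hiL hj hjL e
    rcases lt_or_ge i L with h1 | h1 <;> rcases lt_or_ge j L with h2 | h2
    · rw [hold i hi h1, hold j hj h2] at e
      exact h.inj i j hi h1 hj h2 e
    · rw [hold i hi h1, hnew' j h2 hjL] at e
      exact absurd e (hfresh i _ hi h1 (by omega))
    · rw [hold j hj h2, hnew' i h1 hiL] at e
      exact absurd e.symm (hfresh j _ hj h2 (by omega))
    · rw [hnew' i h1 hiL, hnew' j h2 hjL] at e
      have := hinj _ _ (by omega) (by omega) e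
      omega
  · intro i hi hiL
    rcases lt_or_ge i L with h1 | h1
    · rw [extend_lt h1]; exact h.le_st i hi h1
    · rw [extend_ge h1]; exact hoL
  · intro i hi hiL
    rcases lt_or_ge i L with h1 | h1
    · rw [extend_lt h1]; exact h.st_le i hi h1
    · rw [extend_ge h1]; exact h1
  · intro i hi hiL
    rcases lt_or_ge i L with h1 | h1
    · rw [extend_lt h1]; exact h.le_en i hi h1
    · rw [extend_ge h1]; omega
  · intro i hi hiL
    rcases lt_or_ge i L with h1 | h1
    · rw [extend_lt h1]; have := h.en_lt i hi h1; omega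
    · rw [extend_ge h1]; omega
  · intro i hi hiL
    rcases lt_or_ge i L with h1 | h1
    · rw [extend_lt h1, extend_lt h1]; exact h.st_lt_en i hi h1
    · rw [extend_ge h1, extend_ge h1]; omega
  · intro i j hi hiL
    rcases lt_or_ge i L with h1 | h1
    · rw [extend_lt h1, extend_lt h1]
      intro h2 h3
      have := h.en_lt i hi h1
      rw [extend_lt (by omega)]
      exact h.st_eq i j hi h1 h2 h3
    · rw [extend_ge h1]
      intro h2 h3
      rw [extend_ge h2]
  · intro i j hi hiL
    rcases lt_or_ge i L with h1 | h1
    · rw [extend_lt h1, extend_lt h1]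
      intro h2 h3
      have := h.en_lt i hi h1
      rw [extend_lt (by omega)]
      exact h.en_eq i j hi h1 h2 h3
    · rw [extend_ge h1, extend_ge h1]
      intro h2 h3
      rw [extend_ge h2]
  · intro i w hi hiL hw
    rcases lt_or_ge i L with h1 | h1
    · rw [extend_lt h1, extend_lt h1]
      rw [hold i hi h1] at hw
      obtain ⟨j, h2, h3, rfl, h4⟩ := h.nbr i w hi h1 hw
      have := h.en_lt i hi h1
      have := h.le_st i hi h1
      exact ⟨j, h2, h3, (hold j (by omega) (by omega)).symm, h4⟩
    · rw [extend_ge h1, extend_ge h1]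
      rw [hnew' i h1 hiL] at hw
      obtain ⟨j, h2, rfl, h4⟩ := hnbr _ w (by omega) hw
      exact ⟨L + j, by omega, by omega, (hnew j h2).symm, by omega⟩

theorem Coords.empty (N S X ε base : ℝ) (c : ℕ → ℝ) (q st en : ℕ → ℕ) (dl : ℕ → ℝ) (o : ℕ) :
    Coords N S X ε False base c q st en dl o o := by
  constructor <;> intros <;> first | omega | tauto

/-- The new block starts at `xc`, advances by `δ`, and its last vertex is one unit further. Since `m
* δ` is at most 1, it ends at or before `xc + 2`, hence within `base + S`, and all earlier ordinary
vertices are at least one unit to the left of `xc`. -/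
theorem Coords.append {N S X ε : ℝ} {far : Prop} {base : ℝ} {nb : ℕ → ℕ → Prop} {c c' : ℕ → ℝ}
    {q q' st en z : ℕ → ℕ} {dl : ℕ → ℝ} {o L m : ℕ} {xc δ : ℝ} (K : Consts N S X ε)
    (h : Coords N S X ε far base c q st en dl o L) (hB : PreBlocks nb q st en o L)
    (hm : 1 ≤ m) (hold : ∀ i, o ≤ i → i < L → q' i = q i) (hnew : ∀ i, i ≤ m → q' (L + i) = z i)
    (hcold : ∀ i, o ≤ i → i < L → c' (q i) = c (q i)) (hcnew : ∀ i, i < m → c' (z i) = xc + i * δ)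
    (hclast : c' (z m) = xc + m * δ + 1) (hδ : 0 < δ) (hδε : δ ≤ ε) (hmN : (m : ℝ) ≤ N)
    (hxc : ∀ i, o ≤ i → i < L → (far → en o < i) → c (q i) + 1 ≤ xc) (hbase : base ≤ xc)
    (hfar : far → o < L ∧ base + 1 ≤ xc) (hS : xc + 2 ≤ base + S) :
    Coords N S X ε far base c' q' (extend L st L) (extend L en (L + m)) (extend L dl δ) o (L + m + 1) := by
  have hmδ : (m : ℝ) * δ ≤ 1 := (mul_le_mul_of_nonneg_right hmN hδ.le).trans (K.mul_N_le hδε)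
  have hold' : ∀ i, o ≤ i → i < L → c' (q' i) = c (q i) := fun i h1 h2 => by rw [hold i h1 h2, hcold i h1 h2]
  have hnew' : ∀ i, L ≤ i → i < L + m → c' (q' i) = xc + ((i : ℝ) - L) * δ := fun i h1 h2 => by
    obtain ⟨j, rfl⟩ := Nat.exists_eq_add_of_le h1
    rw [hnew j (by omega), hcnew j (by omega)]; push_cast; ring
  have hlast : c' (q' (L + m)) = xc + m * δ + 1 := by rw [hnew m le_rfl, hclast]
  have hge : ∀ i, L ≤ i → i < L + m + 1 → xc ≤ c' (q' i) := fun i h1 h2 => by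
    rcases Nat.lt_or_eq_of_le (Nat.lt_succ_iff.1 h2) with h2 | rfl
    · rw [hnew' i h1 h2]
      have : (L : ℝ) ≤ i := by exact_mod_cast h1
      nlinarith
    · rw [hlast]
      have : 0 ≤ (m : ℝ) * δ := by positivity
      linarith
  have hen : far → extend L en (L + m) o = en o := fun hf => extend_lt (hfar hf).1
  have hstep : ∀ i j, L ≤ i → i < j → j < L + m + 1 → c' (q' i) + δ ≤ c' (q' j) := fun i j h1 h2 h3 => by
    rw [hnew' i h1 (by omega)]
    have e : (i : ℝ) + 1 ≤ j := by exact_mod_cast h2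
    rcases Nat.lt_or_eq_of_le (Nat.lt_succ_iff.1 h3) with h3 | rfl
    · rw [hnew' j (by omega) h3]
      nlinarith
    · rw [hlast]
      push_cast at e
      nlinarith
  refine ⟨?_, ?_, ?_, ?_, ?_, ?_, ?_, ?_, ?_, ?_, ?_, ?_⟩
  · intro i hi hiL
    rcases lt_or_ge i L with h1 | h1
    · rw [extend_lt h1]; exact h.dl_pos i hi h1
    · rw [extend_ge h1]; exact hδ
  · intro i hi hiL
    rcases lt_or_ge i L with h1 | h1
    · rw [extend_lt h1]; exact h.dl_le i hi h1
    · rw [extend_ge h1]; exact hδε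
  · intro i hi hiL
    rcases lt_or_ge i L with h1 | h1
    · rw [extend_lt h1, extend_lt h1, extend_lt ((hB.st_le i hi h1).trans_lt h1)]; exact h.dl_eq i hi h1
    · rw [extend_ge h1, extend_ge h1, extend_ge le_rfl]
  · intro i hi hiL
    rcases lt_or_ge i L with h1 | h1
    · rw [hold' i hi h1]; exact h.base_le i hi h1
    · exact hbase.trans (hge i h1 hiL)
  · intro hf i hi hiL
    rw [hen hf] at hi
    rcases lt_or_ge i L with h1 | h1
    · have := hB.le_en o le_rfl (hfar hf).1
      rw [hold' i (by omega) h1]; exact h.far_base_le hf i hi h1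
    · exact (hfar hf).2.trans (hge i h1 hiL)
  · intro i hi hiL hn
    rcases lt_or_ge i L with h1 | h1
    · rw [hold' i hi h1]; exact h.le i hi h1 fun hf => hen hf ▸ hn hf
    · rcases Nat.lt_or_eq_of_le (Nat.lt_succ_iff.1 hiL) with h2 | rfl
      · rw [hnew' i h1 h2]
        have : (i : ℝ) ≤ L + m := by exact_mod_cast h2.le
        nlinarith
      · rw [hlast]; linarith
  · intro i j hi hij hj hn
    rcases lt_or_ge i L with h1 | h1
    · rw [extend_lt h1, hold' i hi h1]
      rcases lt_or_ge j L with h2 | h2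
      · rw [hold' j (by omega) h2]; exact h.mono i j hi hij h2 fun hf => hen hf ▸ hn hf
      · have := hxc i hi h1 fun hf => hen hf ▸ hn hf
        have := K.le_one (h.dl_le i hi h1)
        have := hge j h2 hj
        linarith
    · rw [extend_ge h1]; exact hstep i j h1 hij hj
  · intro i hi hiL hlt hn
    rcases lt_or_ge i L with h1 | h1
    · rw [extend_lt h1] at hlt
      have := hB.le_st i hi h1
      have := hB.st_le i hi h1
      rw [extend_lt h1, extend_lt h1, hold' i hi h1, hold' (st i) (by omega) (by omega)]
      exact h.near i hi h1 hlt fun hf => hen hf ▸ hn hf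
    · rw [extend_ge h1] at hlt
      rw [extend_ge h1, extend_ge h1, hnew' i h1 hlt, hnew' L le_rfl (by omega)]
      have : (i : ℝ) ≤ L + m := by exact_mod_cast hlt.le
      nlinarith
  · intro i hi hiL hn
    rcases lt_or_ge i L with h1 | h1
    · have := hB.le_st i hi h1
      have := hB.st_le i hi h1
      have := hB.le_en i hi h1
      have := hB.en_lt i hi h1
      rw [extend_lt h1, extend_lt h1, hold' (st i) (by omega) (by omega), hold' (en i) (by omega) (by omega)]
      exact h.gap i hi h1 fun hf => hen hf ▸ hn hf
    · rw [extend_ge h1, extend_ge h1, hlast, hnew' L le_rfl (by omega)]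
      have : 0 ≤ (m : ℝ) * δ := by positivity
      linarith
  · intro hf
    rw [hold' o le_rfl (hfar hf).1]; exact h.far_o hf
  · intro hf i hi hie
    rw [hen hf] at hie
    have := hB.en_lt o le_rfl (hfar hf).1
    rw [hold' i (by omega) (by omega), extend_lt (hfar hf).1]; exact h.far_eq hf i hi hie
  · intro hf
    rw [hen hf]; exact h.far_len hf

/-- There is only the first block, so all conditions on ordinary positions are vacuous. -/
theorem Coords.far_init {N S X ε base : ℝ} {c : ℕ → ℝ} {q st en : ℕ → ℕ} {dl : ℕ → ℝ} {o m : ℕ} {δ : ℝ}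
    (K : Consts N S X ε) (hδ : 0 < δ) (hδε : δ ≤ ε) (hmN : (m : ℝ) ≤ N) (h0 : c (q o) = base)
    (h1 : ∀ i, 1 ≤ i → i ≤ m → c (q (o + i)) = base + X - i * δ) :
    Coords N S X ε True base c q (extend o st o) (extend o en (o + m)) (extend o dl δ) o (o + m + 1) := by
  have hen : extend o en (o + m) o = o + m := extend_ge le_rfl
  have hmδ : (m : ℝ) * δ ≤ 1 := (mul_le_mul_of_nonneg_right hmN hδ.le).trans (K.mul_N_le hδε)
  have no : ∀ i, i < o + m + 1 → ¬ (True → extend o en (o + m) o < i) := fun i hi h => by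
    have := h trivial
    omega
  refine ⟨fun i hi _ => by rwa [extend_ge hi], fun i hi _ => by rwa [extend_ge hi],
    fun i hi _ => by rw [extend_ge hi, extend_ge hi, extend_ge le_rfl], fun i hi hL => ?_,
    fun _ i hi hL => absurd (fun _ => hi) (no i hL), fun i _ hL hn => absurd hn (no i hL),
    fun i j _ hij hL hn => absurd hn (no i (by omega)),
    fun i _ hL _ hn => absurd hn (no i hL), fun i _ hL hn => absurd hn (no i hL), fun _ => h0, fun _ i hi hie => ?_,
    fun _ => by rw [hen]; push_cast; linarith⟩
  · obtain ⟨j, rfl⟩ := Nat.exists_eq_add_of_le hi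
    rcases Nat.eq_zero_or_pos j with rfl | hj
    · exact h0.ge
    · rw [h1 j hj (by omega)]
      have e : (j : ℝ) ≤ m := by exact_mod_cast (by omega : j ≤ m)
      nlinarith [K.S_add_two_le, K.two_le, K.N_le]
  · obtain ⟨j, rfl⟩ := Nat.exists_eq_add_of_le hi.le
    rw [extend_ge le_rfl, h1 j (by omega) (by omega)]
    push_cast; ring

/-- Only the new block has to be checked, and not even that one if it is the first (`L = o`). -/
theorem Opened.append {ε : ℝ} {q q1 st : ℕ → ℕ} {dl : ℕ → ℝ} {o L m : ℕ} {q' : ℕ → ℕ} {dl' : ℕ → ℝ} {o' L' : ℕ}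
    {δ : ℝ} (h : Opened ε q st dl o L q' dl' o' L') (hst : ∀ i, o ≤ i → i < L → st i ≤ i)
    (hold : ∀ i, o ≤ i → i < L → q1 i = q i)
    (hopen : L ≠ o → ∃ k, o' ≤ k ∧ k < L' ∧ q' k = q1 L ∧ δ ≤ ε * dl' k ∧
      ∀ k', o' ≤ k' → k' < k → ∃ j, o ≤ j ∧ j < L ∧ q j = q' k')
    (hoL : ∀ i, o ≤ i → i < L → o ≤ st i) :
    Opened ε q1 (extend L st L) (extend L dl δ) o (L + m + 1) q' dl' o' L' := by
  intro i hi hiL hne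
  rcases lt_or_ge i L with h1 | h1
  · rw [extend_lt h1] at hne ⊢
    rw [extend_lt h1]
    have := hst i hi h1
    obtain ⟨k, a1, a2, a3, a4, a5⟩ := h i hi h1 hne
    refine ⟨k, a1, a2, by rw [a3, hold _ (hoL i hi h1) (by omega)], a4, fun k' b1 b2 => ?_⟩
    obtain ⟨j, c1, c2, c3⟩ := a5 k' b1 b2
    exact ⟨j, c1, c2, by rw [hold j c1 (by omega), c3]⟩
  · rw [extend_ge h1] at hne ⊢
    rw [extend_ge h1]
    obtain ⟨k, a1, a2, a3, a4, a5⟩ := hopen hne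
    refine ⟨k, a1, a2, a3, a4, fun k' b1 b2 => ?_⟩
    obtain ⟨j, c1, c2, c3⟩ := a5 k' b1 b2
    exact ⟨j, c1, c2, by rw [hold j c1 (by omega), c3]⟩

/-- The opening vertex and the vertices before it keep their positions when the other queue grows at
its end. -/
theorem Opened.append_other {ε : ℝ} {q st : ℕ → ℕ} {dl : ℕ → ℝ} {o L : ℕ} {q' q1 : ℕ → ℕ} {dl' : ℕ → ℝ}
    {o' L' m : ℕ} {δ : ℝ} (h : Opened ε q st dl o L q' dl' o' L') (hold : ∀ i, o' ≤ i → i < L' → q1 i = q' i) :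
    Opened ε q st dl o L q1 (extend L' dl' δ) o' (L' + m + 1) := by
  intro i hi hiL hne
  obtain ⟨k, a1, a2, a3, a4, a5⟩ := h i hi hiL hne
  refine ⟨k, a1, by omega, by rw [hold k a1 a2, a3], by rw [extend_lt a2]; exact a4, fun k' b1 b2 => ?_⟩
  rw [hold k' b1 (by omega)]
  exact a5 k' b1 b2

theorem RootOK.congr {ε : ℝ} {far : Prop} {q en : ℕ → ℕ} {dl : ℕ → ℝ} {o : ℕ} {q' en' : ℕ → ℕ} {dl' : ℕ → ℝ}
    {o' : ℕ} {q1 en1 : ℕ → ℕ} {dl1 : ℕ → ℝ} {q1' en1' : ℕ → ℕ} {dl1' : ℕ → ℝ}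
    (h : RootOK ε far q en dl o q' en' dl' o') (hlt : o < en o) (e1 : en1 o = en o) (e2 : dl1 o = dl o)
    (e3 : en1' o' = en' o') (e4 : dl1' o' = dl' o')
    (e5 : ∀ i, o ≤ i → i ≤ en o → q1 i = q i) (e6 : ∀ i, o' ≤ i → i ≤ en' o' → q1' i = q' i) :
    RootOK ε far q1 en1 dl1 o q1' en1' dl1' o' := by
  refine ⟨fun hf => ?_, fun hf k h1 h2 => ?_⟩
  · rw [e2, e4, e1, e3]
    rcases h.near hf with h' | ⟨k, a1, a2, a3, a4⟩
    · exact Or.inl h'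
    · exact Or.inr ⟨k, a1, a2, by rw [e5 _ hlt.le le_rfl, e6 k a1 a2, a3], a4⟩
  · rw [e3] at h2
    rw [e1, e5 _ (by omega) (by omega), e5 _ hlt.le le_rfl, e6 k h1 h2]
    exact h.far hf k h1 h2

/-! ### Placing a cycle with its coordinates -/

namespace RealRAM

/-- The effect of placing the cycle `z 0, …, z m` of the vertex `v`, apart from its coordinates. -/
structure Placed (b : Bool) (N : ℕ) (nb : ℕ → ℕ → Prop) (v : ℕ) (z : ℕ → ℕ) (m : ℕ) (s s' : State) : Prop where
  reg : ∀ r, r ≠ 8 → r ≠ 9 → r ≠ 10 → r ≠ 13 → r ≠ rLen b → s'.reg r = s.reg r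
  arr : ∀ a, a ≠ aMk b true → a ≠ aQ b → s'.arr a = s.arr a
  rreg : ∀ r, r ≠ rX b → r ≠ 2 → r ≠ 4 → r ≠ 7 → s'.rreg r = s.rreg r
  rarr : ∀ a, a ≠ rX b → s'.rarr a = s.rarr a
  len : s'.reg (rLen b) = s.reg (rLen b) + (m + 1)
  q_old : ∀ i, i < s.reg (rLen b) → s'.arr (aQ b) i = s.arr (aQ b) i
  q_new : ∀ i, i ≤ m → s'.arr (aQ b) (s.reg (rLen b) + i) = z i
  mk_new : ∀ i, i ≤ m → s'.arr (aMk b true) (z i) ≠ 0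
  mk_old : ∀ w, (∀ i, i ≤ m → z i ≠ w) → s'.arr (aMk b true) w = s.arr (aMk b true) w
  x_old : ∀ w, (∀ i, i ≤ m → z i ≠ w) → s'.rarr (rX b) w = s.rarr (rX b) w
  pos : 1 ≤ m
  head : z 0 = v
  second : z 1 = s.arr (aF b) (z 0)
  last : z m = s.arr (aG b) (z 0)
  inj : ∀ i j, i ≤ m → j ≤ m → z i = z j → i = j
  lt : ∀ i, i ≤ m → z i < N
  free : ∀ i, i ≤ m → s.arr (aMk b true) (z i) = 0
  succ : ∀ i, i < m → nb (z i) (z (i + 1))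
  nbr : ∀ i w, i ≤ m → nb (z i) w →
    ∃ j, j ≤ m ∧ w = z j ∧ (j = i + 1 ∨ i = j + 1 ∨ (i = 0 ∧ j = m) ∨ (j = 0 ∧ i = m))

/-- Ordinary and far placements differ only in a few real operations before and after `walk`, so
their common effect is derived here once: `s1` is the state before the walk, `s2` after it, and `s3`
the final one. -/
theorem Placed.of_walk {b : Bool} {N : ℕ} {nb : ℕ → ℕ → Prop} {z : ℕ → ℕ} {m : ℕ} {s s1 s2 s3 : State}
    (h : WalkPost b true N nb z s1 s2 m) (h18 : s.reg 18 ≠ 0)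
    (h1 : ∀ r, r ≠ 8 → r ≠ 9 → r ≠ 10 → r ≠ 13 → s1.reg r = s.reg r)
    (h2 : s1.arr = s.arr) (h3 : s1.rarr = s.rarr)
    (h4 : ∀ r, r ≠ rX b → r ≠ 2 → r ≠ 4 → r ≠ 7 → s1.rreg r = s.rreg r) (h5 : s3.reg = s2.reg)
    (h6 : s3.arr = s2.arr) (h7 : ∀ r, r ≠ rX b → r ≠ 2 → r ≠ 4 → r ≠ 7 → s3.rreg r = s2.rreg r)
    (h8 : ∀ a, a ≠ rX b → s3.rarr a = s2.rarr a)
    (h9 : ∀ w, (∀ i, i ≤ m → z i ≠ w) → s3.rarr (rX b) w = s2.rarr (rX b) w) :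
    Placed b N nb (s1.reg 10) z m s s3 := by
  have e18 : s1.reg 18 = s.reg 18 := h1 _ (by decide) (by decide) (by decide) (by decide)
  have eL : s1.reg (rLen b) = s.reg (rLen b) := h1 _ (by cases b <;> decide) (by cases b <;> decide)
    (by cases b <;> decide) (by cases b <;> decide)
  refine ⟨?_, ?_, ?_, ?_, ?_, ?_, ?_, ?_, ?_, ?_, h.pos, h.head, ?_, ?_, h.inj, h.lt, ?_, h.succ, h.nbr⟩
  · intro r a1 a2 a3 a4 a5
    rw [h5, h.reg r a1 a2 a3 a4 a5, h1 r a1 a2 a3 a4]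
  · intro a a1 a2
    rw [h6, h.arr a a1 a2, h2]
  · intro r a1 a2 a3 a4
    rw [h7 r a1 a2 a3 a4, h.rreg r a1, h4 r a1 a2 a3 a4]
  · intro a a1
    rw [h8 a a1, h.rarr a a1, h3]
  · rw [h5, h.len, eL]
  · intro i hi
    rw [h6, h.q_old i (by rwa [eL]), h2]
  · intro i hi
    rw [h6, ← eL, h.q_new i (by omega)]
  · intro i hi
    rw [h6, h.mk_new i (by omega), e18]; exact h18
  · intro w hw
    rw [h6, h.mk_old w fun i hi => hw i (by omega), h2]
  · intro w hw
    rw [h9 w hw, h.x_old w fun i hi => hw i (by omega), h3]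
  · rw [h.second, h2]
  · rw [h.last, h2]
  · intro i hi
    rw [← h2]; exact h.free i hi

/-- Place the cycle of the vertex in register `10` as an ordinary block. -/
def place (b : Bool) : Program :=
  .instr (.rmul 4 4 5) ;; .instr (.rcopy 2 4) ;; walk b true ;; .instr (.rload 7 (rX b) 10) ;;
  .instr (.radd 7 7 6) ;; .instr (.rstore (rX b) 10 7) ;; .instr (.radd (rX b) 7 6)

/-- Coordinates of an ordinary block with gap `δ`. -/
structure PlacedNear (b : Bool) (δ : ℝ) (z : ℕ → ℕ) (m : ℕ) (s s' : State) : Prop where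
  e : s'.rreg 4 = δ
  x_lt : ∀ i, i < m → s'.rarr (rX b) (z i) = s.rreg (rX b) + i * δ
  x_last : s'.rarr (rX b) (z m) = s.rreg (rX b) + m * δ + 1
  xc : s'.rreg (rX b) = s.rreg (rX b) + m * δ + 2

theorem run_place {b : Bool} {N : ℕ} {nb : ℕ → ℕ → Prop} {s : State}
    (h3 : s.reg 3 = 0) (h4 : s.reg 4 = 1) (h18 : s.reg 18 ≠ 0) (h6 : s.rreg 6 = 1)
    (hT : TwoRegular N nb (s.arr (aF b)) (s.arr (aG b)))
    (hM : ∀ v w, v < N → s.arr (aMk b true) v ≠ 0 → nb v w → s.arr (aMk b true) w ≠ 0)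
    (hlt : s.reg 10 < N) (hfree : s.arr (aMk b true) (s.reg 10) = 0) :
    Run (place b) s fun t s' => ∃ z m, Placed b N nb (s.reg 10) z m s s' ∧
      PlacedNear b (s.rreg 4 * s.rreg 5) z m s s' ∧ t ≤ 14 * (m + 1) + 8 := by
  -- The state before the walk is replaced by a variable known only through a few equations, which
  -- keeps the symbolic states small.
  have key : ∀ s1 : State, s1 = (Instr.rcopy 2 4).run ((Instr.rmul 4 4 5).run s) →
      Run (place b) s fun t s' => ∃ z m, Placed b N nb (s.reg 10) z m s s' ∧
      PlacedNear b (s.rreg 4 * s.rreg 5) z m s s' ∧ t ≤ 14 * (m + 1) + 8 := by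
    intro s1 hs1
    have ereg : s1.reg = s.reg := by rw [hs1]; rfl
    have earr : s1.arr = s.arr := by rw [hs1]; rfl
    have erarr : s1.rarr = s.rarr := by rw [hs1]; rfl
    have errr : ∀ r, r ≠ 2 → r ≠ 4 → s1.rreg r = s.rreg r := fun r hr hr' => by
      rw [hs1]; simp [Instr.run, State.setRReg, hr, hr']
    have e2 : s1.rreg 2 = s.rreg 4 * s.rreg 5 := by rw [hs1]; simp [Instr.run, State.setRReg]
    have e4 : s1.rreg 4 = s.rreg 4 * s.rreg 5 := by rw [hs1]; simp [Instr.run, State.setRReg]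
    have e6 : s1.rreg 6 = 1 := by rw [errr _ (by decide) (by decide), h6]
    simp only [place, run_seq, run_instr, ← hs1]
    refine (run_walk (b := b) (p := true) (s := s1) (N := N) (nb := nb) (by rw [ereg, h3]) (by rw [ereg, h4])
      (by rwa [ereg]) (by rwa [earr]) (by rwa [earr]) (by rwa [ereg]) (by rwa [earr, ereg])).mono ?_
    rintro t s2 ⟨z, m, hw, ht⟩
    have hb : rX b ≠ 2 ∧ rX b ≠ 4 ∧ rX b ≠ 6 ∧ rX b ≠ 7 := by cases b <;> decide
    have h26 : s2.rreg 6 = 1 := by rw [hw.rreg _ hb.2.2.1.symm, e6]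
    have h24 : s2.rreg 4 = s.rreg 4 * s.rreg 5 := by rw [hw.rreg _ hb.2.1.symm, e4]
    have hx0 : s1.rreg (rX b) = s.rreg (rX b) := errr _ hb.1 hb.2.1
    have hcur := hw.cur
    have hxm := hw.x_new m (Nat.lt_succ_self m)
    have hxi := hw.x_new
    rw [e2, hx0] at hxm hxi
    refine ⟨z, m, ?_, ⟨?_, ?_, ?_, ?_⟩, by omega⟩
    · rw [← ereg]
      refine Placed.of_walk hw h18 (fun r _ _ _ _ => by rw [ereg]) earr erarr (fun r _ a1 a2 _ => errr r a1 a2)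
        rfl rfl ?_ ?_ ?_
      · intro r a1 a2 a3 a4
        simp [Instr.run, State.setRReg, a1, a4]
      · intro a a1
        simp [Instr.run, State.setRReg, a1]
      · intro w hw'
        simp [Instr.run, State.setRReg, hcur, (hw' m le_rfl).symm]
    · simp [Instr.run, State.setRReg, hb.2.1.symm, h24]
    · intro i hi
      have hne : z i ≠ z m := fun e => by
        have := hw.inj i m hi.le le_rfl e
        omega
      simp [Instr.run, State.setRReg, hcur, hne, hxi i (by omega)]
    · simp [Instr.run, State.setRReg, hcur, h26, hxm]
    · simp [Instr.run, State.setRReg, hcur, h26, hxm]; ring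
  exact key _ rfl

/-- Place the cycle of the vertex in register `20` as the first block of a component, far away. -/
def placeFar (b : Bool) : Program :=
  .instr (.copy 10 20) ;; .instr (.rmul 4 4 5) ;; .instr (.rsub 2 12 4) ;; .instr (.radd (rX b) 8 9) ;;
  walk b true ;; .instr (.rstore (rX b) 20 8) ;; .instr (.radd (rX b) 8 6)

/-- Coordinates of a first block that is placed far away. -/
structure PlacedFar (b : Bool) (δ : ℝ) (z : ℕ → ℕ) (m : ℕ) (s s' : State) : Prop where
  e : s'.rreg 4 = δ
  x_zero : s'.rarr (rX b) (z 0) = s.rreg 8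
  x_pos : ∀ i, 1 ≤ i → i ≤ m → s'.rarr (rX b) (z i) = s.rreg 8 + s.rreg 9 - i * δ
  xc : s'.rreg (rX b) = s.rreg 8 + 1

theorem run_placeFar {b : Bool} {N : ℕ} {nb : ℕ → ℕ → Prop} {s : State}
    (h3 : s.reg 3 = 0) (h4 : s.reg 4 = 1) (h18 : s.reg 18 ≠ 0) (h6 : s.rreg 6 = 1) (h12 : s.rreg 12 = 0)
    (hT : TwoRegular N nb (s.arr (aF b)) (s.arr (aG b)))
    (hM : ∀ v w, v < N → s.arr (aMk b true) v ≠ 0 → nb v w → s.arr (aMk b true) w ≠ 0)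
    (hlt : s.reg 20 < N) (hfree : s.arr (aMk b true) (s.reg 20) = 0) :
    Run (placeFar b) s fun t s' => ∃ z m, Placed b N nb (s.reg 20) z m s s' ∧
      PlacedFar b (s.rreg 4 * s.rreg 5) z m s s' ∧ t ≤ 14 * (m + 1) + 8 := by
  have key : ∀ s1 : State, s1 = (Instr.radd (rX b) 8 9).run ((Instr.rsub 2 12 4).run ((Instr.rmul 4 4 5).run
        ((Instr.copy 10 20).run s))) →
      Run (placeFar b) s fun t s' => ∃ z m, Placed b N nb (s.reg 20) z m s s' ∧
      PlacedFar b (s.rreg 4 * s.rreg 5) z m s s' ∧ t ≤ 14 * (m + 1) + 8 := by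
    intro s1 hs1
    have hb : rX b ≠ 2 ∧ rX b ≠ 4 ∧ rX b ≠ 6 ∧ rX b ≠ 7 ∧ rX b ≠ 8 := by cases b <;> decide
    have ereg : ∀ r, r ≠ 10 → s1.reg r = s.reg r := fun r hr => by
      rw [hs1]; simp [Instr.run, State.setRReg, State.setReg, hr]
    have e10 : s1.reg 10 = s.reg 20 := by rw [hs1]; simp [Instr.run, State.setRReg, State.setReg]
    have earr : s1.arr = s.arr := by rw [hs1]; rfl
    have erarr : s1.rarr = s.rarr := by rw [hs1]; rfl
    have errr : ∀ r, r ≠ rX b → r ≠ 2 → r ≠ 4 → s1.rreg r = s.rreg r := fun r hr hr' hr'' => by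
      rw [hs1]; simp [Instr.run, State.setRReg, State.setReg, hr, hr', hr'']
    -- Real register `12` holds 0, so the step is the negative gap: the walk starts at `base + X`
    -- and goes backwards. The coordinate of the root is overwritten afterwards.
    have e2 : s1.rreg 2 = - (s.rreg 4 * s.rreg 5) := by
      rw [hs1]; simp [Instr.run, State.setRReg, State.setReg, h12, hb.1.symm]
    have e4 : s1.rreg 4 = s.rreg 4 * s.rreg 5 := by
      rw [hs1]; simp [Instr.run, State.setRReg, State.setReg, hb.2.1.symm]
    have ex : s1.rreg (rX b) = s.rreg 8 + s.rreg 9 := by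
      rw [hs1]; simp [Instr.run, State.setRReg, State.setReg]
    have e6 : s1.rreg 6 = 1 := by rw [errr _ hb.2.2.1.symm (by decide) (by decide), h6]
    have e8 : s1.rreg 8 = s.rreg 8 := by rw [errr _ hb.2.2.2.2.symm (by decide) (by decide)]
    simp only [placeFar, run_seq, run_instr, ← hs1]
    refine (run_walk (b := b) (p := true) (s := s1) (N := N) (nb := nb) (by rw [ereg _ (by decide), h3])
      (by rw [ereg _ (by decide), h4]) (by rwa [ereg _ (by decide)]) (by rwa [earr]) (by rwa [earr])
      (by rwa [e10]) (by rwa [earr, e10])).mono ?_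
    rintro t s2 ⟨z, m, hw, ht⟩
    have h26 : s2.rreg 6 = 1 := by rw [hw.rreg _ hb.2.2.1.symm, e6]
    have h28 : s2.rreg 8 = s.rreg 8 := by rw [hw.rreg _ hb.2.2.2.2.symm, e8]
    have h24 : s2.rreg 4 = s.rreg 4 * s.rreg 5 := by rw [hw.rreg _ hb.2.1.symm, e4]
    have h220 : s2.reg 20 = z 0 := by
      rw [hw.reg _ (by decide) (by decide) (by decide) (by decide) (by cases b <;> decide), hw.head, e10,
        ereg _ (by decide)]
    have hxi := hw.x_new
    rw [e2, ex] at hxi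
    refine ⟨z, m, ?_, ⟨?_, ?_, ?_, ?_⟩, by omega⟩
    · rw [← e10]
      refine Placed.of_walk hw h18 (fun r _ _ a3 _ => ereg r a3) earr erarr (fun r a0 a1 a2 _ => errr r a0 a1 a2)
        rfl rfl ?_ ?_ ?_
      · intro r a1 a2 a3 a4
        simp [Instr.run, State.setRReg, a1]
      · intro a a1
        simp [Instr.run, State.setRReg, a1]
      · intro w hw'
        simp [Instr.run, State.setRReg, h220, (hw' 0 (Nat.zero_le _)).symm]
    · simp [Instr.run, State.setRReg, hb.2.1.symm, h24]
    · simp [Instr.run, State.setRReg, h220, h28]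
    · intro i hi hi'
      have hne : z i ≠ z 0 := fun e => by
        have := hw.inj i 0 hi' (Nat.zero_le _) e
        omega
      simp [Instr.run, State.setRReg, h220, hne, hxi i (by omega)]; ring
    · simp [Instr.run, State.setRReg, h26, h28]
  exact key _ rfl

end RealRAM

/-! ### Invariant of one axis -/

namespace RealRAM

/-- The registers and arrays that do not change while a component is placed. -/
structure Env (N : ℕ) (ε X base : ℝ) (u : ℕ) (ids : Bool → ℕ → ℕ) (s : State) : Prop where
  r3 : s.reg 3 = 0
  r4 : s.reg 4 = 1
  r5 : s.reg 5 = N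
  r18 : s.reg 18 = 1
  r20 : s.reg 20 = u
  x5 : s.rreg 5 = ε
  x6 : s.rreg 6 = 1
  x8 : s.rreg 8 = base
  x9 : s.rreg 9 = X
  x10 : s.rreg 10 = X + 1
  x12 : s.rreg 12 = 0
  id : ∀ b, s.arr (aMk b false) = ids b

theorem Env.placed {N : ℕ} {ε X base : ℝ} {u : ℕ} {ids : Bool → ℕ → ℕ} {s s' : State}
    (h : Env N ε X base u ids s) {b : Bool} {nb : ℕ → ℕ → Prop} {v : ℕ} {z : ℕ → ℕ} {m : ℕ}
    (hp : Placed b N nb v z m s s') : Env N ε X base u ids s' := by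
  have hr : ∀ r, r ≠ 8 → r ≠ 9 → r ≠ 10 → r ≠ 13 → r ≠ 14 → r ≠ 15 → s'.reg r = s.reg r := by
    intro r h1 h2 h3 h4 h5 h6
    exact hp.reg r h1 h2 h3 h4 (by cases b <;> assumption)
  have hx : ∀ r, r ≠ 0 → r ≠ 1 → r ≠ 2 → r ≠ 4 → r ≠ 7 → s'.rreg r = s.rreg r := by
    intro r h1 h2 h3 h4 h5
    exact hp.rreg r (by cases b <;> assumption) h3 h4 h5
  refine ⟨?_, ?_, ?_, ?_, ?_, ?_, ?_, ?_, ?_, ?_, ?_, fun b' => ?_⟩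
  · rw [hr _ (by decide) (by decide) (by decide) (by decide) (by decide) (by decide), h.r3]
  · rw [hr _ (by decide) (by decide) (by decide) (by decide) (by decide) (by decide), h.r4]
  · rw [hr _ (by decide) (by decide) (by decide) (by decide) (by decide) (by decide), h.r5]
  · rw [hr _ (by decide) (by decide) (by decide) (by decide) (by decide) (by decide), h.r18]
  · rw [hr _ (by decide) (by decide) (by decide) (by decide) (by decide) (by decide), h.r20]
  · rw [hx _ (by decide) (by decide) (by decide) (by decide) (by decide), h.x5]
  · rw [hx _ (by decide) (by decide) (by decide) (by decide) (by decide), h.x6]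
  · rw [hx _ (by decide) (by decide) (by decide) (by decide) (by decide), h.x8]
  · rw [hx _ (by decide) (by decide) (by decide) (by decide) (by decide), h.x9]
  · rw [hx _ (by decide) (by decide) (by decide) (by decide) (by decide), h.x10]
  · rw [hx _ (by decide) (by decide) (by decide) (by decide) (by decide), h.x12]
  · rw [hp.arr _ (by cases b <;> cases b' <;> decide) (by cases b <;> cases b' <;> decide), h.id]

/-- The state of one axis while a component is placed; positions from `o` on belong to this component. -/
structure SideInv (b : Bool) (N : ℕ) (nb : ℕ → ℕ → Prop) (X ε : ℝ) (far : Prop) (base : ℝ)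
    (o : ℕ) (st en : ℕ → ℕ) (dl : ℕ → ℝ) (q0 : ℕ → ℕ) (c0 : ℕ → ℝ) (s : State) : Prop where
  two : TwoRegular N nb (s.arr (aF b)) (s.arr (aG b))
  o_le : o ≤ s.reg (rLen b)
  blocks : PreBlocks nb (s.arr (aQ b)) st en o (s.reg (rLen b))
  coords : Coords N (3 * N) X ε far base (s.rarr (rX b)) (s.arr (aQ b)) st en dl o (s.reg (rLen b))
  mk_iff : ∀ v, v < N → (s.arr (aMk b true) v ≠ 0 ↔ ∃ i, i < s.reg (rLen b) ∧ s.arr (aQ b) i = v)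
  q_lt : ∀ i, i < s.reg (rLen b) → s.arr (aQ b) i < N
  q_inj : ∀ i j, i < s.reg (rLen b) → j < s.reg (rLen b) → s.arr (aQ b) i = s.arr (aQ b) j → i = j
  xc_ge : ∀ i, o ≤ i → i < s.reg (rLen b) → (far → en o < i) →
    s.rarr (rX b) (s.arr (aQ b) i) + 1 ≤ s.rreg (rX b)
  xc_le : s.rreg (rX b) ≤ base + 1 + 3 * ((s.reg (rLen b) : ℝ) - o)
  base_le : base ≤ s.rreg (rX b)
  far_base_le : far → base + 1 ≤ s.rreg (rX b)
  closed : ∀ i w, i < o → nb (s.arr (aQ b) i) w → ∃ j, j < o ∧ w = s.arr (aQ b) j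
  old : ∀ i, i < o → s.arr (aQ b) i = q0 i ∧ s.rarr (rX b) (s.arr (aQ b) i) = c0 (s.arr (aQ b) i)

section

variable {b : Bool} {N : ℕ} {nb : ℕ → ℕ → Prop} {X ε : ℝ} {far : Prop} {base : ℝ}
  {o : ℕ} {st en : ℕ → ℕ} {dl : ℕ → ℝ} {q0 : ℕ → ℕ} {c0 : ℕ → ℝ} {s s' : State}

theorem SideInv.marks_closed (h : SideInv b N nb X ε far base o st en dl q0 c0 s) {v w : ℕ} (hv : v < N)
    (hm : s.arr (aMk b true) v ≠ 0) (hw : nb v w) : s.arr (aMk b true) w ≠ 0 := by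
  rw [h.mk_iff v hv] at hm
  rw [h.mk_iff w (h.two.lt v w hv hw)]
  obtain ⟨i, hi, rfl⟩ := hm
  have := h.o_le
  rcases lt_or_ge i o with h1 | h1
  · obtain ⟨j, hj, rfl⟩ := h.closed i w h1 hw
    exact ⟨j, by omega, rfl⟩
  · obtain ⟨j, -, hj, rfl, -⟩ := h.blocks.nbr i w h1 hi hw
    exact ⟨j, hj.trans_lt (h.blocks.en_lt i h1 hi), rfl⟩

theorem SideInv.len_le (h : SideInv b N nb X ε far base o st en dl q0 c0 s) : s.reg (rLen b) ≤ N := by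
  rcases Nat.eq_zero_or_pos (s.reg (rLen b)) with h0 | h0
  · omega
  · have := le_of_injective_path (z := s.arr (aQ b)) (k := s.reg (rLen b) - 1) (N := N)
      (fun i j hi hj e => h.q_inj i j (by omega) (by omega) e) (fun i hi => h.q_lt i (by omega))
    omega

theorem SideInv.congr (h : SideInv b N nb X ε far base o st en dl q0 c0 s)
    (h1 : s'.arr (aF b) = s.arr (aF b)) (h2 : s'.arr (aG b) = s.arr (aG b)) (h3 : s'.arr (aQ b) = s.arr (aQ b))
    (h4 : s'.arr (aMk b true) = s.arr (aMk b true)) (h5 : s'.rarr (rX b) = s.rarr (rX b))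
    (h6 : s'.rreg (rX b) = s.rreg (rX b)) (h7 : s'.reg (rLen b) = s.reg (rLen b)) :
    SideInv b N nb X ε far base o st en dl q0 c0 s' := by
  constructor <;> simp only [h1, h2, h3, h4, h5, h6, h7]
  exacts [h.two, h.o_le, h.blocks, h.coords, h.mk_iff, h.q_lt, h.q_inj, h.xc_ge, h.xc_le, h.base_le, h.far_base_le,
    h.closed, h.old]

theorem SideInv.placed_other (h : SideInv b N nb X ε far base o st en dl q0 c0 s) {nb' : ℕ → ℕ → Prop} {v : ℕ}
    {z : ℕ → ℕ} {m : ℕ} (hp : Placed (!b) N nb' v z m s s') :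
    SideInv b N nb X ε far base o st en dl q0 c0 s' := by
  refine h.congr ?_ ?_ ?_ ?_ ?_ ?_ ?_
  · exact hp.arr _ (by cases b <;> decide) (by cases b <;> decide)
  · exact hp.arr _ (by cases b <;> decide) (by cases b <;> decide)
  · exact hp.arr _ (by cases b <;> decide) (by cases b <;> decide)
  · exact hp.arr _ (by cases b <;> decide) (by cases b <;> decide)
  · exact hp.rarr _ (by cases b <;> decide)
  · exact hp.rreg _ (by cases b <;> decide) (by cases b <;> decide) (by cases b <;> decide) (by cases b <;> decide)
  · exact hp.reg _ (by cases b <;> decide) (by cases b <;> decide) (by cases b <;> decide) (by cases b <;> decide)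
      (by cases b <;> decide)

/-- The part of the invariant that does not depend on the coordinates of the new block. -/
structure Appended (b : Bool) (N : ℕ) (z : ℕ → ℕ) (m : ℕ) (s s' : State) : Prop where
  fresh : ∀ i j, i < s.reg (rLen b) → j ≤ m → s.arr (aQ b) i ≠ z j
  len_le : s.reg (rLen b) + m + 1 ≤ N
  mk_iff : ∀ v, v < N → (s'.arr (aMk b true) v ≠ 0 ↔ ∃ i, i < s'.reg (rLen b) ∧ s'.arr (aQ b) i = v)
  q_lt : ∀ i, i < s'.reg (rLen b) → s'.arr (aQ b) i < N
  q_inj : ∀ i j, i < s'.reg (rLen b) → j < s'.reg (rLen b) → s'.arr (aQ b) i = s'.arr (aQ b) j → i = j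
  x_old : ∀ i, i < s.reg (rLen b) → s'.rarr (rX b) (s.arr (aQ b) i) = s.rarr (rX b) (s.arr (aQ b) i)

/-- The vertices of the new cycle were unmarked and queued vertices are marked, so the enlarged
queue is still injective; it therefore has at most `N` entries. -/
theorem SideInv.appended (h : SideInv b N nb X ε far base o st en dl q0 c0 s) {v : ℕ} {z : ℕ → ℕ} {m : ℕ}
    (hp : Placed b N nb v z m s s') : Appended b N z m s s' := by
  have fresh : ∀ i j, i < s.reg (rLen b) → j ≤ m → s.arr (aQ b) i ≠ z j := fun i j hi hj e =>
    (h.mk_iff _ (h.q_lt i hi)).2 ⟨i, hi, rfl⟩ (e ▸ hp.free j hj)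
  have hnew : ∀ i, s.reg (rLen b) ≤ i → i < s'.reg (rLen b) → s'.arr (aQ b) i = z (i - s.reg (rLen b)) :=
    fun i h1 h2 => by
      have := hp.len
      rw [← hp.q_new (i - s.reg (rLen b)) (by omega), Nat.add_sub_cancel' h1]
  have hlen := hp.len
  have q_lt : ∀ i, i < s'.reg (rLen b) → s'.arr (aQ b) i < N := fun i hi => by
    rcases lt_or_ge i (s.reg (rLen b)) with h1 | h1
    · rw [hp.q_old i h1]; exact h.q_lt i h1
    · rw [hnew i h1 hi]; exact hp.lt _ (by omega)
  have q_inj : ∀ i j, i < s'.reg (rLen b) → j < s'.reg (rLen b) → s'.arr (aQ b) i = s'.arr (aQ b) j → i = j := by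
    intro i j hi hj e
    rcases lt_or_ge i (s.reg (rLen b)) with h1 | h1 <;> rcases lt_or_ge j (s.reg (rLen b)) with h2 | h2
    · rw [hp.q_old i h1, hp.q_old j h2] at e
      exact h.q_inj i j h1 h2 e
    · rw [hp.q_old i h1, hnew j h2 hj] at e
      exact absurd e (fresh i _ h1 (by omega))
    · rw [hp.q_old j h2, hnew i h1 hi] at e
      exact absurd e.symm (fresh j _ h2 (by omega))
    · rw [hnew j h2 hj, hnew i h1 hi] at e
      have := hp.inj _ _ (by omega) (by omega) e
      omega
  refine ⟨fresh, ?_, ?_, q_lt, q_inj, ?_⟩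
  · have := le_of_injective_path (z := s'.arr (aQ b)) (k := s'.reg (rLen b) - 1) (N := N)
      (fun i j hi hj e => q_inj i j (by omega) (by omega) e) (fun i hi => q_lt i (by omega))
    omega
  · intro v hv
    by_cases hz : ∃ i, i ≤ m ∧ z i = v
    · obtain ⟨i, hi, rfl⟩ := hz
      exact ⟨fun _ => ⟨s.reg (rLen b) + i, by omega, hp.q_new i hi⟩, fun _ => hp.mk_new i hi⟩
    · rw [hp.mk_old v fun i hi e => hz ⟨i, hi, e⟩, h.mk_iff v hv]
      constructor
      · rintro ⟨i, hi, e⟩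
        exact ⟨i, by omega, by rw [hp.q_old i hi, e]⟩
      · rintro ⟨i, hi, e⟩
        rcases lt_or_ge i (s.reg (rLen b)) with h1 | h1
        · exact ⟨i, h1, by rw [← hp.q_old i h1, e]⟩
        · rw [hnew i h1 hi] at e
          exact absurd ⟨_, by omega, e⟩ hz
  · intro i hi
    exact hp.x_old _ fun j hj => (fresh i j hi hj).symm

theorem Placed.two {v : ℕ} {z : ℕ → ℕ} {m : ℕ} (hp : Placed b N nb v z m s s')
    (h : TwoRegular N nb (s.arr (aF b)) (s.arr (aG b))) :
    TwoRegular N nb (s'.arr (aF b)) (s'.arr (aG b)) := by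
  rwa [hp.arr _ (aF_ne_aMk _ _ _) (aF_ne_aQ _ _), hp.arr _ (aG_ne_aMk _ _ _) (aG_ne_aQ _ _)]

theorem SideInv.append (K : Consts N (3 * N) X ε) (h : SideInv b N nb X ε far base o st en dl q0 c0 s) {v : ℕ}
    {z : ℕ → ℕ} {m : ℕ} {δ : ℝ} (hp : Placed b N nb v z m s s') (hn : PlacedNear b δ z m s s') (hδ : 0 < δ)
    (hδε : δ ≤ ε) (hfar : far → o < s.reg (rLen b)) :
    SideInv b N nb X ε far base o (extend (s.reg (rLen b)) st (s.reg (rLen b)))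
      (extend (s.reg (rLen b)) en (s.reg (rLen b) + m)) (extend (s.reg (rLen b)) dl δ) q0 c0 s' := by
  have ha := h.appended hp
  have hlen := hp.len
  have hlenle := ha.len_le
  have hmN : (m : ℝ) ≤ N := by exact_mod_cast (by omega : m ≤ N)
  have hmδ0 : 0 ≤ (m : ℝ) * δ := by positivity
  have hmδ : (m : ℝ) * δ ≤ 1 := (mul_le_mul_of_nonneg_right hmN hδ.le).trans (K.mul_N_le hδε)
  have hLN : (s.reg (rLen b) : ℝ) + m + 1 ≤ N := by exact_mod_cast hlenle
  have hlenR : (s'.reg (rLen b) : ℝ) = s.reg (rLen b) + m + 1 := by rw [hlen]; push_cast; ring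
  have hm1 : (1 : ℝ) ≤ m := by exact_mod_cast hp.pos
  have ho : (o : ℝ) ≤ s.reg (rLen b) := by exact_mod_cast h.o_le
  have ho0 : (0 : ℝ) ≤ o := Nat.cast_nonneg o
  have hxc := h.xc_le
  have hle' : o ≤ s'.reg (rLen b) := by have := h.o_le; omega
  have hqo : ∀ i, i < o → s'.arr (aQ b) i = s.arr (aQ b) i := fun i hi => hp.q_old i (hi.trans_le h.o_le)
  have hco : Coords N (3 * N) X ε far base (s'.rarr (rX b)) (s'.arr (aQ b))
      (extend (s.reg (rLen b)) st (s.reg (rLen b))) (extend (s.reg (rLen b)) en (s.reg (rLen b) + m))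
      (extend (s.reg (rLen b)) dl δ) o (s'.reg (rLen b)) := by
    rw [hlen]
    -- A block of m + 1 vertices advances the next coordinate by at most 3, which is less than 3(m +
    -- 1). So with at most `N` vertices an extent of `3 * N` suffices.
    exact h.coords.append K h.blocks hp.pos (fun i _ hi => hp.q_old i hi) hp.q_new
      (fun i _ hi => ha.x_old i hi) hn.x_lt hn.x_last hδ hδε hmN h.xc_ge h.base_le
      (fun hf => ⟨hfar hf, h.far_base_le hf⟩) (by linarith)
  refine ⟨hp.two h.two, hle', ?_, hco, ha.mk_iff, ha.q_lt, ha.q_inj, ?_, ?_, ?_, ?_, ?_, ?_⟩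
  · rw [hlen]
    exact h.blocks.append h.o_le hp.pos (fun i _ hi => hp.q_old i hi) hp.q_new hp.inj
      (fun i j _ hi hj => ha.fresh i j hi hj) hp.nbr
  · intro i hi hiL hnear
    rcases lt_or_ge i (s.reg (rLen b)) with h1 | h1
    · rw [hp.q_old i h1, ha.x_old i h1, hn.xc]
      have := h.xc_ge i hi h1 fun hf => by
        have := hnear hf
        rwa [extend_lt (hfar hf)] at this
      linarith
    · obtain ⟨j, rfl⟩ := Nat.exists_eq_add_of_le h1
      rw [hp.q_new j (by omega), hn.xc]
      rcases Nat.lt_or_eq_of_le (by omega : j ≤ m) with h2 | rfl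
      · rw [hn.x_lt j h2]
        have : (j : ℝ) ≤ m := by exact_mod_cast h2.le
        nlinarith
      · rw [hn.x_last]; linarith
  · rw [hn.xc, hlenR]; linarith
  · rw [hn.xc]; linarith [h.base_le]
  · intro hf
    rw [hn.xc]; linarith [h.far_base_le hf]
  · intro i w hi hw
    rw [hqo i hi] at hw
    obtain ⟨j, hj, rfl⟩ := h.closed i w hi hw
    exact ⟨j, hj, (hqo j hj).symm⟩
  · intro i hi
    rw [hqo i hi, ha.x_old i (hi.trans_le h.o_le)]
    exact h.old i hi

/-- The queue length equals the offset, so nothing of the component is on this axis yet. Ordinary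
blocks will continue from `base + 1`, between the root and the far part of its cycle. -/
theorem SideInv.append_far (K : Consts N (3 * N) X ε) {u : ℕ} {ids : Bool → ℕ → ℕ} (hE : Env N ε X base u ids s)
    (h : SideInv b N nb X ε False base (s.reg (rLen b)) st en dl q0 c0 s) {v : ℕ}
    {z : ℕ → ℕ} {m : ℕ} {δ : ℝ} (hp : Placed b N nb v z m s s') (hn : PlacedFar b δ z m s s') (hδ : 0 < δ)
    (hδε : δ ≤ ε) :
    SideInv b N nb X ε True base (s.reg (rLen b)) (extend (s.reg (rLen b)) st (s.reg (rLen b)))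
      (extend (s.reg (rLen b)) en (s.reg (rLen b) + m)) (extend (s.reg (rLen b)) dl δ) q0 c0 s' := by
  have ha := h.appended hp
  have hlen := hp.len
  have hlenle := ha.len_le
  have hmN : (m : ℝ) ≤ N := by exact_mod_cast (by omega : m ≤ N)
  have hle' : s.reg (rLen b) ≤ s'.reg (rLen b) := by omega
  have hq0 : s'.arr (aQ b) (s.reg (rLen b)) = z 0 := hp.q_new 0 (Nat.zero_le _)
  refine ⟨hp.two h.two, hle', ?_, ?_, ha.mk_iff, ha.q_lt, ha.q_inj, ?_, ?_, ?_, ?_, ?_, ?_⟩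
  · rw [hlen]
    exact h.blocks.append le_rfl hp.pos (fun i _ hi => hp.q_old i hi) hp.q_new hp.inj
      (fun i j _ hi hj => ha.fresh i j hi hj) hp.nbr
  · rw [hlen]
    refine Coords.far_init K hδ hδε hmN ?_ fun i h1 h2 => ?_
    · rw [hq0, hn.x_zero, hE.x8]
    · rw [hp.q_new i h2, hn.x_pos i h1 h2, hE.x8, hE.x9]
  · intro i hi hiL hnear
    have := hnear trivial
    rw [extend_ge le_rfl] at this
    omega
  · rw [hn.xc, hE.x8]
    have : (s.reg (rLen b) : ℝ) ≤ s'.reg (rLen b) := by exact_mod_cast hle'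
    linarith
  · rw [hn.xc, hE.x8]; linarith
  · intro _
    rw [hn.xc, hE.x8]
  · intro i w hi hw
    rw [hp.q_old i hi] at hw
    obtain ⟨j, hj, rfl⟩ := h.closed i w hi hw
    exact ⟨j, hj, (hp.q_old j hj).symm⟩
  · intro i hi
    rw [hp.q_old i hi, ha.x_old i hi]
    exact h.old i hi

end

end RealRAM

/-! ### Breadth-first search in one component -/

namespace RealRAM

/-- The state while the component of `u` is placed. -/
structure Comp (N : ℕ) (nb : Bool → ℕ → ℕ → Prop) (X ε : ℝ) (far : Prop) (base : ℝ) (u : ℕ)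
    (ids : Bool → ℕ → ℕ) (o : Bool → ℕ) (q0 : Bool → ℕ → ℕ) (c0 : Bool → ℕ → ℝ) (st en : Bool → ℕ → ℕ)
    (dl : Bool → ℕ → ℝ) (s : State) : Prop where
  env : Env N ε X base u ids s
  side : ∀ b, SideInv b N (nb b) X ε far base (o b) (st b) (en b) (dl b) (q0 b) (c0 b) s
  e_pos : 0 < s.rreg 4
  e_le : s.rreg 4 ≤ 1
  dl_ge : ∀ b i, o b ≤ i → i < s.reg (rLen b) → s.rreg 4 ≤ dl b i
  lt : ∀ b, o b < s.reg (rLen b)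
  st_o : ∀ b, st b (o b) = o b
  head : ∀ b, s.arr (aQ b) (o b) = u
  opened : ∀ b, Opened ε (s.arr (aQ b)) (st b) (dl b) (o b) (s.reg (rLen b)) (s.arr (aQ !b)) (dl !b) (o !b)
    (s.reg (rLen !b))
  root : ∀ b, RootOK ε far (s.arr (aQ b)) (en b) (dl b) (o b) (s.arr (aQ !b)) (en !b) (dl !b) (o !b)
  pre : ∀ b i, i < o b → ∃ j, j < o !b ∧ s.arr (aQ !b) j = s.arr (aQ b) i

section

variable {N : ℕ} {nb : Bool → ℕ → ℕ → Prop} {X ε : ℝ} {far : Prop} {base : ℝ} {u : ℕ}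
  {ids : Bool → ℕ → ℕ} {o : Bool → ℕ} {q0 : Bool → ℕ → ℕ} {c0 : Bool → ℕ → ℝ} {st en : Bool → ℕ → ℕ}
  {dl : Bool → ℕ → ℝ} {s s' : State}

theorem Env.congr (h : Env N ε X base u ids s)
    (hr : ∀ r, r = 3 ∨ r = 4 ∨ r = 5 ∨ r = 18 ∨ r = 20 → s'.reg r = s.reg r)
    (ha : ∀ b, s'.arr (aMk b false) = s.arr (aMk b false))
    (hx : ∀ r, r = 5 ∨ r = 6 ∨ r = 8 ∨ r = 9 ∨ r = 10 ∨ r = 12 → s'.rreg r = s.rreg r) :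
    Env N ε X base u ids s' := by
  refine ⟨?_, ?_, ?_, ?_, ?_, ?_, ?_, ?_, ?_, ?_, ?_, fun b => by rw [ha, h.id]⟩
  · rw [hr _ (by simp), h.r3]
  · rw [hr _ (by simp), h.r4]
  · rw [hr _ (by simp), h.r5]
  · rw [hr _ (by simp), h.r18]
  · rw [hr _ (by simp), h.r20]
  · rw [hx _ (by simp), h.x5]
  · rw [hx _ (by simp), h.x6]
  · rw [hx _ (by simp), h.x8]
  · rw [hx _ (by simp), h.x9]
  · rw [hx _ (by simp), h.x10]
  · rw [hx _ (by simp), h.x12]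

theorem Comp.congr (h : Comp N nb X ε far base u ids o q0 c0 st en dl s)
    (hr : ∀ r, r = 3 ∨ r = 4 ∨ r = 5 ∨ r = 18 ∨ r = 20 ∨ r = 14 ∨ r = 15 → s'.reg r = s.reg r)
    (ha : s'.arr = s.arr) (hx : s'.rreg = s.rreg) (hxa : s'.rarr = s.rarr) :
    Comp N nb X ε far base u ids o q0 c0 st en dl s' := by
  have hl : ∀ b, s'.reg (rLen b) = s.reg (rLen b) := fun b => hr _ (by cases b <;> decide)
  refine ⟨h.env.congr (fun r hr' => hr r (by omega)) (fun b => by rw [ha]) (fun r _ => by rw [hx]), fun b => ?_, ?_, ?_,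
    ?_, ?_, h.st_o, ?_, ?_, ?_, ?_⟩
  · exact (h.side b).congr (by rw [ha]) (by rw [ha]) (by rw [ha]) (by rw [ha]) (by rw [hxa]) (by rw [hx]) (hl b)
  · rw [hx]; exact h.e_pos
  · rw [hx]; exact h.e_le
  · simp only [hx, hl]; exact h.dl_ge
  · simp only [hl]; exact h.lt
  · simp only [ha]; exact h.head
  · simp only [hl, ha]; exact h.opened
  · simp only [ha]; exact h.root
  · simp only [ha]; exact h.pre

theorem Comp.blocks (h : Comp N nb X ε far base u ids o q0 c0 st en dl s) (b : Bool) :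
    Blocks (nb b) (s.arr (aQ b)) (st b) (en b) (o b) (s.reg (rLen b)) :=
  ⟨(h.side b).blocks, h.lt b, h.st_o b⟩

/-- Placing an ordinary block preserves the invariant. -/
theorem Comp.place (K : Consts N (3 * N) X ε) (h : Comp N nb X ε far base u ids o q0 c0 st en dl s) {b : Bool}
    {v : ℕ} {z : ℕ → ℕ} {m : ℕ} (hp : Placed b N (nb b) v z m s s')
    (hn : PlacedNear b (s.rreg 4 * s.rreg 5) z m s s')
    (hopen : ∃ k, o (!b) ≤ k ∧ k < s.reg (rLen !b) ∧ s.arr (aQ !b) k = v ∧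
      ∀ k', o (!b) ≤ k' → k' < k → ∃ j, o b ≤ j ∧ j < s.reg (rLen b) ∧ s.arr (aQ b) j = s.arr (aQ !b) k') :
    ∃ st' en' dl', Comp N nb X ε far base u ids o q0 c0 st' en' dl' s' := by
  have hε := K.ε_pos
  have hε1 : ε ≤ 1 := K.le_one le_rfl
  have hx5 := h.env.x5
  rw [hx5] at hn
  have hE := h.e_pos
  have hE1 := h.e_le
  have hδ : 0 < s.rreg 4 * ε := mul_pos hE hε
  have hδε : s.rreg 4 * ε ≤ ε := by nlinarith
  have hδE : s.rreg 4 * ε ≤ s.rreg 4 := by nlinarith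
  have hL := h.lt b
  have hlen := hp.len
  have hne : (!b) ≠ b := Bool.not_ne_self b
  have hlen' : s'.reg (rLen !b) = s.reg (rLen !b) := hp.reg _ (by cases b <;> decide) (by cases b <;> decide)
    (by cases b <;> decide) (by cases b <;> decide) (by cases b <;> decide)
  have hq' : s'.arr (aQ !b) = s.arr (aQ !b) := hp.arr _ (by cases b <;> decide) (by cases b <;> decide)
  have hside := (h.side b).append K hp hn hδ hδε fun _ => hL
  have hside' : SideInv (!b) N (nb !b) X ε far base (o !b) (st !b) (en !b) (dl !b) (q0 !b) (c0 !b) s' :=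
    (h.side (!b)).placed_other (by rw [Bool.not_not]; exact hp)
  have both : ∀ {p : Bool → Prop}, p b → p (!b) → ∀ b', p b' := by
    intro p h1 h2 b'
    rcases Bool.eq_or_eq_not b' b with rfl | rfl
    · exact h1
    · exact h2
  have hq : ∀ i, i < s.reg (rLen b) → s'.arr (aQ b) i = s.arr (aQ b) i := hp.q_old
  have hoe : ∀ b, o b < en b (o b) := fun b => by
    have := (h.blocks b).st_lt_en _ le_rfl (h.lt b)
    rwa [h.st_o] at this
  have heL : ∀ b, en b (o b) < s.reg (rLen b) := fun b => (h.blocks b).en_lt _ le_rfl (h.lt b)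
  refine ⟨Function.update st b (extend (s.reg (rLen b)) (st b) (s.reg (rLen b))),
    Function.update en b (extend (s.reg (rLen b)) (en b) (s.reg (rLen b) + m)),
    Function.update dl b (extend (s.reg (rLen b)) (dl b) (s.rreg 4 * ε)), h.env.placed hp, ?_, ?_, ?_, ?_, ?_, ?_, ?_,
    ?_, ?_, ?_⟩
  · refine both ?_ ?_
    · simp only [Function.update_self]; exact hside
    · simp only [Function.update_of_ne hne]; exact hside'
  · rw [hn.e]; exact hδ
  · rw [hn.e]; linarith
  · rw [hn.e]
    refine both ?_ ?_
    · intro i hi hiL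
      rw [Function.update_self]
      rcases lt_or_ge i (s.reg (rLen b)) with h1 | h1
      · rw [extend_lt h1]; exact hδE.trans (h.dl_ge b i hi h1)
      · rw [extend_ge h1]
    · intro i hi hiL
      rw [Function.update_of_ne hne]
      exact hδE.trans (h.dl_ge _ i hi (hlen' ▸ hiL))
  · refine both (by omega) ?_
    rw [hlen']; exact h.lt _
  · refine both ?_ ?_
    · rw [Function.update_self, extend_lt hL, h.st_o]
    · rw [Function.update_of_ne hne, h.st_o]
  · refine both ?_ ?_
    · rw [hq _ hL, h.head]
    · rw [hq', h.head]
  · refine both ?_ ?_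
    · simp only [Function.update_self, Function.update_of_ne hne, hlen', hq', hlen]
      refine (h.opened b).append (h.side b).blocks.st_le (fun i _ hi => hq i hi) (fun _ => ?_)
        (h.side b).blocks.le_st
      obtain ⟨k, a1, a2, a3, a4⟩ := hopen
      refine ⟨k, a1, a2, ?_, ?_, a4⟩
      · have := hp.q_new 0 (Nat.zero_le _)
        rw [add_zero] at this
        rw [this, hp.head, a3]
      -- The new gap is ε times real register `4`, which is a lower bound for all gaps so far, in
      -- particular for that of the opening vertex.
      · rw [mul_comm]
        exact mul_le_mul_of_nonneg_left (h.dl_ge _ k a1 a2) hε.le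
    · have := (h.opened (!b)).append_other (q1 := s'.arr (aQ b)) (m := m) (δ := s.rreg 4 * ε)
        (fun i _ hi => by rw [Bool.not_not] at hi ⊢; exact hq i hi)
      simp only [Bool.not_not] at this
      simp only [Bool.not_not, Function.update_self, Function.update_of_ne hne, hlen', hq', hlen]
      exact this
  · refine both ?_ ?_
    · refine (h.root b).congr (hoe b) ?_ ?_ ?_ ?_ (fun i _ hi => hq i (hi.trans_lt (heL b))) (fun i _ _ => by rw [hq'])
      · rw [Function.update_self, extend_lt hL]
      · rw [Function.update_self, extend_lt hL]
      · rw [Function.update_of_ne hne]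
      · rw [Function.update_of_ne hne]
    · have := h.root (!b)
      rw [Bool.not_not] at this ⊢
      refine this.congr (hoe _) ?_ ?_ ?_ ?_ (fun i _ _ => by rw [hq']) (fun i _ hi => hq i (hi.trans_lt (heL b)))
      · rw [Function.update_of_ne hne]
      · rw [Function.update_of_ne hne]
      · rw [Function.update_self, extend_lt hL]
      · rw [Function.update_self, extend_lt hL]
  · refine both ?_ ?_
    · intro i hi
      rw [hq', hq i (hi.trans hL)]
      exact h.pre b i hi
    · intro i hi
      rw [hq']
      obtain ⟨j, hj, e⟩ := h.pre (!b) i hi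
      rw [Bool.not_not] at hj e ⊢
      exact ⟨j, hj, by rw [hq j (hj.trans hL), e]⟩

/-- The part of the queues before the pointers has been processed. -/
structure Processed (o : Bool → ℕ) (s : State) : Prop where
  o_le : ∀ b, o b ≤ s.reg (rPtr b)
  le : ∀ b, s.reg (rPtr b) ≤ s.reg (rLen b)
  done : ∀ b k, o b ≤ k → k < s.reg (rPtr b) → s.arr (aMk (!b) true) (s.arr (aQ b) k) ≠ 0

/-- The number of vertices that still have to be placed or processed. -/
def pot (N : ℕ) (s : State) : ℕ :=
  (N - s.reg (rPtr false)) + (N - s.reg (rPtr true)) + (N - s.reg (rLen false)) + (N - s.reg (rLen true))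

theorem pot_eq (N : ℕ) (b : Bool) (s : State) :
    pot N s = (N - s.reg (rPtr b)) + (N - s.reg (rPtr !b)) + (N - s.reg (rLen b)) + (N - s.reg (rLen !b)) := by
  cases b <;> simp only [pot, Bool.not_false, Bool.not_true]
  omega

/-- Process the next vertex in a queue: place its cycle in the other graph. -/
def process (b : Bool) : Program :=
  .instr (.load 10 (aQ b) (rPtr b)) ;; .instr (.succ (rPtr b) (rPtr b)) ;; .instr (.load 9 (aMk (!b) true) 10) ;;
  .branch (.eq 9 3) (place !b) .skip

/-- If the vertex at the pointer is missing on the other axis, all vertices before it in its queue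
are present there, which is the condition for opening a block with it. The pointer moves by 1 and
the other queue grows by m + 1, so the potential drops by 20(m + 2), enough for the steps of
`place`. -/
theorem run_process (K : Consts N (3 * N) X ε) (h : Comp N nb X ε far base u ids o q0 c0 st en dl s)
    (hP : Processed o s) {b : Bool} (hlt : s.reg (rPtr b) < s.reg (rLen b)) :
    Run (process b) s fun t s' => (∃ st' en' dl', Comp N nb X ε far base u ids o q0 c0 st' en' dl' s') ∧
      Processed o s' ∧ s'.reg 19 = s.reg 19 ∧ t + 3 + 20 * pot N s' ≤ 20 * pot N s := by
  have key : ∀ s1 : State, s1 = (Instr.load 9 (aMk (!b) true) 10).run ((Instr.succ (rPtr b) (rPtr b)).run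
      ((Instr.load 10 (aQ b) (rPtr b)).run s)) →
    Run (process b) s fun t s' => (∃ st' en' dl', Comp N nb X ε far base u ids o q0 c0 st' en' dl' s') ∧
      Processed o s' ∧ s'.reg 19 = s.reg 19 ∧ t + 3 + 20 * pot N s' ≤ 20 * pot N s := by
    intro s1 hs1
    have hb : rPtr b ≠ 9 ∧ rPtr b ≠ 10 := by cases b <;> decide
    have ereg : ∀ r, r ≠ 9 → r ≠ 10 → r ≠ rPtr b → s1.reg r = s.reg r := fun r h1 h2 h3 => by
      rw [hs1]; simp [Instr.run, State.setReg, h1, h2, h3]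
    have e10 : s1.reg 10 = s.arr (aQ b) (s.reg (rPtr b)) := by
      rw [hs1]; simp [Instr.run, State.setReg, hb.2.symm]
    have ep : s1.reg (rPtr b) = s.reg (rPtr b) + 1 := by
      rw [hs1]; simp [Instr.run, State.setReg, hb.1, hb.2]
    have e9 : s1.reg 9 = s.arr (aMk (!b) true) (s.arr (aQ b) (s.reg (rPtr b))) := by
      rw [hs1]; simp [Instr.run, State.setReg, hb.2.symm]
    have earr : s1.arr = s.arr := by rw [hs1]; rfl
    have erarr : s1.rarr = s.rarr := by rw [hs1]; rfl
    have erreg : s1.rreg = s.rreg := by rw [hs1]; rfl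
    have eL : ∀ b', s1.reg (rLen b') = s.reg (rLen b') := fun b' =>
      ereg _ (by cases b' <;> decide) (by cases b' <;> decide) (by cases b <;> cases b' <;> decide)
    have epo : s1.reg (rPtr !b) = s.reg (rPtr !b) :=
      ereg _ (by cases b <;> decide) (by cases b <;> decide) (by cases b <;> decide)
    have e19 : s1.reg 19 = s.reg 19 := ereg _ (by decide) (by decide) (by cases b <;> decide)
    have h1 : Comp N nb X ε far base u ids o q0 c0 st en dl s1 := by
      refine h.congr (fun r hr => ?_) earr erreg erarr
      refine ereg r (by omega) (by omega) ?_
      rintro rfl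
      revert hr
      cases b <;> decide
    have hoP := hP.o_le b
    have hbN := (h.side b).len_le
    have hobN := (h.side (!b)).len_le
    have hPo := hP.le (!b)
    simp only [process, run_seq, run_instr, ← hs1, run_branch, Test.Holds, run_skip, e9, h1.env.r3]
    have both : ∀ {p : Bool → Prop}, p b → p (!b) → ∀ b', p b' := by
      intro p h1 h2 b'
      rcases Bool.eq_or_eq_not b' b with rfl | rfl
      · exact h1
      · exact h2
    constructor
    · intro hz
      refine (run_place (N := N) (nb := nb !b) h1.env.r3 h1.env.r4 (by rw [h1.env.r18]; decide) h1.env.x6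
        (h1.side _).two (fun v w hv hm hw => (h1.side _).marks_closed hv hm hw) ?_ ?_).mono ?_
      · rw [e10]; exact (h.side b).q_lt _ hlt
      · rw [earr, e10]; exact hz
      · rintro t s' ⟨z, m, hp, hn, ht⟩
        have hlen' : s'.reg (rLen b) = s.reg (rLen b) := by
          rw [hp.reg _ (by cases b <;> decide) (by cases b <;> decide) (by cases b <;> decide) (by cases b <;> decide)
            (by cases b <;> decide), eL]
        have hptr : ∀ b', s'.reg (rPtr b') = s1.reg (rPtr b') := fun b' =>
          hp.reg _ (by cases b' <;> decide) (by cases b' <;> decide) (by cases b' <;> decide)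
            (by cases b' <;> decide) (by cases b <;> cases b' <;> decide)
        have hlen := hp.len
        rw [eL] at hlen
        have hqb : s'.arr (aQ b) = s.arr (aQ b) := by
          rw [hp.arr _ (by cases b <;> decide) (by cases b <;> decide), earr]
        have hmb : s'.arr (aMk b true) = s.arr (aMk b true) := by
          rw [hp.arr _ (by cases b <;> decide) (by cases b <;> decide), earr]
        have hmono : ∀ w, s.arr (aMk (!b) true) w ≠ 0 → s'.arr (aMk (!b) true) w ≠ 0 := by
          intro w hw
          by_cases hex : ∃ i, i ≤ m ∧ z i = w
          · obtain ⟨i, hi, rfl⟩ := hex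
            exact hp.mk_new i hi
          · rw [hp.mk_old w fun i hi e => hex ⟨i, hi, e⟩, earr]; exact hw
        refine ⟨h1.place K hp hn ⟨s.reg (rPtr b), ?_, ?_, ?_, ?_⟩, ⟨?_, ?_, ?_⟩, ?_, ?_⟩
        · rw [Bool.not_not]; exact hoP
        · rw [Bool.not_not, eL]; exact hlt
        · rw [Bool.not_not, earr, e10]
        · intro k' hk1 hk2
          rw [Bool.not_not] at hk1 ⊢
          rw [earr, eL]
          obtain ⟨j, hj, e⟩ := ((h.side (!b)).mk_iff _ ((h.side b).q_lt k' (hk2.trans hlt))).1 (hP.done b k' hk1 hk2)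
          refine ⟨j, ?_, hj, e⟩
          -- A position before the offset would belong to an earlier component. By `pre` the vertex
          -- would then also be old in this queue, against injectivity.
          by_contra hjo
          obtain ⟨j', hj', e'⟩ := h.pre (!b) j (by omega)
          rw [Bool.not_not] at hj' e'
          have := (h.side b).q_inj j' k' (by omega) (by omega) (e'.trans e)
          omega
        · refine both ?_ ?_
          · rw [hptr, ep]; omega
          · rw [hptr, epo]; exact hP.o_le _
        · refine both ?_ ?_
          · rw [hptr, ep, hlen']; exact hlt
          · rw [hptr, epo, hlen]; omega
        · refine both ?_ ?_
          · intro k hk1 hk2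
            rw [hptr, ep] at hk2
            rw [hqb]
            rcases Nat.lt_succ_iff_lt_or_eq.1 hk2 with hk2 | rfl
            · exact hmono _ (hP.done b k hk1 hk2)
            · have := hp.mk_new 0 (Nat.zero_le _)
              rwa [hp.head, e10] at this
          · intro k hk1 hk2
            rw [hptr, epo] at hk2
            rw [Bool.not_not, hmb, hp.q_old k (by rw [eL]; omega), earr]
            have := hP.done (!b) k hk1 hk2
            rwa [Bool.not_not] at this
        · rw [hp.reg _ (by decide) (by decide) (by decide) (by decide) (by cases b <;> decide), e19]
        · have hle : s'.reg (rLen !b) ≤ N := by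
            have := ((h1.side (!b)).appended hp).len_le
            rw [eL] at this
            omega
          rw [pot_eq N b s', pot_eq N b s, hptr, hptr, ep, epo, hlen', hlen]
          rw [hlen] at hle
          omega
    · intro hz
      refine ⟨⟨_, _, _, h1⟩, ⟨?_, ?_, ?_⟩, e19, ?_⟩
      · refine both ?_ ?_
        · rw [ep]; omega
        · rw [epo]; exact hP.o_le _
      · refine both ?_ ?_
        · rw [ep, eL]; exact hlt
        · rw [epo, eL]; exact hPo
      · refine both ?_ ?_
        · intro k hk1 hk2
          rw [ep] at hk2
          rw [earr]
          rcases Nat.lt_succ_iff_lt_or_eq.1 hk2 with hk2 | rfl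
          · exact hP.done b k hk1 hk2
          · exact hz
        · intro k hk1 hk2
          rw [epo] at hk2
          rw [earr]
          exact hP.done _ k hk1 hk2
      · rw [pot_eq N b s1, pot_eq N b s, ep, epo, eL, eL]
        omega
  exact key _ rfl

/-- Process the queues until both are exhausted. -/
def bfs : Program :=
  .instr (.copy 19 4) ;; .loop (.not (.eq 19 3)) (
    .branch (.lt (rPtr false) (rLen false)) (process false) (
      .branch (.lt (rPtr true) (rLen true)) (process true) (.instr (.copy 19 3))))

/-- Register `19` is 1 while the loop runs and is cleared once both pointers have reached the ends
of their queues; its term in the potential pays for that last iteration. -/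
theorem run_bfs (K : Consts N (3 * N) X ε) (h : Comp N nb X ε far base u ids o q0 c0 st en dl s)
    (hP : Processed o s) :
    Run bfs s fun t s' => (∃ st' en' dl', Comp N nb X ε far base u ids o q0 c0 st' en' dl' s') ∧
      Processed o s' ∧ (∀ b, s'.reg (rPtr b) = s'.reg (rLen b)) ∧ t + 20 * pot N s' ≤ 20 * pot N s + 10 := by
  rw [bfs, run_seq, run_instr]
  have pot_congr : ∀ s s' : State, (∀ b, s'.reg (rPtr b) = s.reg (rPtr b)) → (∀ b, s'.reg (rLen b) = s.reg (rLen b)) →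
      pot N s' = pot N s := fun s s' h1 h2 => by simp only [pot, h1, h2]
  have P_congr : ∀ (s : State) (c : ℕ), Processed o s → Processed o ((Instr.copy 19 c).run s) := by
    intro s c hs
    refine ⟨fun b => ?_, fun b => ?_, fun b => ?_⟩
    · have := hs.o_le b
      cases b <;> simpa [Instr.run, State.setReg, rPtr] using this
    · have := hs.le b
      cases b <;> simpa [Instr.run, State.setReg, rPtr, rLen] using this
    · have := hs.done b
      cases b <;> simpa [Instr.run, State.setReg, rPtr] using this
  have C_congr : ∀ (s : State) (c : ℕ) {st en dl}, Comp N nb X ε far base u ids o q0 c0 st en dl s →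
      Comp N nb X ε far base u ids o q0 c0 st en dl ((Instr.copy 19 c).run s) := by
    intro s c st en dl hs
    refine hs.congr (fun r hr => ?_) rfl rfl rfl
    simp [Instr.run, State.setReg, show r ≠ 19 by omega]
  have hpot : ∀ (s : State) (c : ℕ), pot N ((Instr.copy 19 c).run s) = pot N s := fun s c =>
    pot_congr _ _ (fun b => by cases b <;> simp [Instr.run, State.setReg, rPtr])
      (fun b => by cases b <;> simp [Instr.run, State.setReg, rLen])
  refine (run_loop (fun s => (∃ st' en' dl', Comp N nb X ε far base u ids o q0 c0 st' en' dl' s) ∧ Processed o s ∧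
    (s.reg 19 = 0 → ∀ b, s.reg (rPtr b) = s.reg (rLen b))) (fun s => 20 * pot N s + 5 * s.reg 19) ?_
    ⟨⟨_, _, _, C_congr s 4 h⟩, P_congr s 4 hP, ?_⟩).mono ?_
  · rintro s ⟨⟨st, en, dl, hs⟩, hP, -⟩ hb
    have h19 : s.reg 19 ≠ 0 := by simpa [Test.Holds, hs.env.r3] using hb
    have h19' : 1 ≤ s.reg 19 := by omega
    simp only [run_branch, Test.Holds, run_instr]
    refine ⟨fun hl => (run_process K hs hP hl).mono ?_, fun hl => ⟨fun hl' => (run_process K hs hP hl').mono ?_,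
      fun hl' => ?_⟩⟩
    · rintro t s' ⟨h1, h2, h3, h4⟩
      exact ⟨⟨h1, h2, fun e => absurd (h3.symm.trans e) h19⟩, by omega⟩
    · rintro t s' ⟨h1, h2, h3, h4⟩
      exact ⟨⟨h1, h2, fun e => absurd (h3.symm.trans e) h19⟩, by omega⟩
    · refine ⟨⟨⟨_, _, _, C_congr s 3 hs⟩, P_congr s 3 hP, fun _ b => ?_⟩, ?_⟩
      · have := hP.le b
        cases b <;> simp only [rPtr, rLen, cond] at * <;> simp [Instr.run, State.setReg] <;> omega
      · rw [hpot]
        simp only [Instr.run, State.setReg, Function.update_self, hs.env.r3]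
        omega
  · intro e
    simp [Instr.run, State.setReg, h.env.r4] at e
  · rintro t s' ⟨⟨⟨st', en', dl', h1⟩, h2, h3⟩, h4, h5⟩
    have h19 : s'.reg 19 = 0 := by simpa [Test.Holds, h1.env.r3] using h4
    refine ⟨⟨_, _, _, h1⟩, h2, h3 h19, ?_⟩
    rw [hpot] at h5
    simp only [Instr.run, State.setReg, Function.update_self, h.env.r4] at h5
    omega

end

end RealRAM

/-! ### First blocks of a component, placed as ordinary blocks -/

namespace RealRAM

theorem forall_bool_of {p : Bool → Prop} (b : Bool) (h1 : p b) (h2 : p (!b)) : ∀ b', p b' := by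
  intro b'
  rcases Bool.eq_or_eq_not b' b with rfl | rfl
  · exact h1
  · exact h2

/-- The link between component numbers, which encode reachability, and membership in a placed cycle.
-/
theorem Placed.reachable_iff {b : Bool} {N : ℕ} {nb : ℕ → ℕ → Prop} {v : ℕ} {z : ℕ → ℕ} {m : ℕ} {s s' : State}
    (hp : Placed b N nb v z m s s') (w : ℕ) : Relation.ReflTransGen nb v w ↔ ∃ i, i ≤ m ∧ z i = w := by
  constructor
  · intro h
    induction h with
    | refl => exact ⟨0, Nat.zero_le _, hp.head⟩
    | tail _ hw ih =>
      obtain ⟨i, hi, rfl⟩ := ih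
      obtain ⟨j, hj, rfl, -⟩ := hp.nbr i _ hi hw
      exact ⟨j, hj, rfl⟩
  · rintro ⟨i, hi, rfl⟩
    induction i with
    | zero => rw [hp.head]
    | succ i ih => exact (ih (by omega)).tail (hp.succ i (by omega))

/-- The state before the component of `u` is placed. -/
structure Start (N : ℕ) (nb : Bool → ℕ → ℕ → Prop) (X ε base : ℝ) (u : ℕ) (ids : Bool → ℕ → ℕ)
    (o : Bool → ℕ) (q0 : Bool → ℕ → ℕ) (c0 : Bool → ℕ → ℝ) (s : State) : Prop where
  env : Env N ε X base u ids s
  side : ∀ b, SideInv b N (nb b) X ε False base (o b) id id 0 (q0 b) (c0 b) s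
  len : ∀ b, s.reg (rLen b) = o b
  ptr : ∀ b, s.reg (rPtr b) = o b
  e_pos : 0 < s.rreg 4
  e_le : s.rreg 4 ≤ 1
  u_lt : u < N
  free : ∀ b, s.arr (aMk b true) u = 0
  pre : ∀ b i, i < o b → ∃ j, j < o !b ∧ q0 (!b) j = q0 b i
  ids_iff : ∀ b v w, v < N → w < N → (ids b v = ids b w ↔ Relation.ReflTransGen (nb b) v w)

section

variable {N : ℕ} {nb : Bool → ℕ → ℕ → Prop} {X ε : ℝ} {far : Prop} {base : ℝ} {u : ℕ}
  {ids : Bool → ℕ → ℕ} {o : Bool → ℕ} {q0 : Bool → ℕ → ℕ} {c0 : Bool → ℕ → ℝ}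
  {s s' : State}

/-- The invariant holds when the first blocks of both graphs have been placed. -/
theorem Comp.init {z : Bool → ℕ → ℕ} {m : Bool → ℕ} {δ : Bool → ℝ} (env : Env N ε X base u ids s)
    (side : ∀ b, SideInv b N (nb b) X ε far base (o b) (extend (o b) id (o b)) (extend (o b) id (o b + m b))
      (extend (o b) 0 (δ b)) (q0 b) (c0 b) s)
    (e_pos : 0 < s.rreg 4) (e_le : s.rreg 4 ≤ 1) (hδ : ∀ b, s.rreg 4 ≤ δ b)
    (len : ∀ b, s.reg (rLen b) = o b + (m b + 1)) (ptr : ∀ b, s.reg (rPtr b) = o b)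
    (hz : ∀ b i, i ≤ m b → s.arr (aQ b) (o b + i) = z b i) (head : ∀ b, z b 0 = u) (pos : ∀ b, 1 ≤ m b)
    (near : ¬ far → ∀ b, δ b ≤ ε * δ (!b) ∨ ∃ k, k ≤ m (!b) ∧ z (!b) k = z b (m b) ∧ (k < m (!b) ∨ m (!b) = 1))
    (hfar : far → ∀ b k, k ≤ m (!b) → z (!b) k ≠ z b 1 ∧ z (!b) k ≠ z b (m b))
    (pre : ∀ b i, i < o b → ∃ j, j < o !b ∧ q0 (!b) j = q0 b i) :
    (∃ st en dl, Comp N nb X ε far base u ids o q0 c0 st en dl s) ∧ Processed o s := by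
  refine ⟨⟨fun b => extend (o b) id (o b), fun b => extend (o b) id (o b + m b), fun b => extend (o b) 0 (δ b), env, side,
    e_pos, e_le, fun b i hi _ => by rw [extend_ge hi]; exact hδ b, fun b => by rw [len]; omega,
    fun b => extend_ge le_rfl, fun b => ?_, fun b i hi _ hne => absurd (extend_ge hi) hne, fun b => ⟨fun hf => ?_, fun hf k h1 h2 => ?_⟩,
    fun b i hi => ?_⟩, fun b => (ptr b).ge, fun b => by rw [ptr, len]; omega,
    fun b k h1 h2 => by rw [ptr] at h2; omega⟩
  · have := hz b 0 (Nat.zero_le _)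
    rwa [head] at this
  · simp only [extend_ge le_rfl]
    rcases near hf b with h | ⟨k, h1, h2, h3⟩
    · exact Or.inl h
    · refine Or.inr ⟨o (!b) + k, by omega, by omega, ?_, by omega⟩
      rw [hz _ k h1, h2, hz b _ le_rfl]
  · simp only [extend_ge le_rfl] at h2 ⊢
    obtain ⟨j, rfl⟩ := Nat.exists_eq_add_of_le h1
    rw [hz _ j (by omega), hz b _ le_rfl, hz b 1 (pos b)]
    exact hfar hf b j (by omega)
  · obtain ⟨j, hj, e⟩ := pre b i hi
    exact ⟨j, hj, by rw [((side _).old j hj).1, ((side b).old i hi).1, e]⟩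

/-- The slot arrays `6` to `9` may change as long as they describe the same 2-regular graphs: the
neighbours of the root will be exchanged. -/
theorem Start.congr (h : Start N nb X ε base u ids o q0 c0 s)
    (hr : ∀ r, r = 3 ∨ r = 4 ∨ r = 5 ∨ r = 18 ∨ r = 20 ∨ r = 14 ∨ r = 15 ∨ r = 16 ∨ r = 17 → s'.reg r = s.reg r)
    (ha : ∀ a, a < 6 ∨ 9 < a → s'.arr a = s.arr a)
    (h2 : ∀ b, TwoRegular N (nb b) (s'.arr (aF b)) (s'.arr (aG b)))
    (hx : s'.rreg = s.rreg) (hxa : s'.rarr = s.rarr) :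
    Start N nb X ε base u ids o q0 c0 s' := by
  have hl : ∀ b, s'.reg (rLen b) = s.reg (rLen b) := fun b => hr _ (by cases b <;> decide)
  have hQ : ∀ b, s'.arr (aQ b) = s.arr (aQ b) := fun b => ha _ (by cases b <;> decide)
  have hM : ∀ b p, s'.arr (aMk b p) = s.arr (aMk b p) := fun b p => ha _ (by cases b <;> cases p <;> decide)
  refine ⟨h.env.congr (fun r hr' => hr r (by omega)) (fun b => hM _ _) (fun r _ => by rw [hx]), fun b => ?_, ?_, ?_,
    ?_, ?_, h.u_lt, ?_, h.pre, h.ids_iff⟩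
  · have hs := h.side b
    constructor <;> try simp only [hQ, hM, hl, hx, hxa]
    exacts [h2 b, hs.o_le, hs.blocks, hs.coords, hs.mk_iff, hs.q_lt, hs.q_inj, hs.xc_ge, hs.xc_le, hs.base_le,
      hs.far_base_le, hs.closed, hs.old]
  · intro b; rw [hl, h.len]
  · intro b; rw [hr _ (by cases b <;> decide), h.ptr]
  · rw [hx]; exact h.e_pos
  · rw [hx]; exact h.e_le
  · intro b; rw [hM, h.free]

/-- Exchange the two neighbours of the vertex in register `20`. -/
def exchange (b : Bool) : Program :=
  .instr (.load 21 (aF b) 20) ;; .instr (.load 22 (aG b) 20) ;; .instr (.store (aF b) 20 22) ;;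
  .instr (.store (aG b) 20 21)

theorem run_exchange (h : Start N nb X ε base u ids o q0 c0 s) (b : Bool) :
    Run (exchange b) s fun t s' => Start N nb X ε base u ids o q0 c0 s' ∧ t = 4 ∧
      s'.arr (aF b) u = s.arr (aG b) u ∧ s'.arr (aG b) u = s.arr (aF b) u ∧
      s'.arr (aF !b) = s.arr (aF !b) ∧ s'.arr (aG !b) = s.arr (aG !b) := by
  have key : ∀ s' : State, (Instr.store (aG b) 20 21).run ((Instr.store (aF b) 20 22).run
      ((Instr.load 22 (aG b) 20).run ((Instr.load 21 (aF b) 20).run s))) = s' →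
      Start N nb X ε base u ids o q0 c0 s' ∧ 
      s'.arr (aF b) u = s.arr (aG b) u ∧ s'.arr (aG b) u = s.arr (aF b) u ∧
      s'.arr (aF !b) = s.arr (aF !b) ∧ s'.arr (aG !b) = s.arr (aG !b) := by
    intro s' hs'
    have hu := h.env.r20
    have ea : ∀ a, a ≠ aF b → a ≠ aG b → s'.arr a = s.arr a := fun a h1 h2 => by
      rw [← hs']; simp [Instr.run, State.setReg, h1, h2]
    have eF : s'.arr (aF b) = Function.update (s.arr (aF b)) u (s.arr (aG b) u) := by
      rw [← hs']
      cases b <;> simp [Instr.run, State.setReg, aF, aG, hu]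
    have eG : s'.arr (aG b) = Function.update (s.arr (aG b)) u (s.arr (aF b) u) := by
      rw [← hs']
      cases b <;> simp [Instr.run, State.setReg, aF, aG, hu]
    have eF' : s'.arr (aF !b) = s.arr (aF !b) := ea _ (by cases b <;> decide) (by cases b <;> decide)
    have eG' : s'.arr (aG !b) = s.arr (aG !b) := ea _ (by cases b <;> decide) (by cases b <;> decide)
    refine ⟨h.congr ?_ ?_ (forall_bool_of b ?_ ?_) ?_ ?_, by rw [eF, Function.update_self],
      by rw [eG, Function.update_self], eF', eG'⟩
    · intro r hr
      rw [← hs']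
      simp [Instr.run, State.setReg, show r ≠ 21 by omega, show r ≠ 22 by omega]
    · intro a haa
      refine ea a ?_ ?_ <;> rintro rfl <;> revert haa <;> cases b <;> decide
    · rw [eF, eG]
      refine (h.side b).two.swap fun v hv => ?_
      by_cases e : v = u
      · subst e; exact Or.inr ⟨Function.update_self .., Function.update_self ..⟩
      · exact Or.inl ⟨Function.update_of_ne e _ _, Function.update_of_ne e _ _⟩
    · rw [eF', eG']; exact (h.side _).two
    · rw [← hs']; rfl
    · rw [← hs']; rfl
  obtain ⟨k1, k2⟩ := key _ rfl
  simp only [exchange, run_seq, run_instr]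
  exact ⟨k1, trivial, k2⟩

/-- If one of the neighbours of the vertex in register `20` belongs to the cycle of this vertex in the other
graph, make it the second neighbour. -/
def orient (b : Bool) : Program :=
  .instr (.load 23 (aF b) 20) ;; .instr (.load 24 (aMk (!b) false) 23) ;; .instr (.load 25 (aMk (!b) false) 20) ;;
  .branch (.eq 24 25) (exchange b) .skip

/-- If the second neighbour of `u` is outside the cycle of `u` in the other graph, then so is the first. -/
def Oriented (ids : Bool → ℕ → ℕ) (u : ℕ) (b : Bool) (s : State) : Prop :=
  ids (!b) (s.arr (aF b) u) = ids (!b) u → ids (!b) (s.arr (aG b) u) = ids (!b) u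

theorem Start.setReg (h : Start N nb X ε base u ids o q0 c0 s) {r : ℕ} (hr : 20 < r) (v : ℕ) :
    Start N nb X ε base u ids o q0 c0 (s.setReg r v) :=
  h.congr (fun r' hr' => Function.update_of_ne (by omega) _ _) (fun _ _ => rfl) (fun b => (h.side b).two) rfl rfl

theorem run_orient (h : Start N nb X ε base u ids o q0 c0 s) (b : Bool) :
    Run (orient b) s fun t s' => Start N nb X ε base u ids o q0 c0 s' ∧ t ≤ 8 ∧ Oriented ids u b s' ∧
      s'.arr (aF !b) = s.arr (aF !b) ∧ s'.arr (aG !b) = s.arr (aG !b) := by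
  have h' := ((h.setReg (r := 23) (by omega) (s.arr (aF b) u)).setReg (r := 24) (by omega)
    (ids (!b) (s.arr (aF b) u))).setReg (r := 25) (by omega) (ids (!b) u)
  simp only [orient, run_seq, run_instr, run_branch, run_skip, Test.Holds]
  simp only [Instr.run, State.setReg, h.env.r20, h.env.id, Function.update_self, Function.update_of_ne, ne_eq,
    Nat.reduceEqDiff, not_false_eq_true]
  refine ⟨fun e => ?_, fun e => ⟨h', by omega, fun e' => absurd e' e, trivial, trivial⟩⟩
  refine (run_exchange h' b).mono ?_
  rintro t s' ⟨h1, rfl, h2, h3, h4, h5⟩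
  refine ⟨h1, by omega, fun _ => ?_, h4, h5⟩
  rw [h3]; exact e

/-- Place the first blocks, both as ordinary blocks. -/
def rootNear (b : Bool) : Program :=
  .instr (.load 23 (aG b) 20) ;; .instr (.load 24 (aG !b) 20) ;; .branch (.eq 23 24) (exchange !b) .skip ;;
  .instr (.copy 10 20) ;; place b ;; .instr (.copy 10 20) ;; place !b

/-- Block `b` is placed first, so the other first block has an ε times smaller gap and needs nothing
more. For block `b`, `hG` says that its last vertex lies on the other cycle of the root; `hne`
ensures that it is not the last vertex there, unless that cycle has length two. -/
theorem run_rootNear_aux (K : Consts N (3 * N) X ε) (h : Start N nb X ε base u ids o q0 c0 s) (b : Bool)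
    (hG : ids (!b) (s.arr (aG b) u) = ids (!b) u)
    (hne : s.arr (aG b) u = s.arr (aG !b) u → s.arr (aF !b) u = s.arr (aG !b) u) :
    Run (.instr (.copy 10 20) ;; place b ;; .instr (.copy 10 20) ;; place !b) s fun t s' =>
      (∃ st en dl, Comp N nb X ε False base u ids o q0 c0 st en dl s') ∧ Processed o s' ∧
        t + 20 * pot N s' ≤ 20 * pot N s + 18 := by
  have hε := K.ε_pos
  have hε1 : ε ≤ 1 := K.le_one le_rfl
  have hE := h.e_pos
  have hE1 := h.e_le
  have hδ : 0 < s.rreg 4 * ε := mul_pos hE hε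
  have hδε : s.rreg 4 * ε ≤ ε := by nlinarith
  have hδ' : 0 < s.rreg 4 * ε * ε := mul_pos hδ hε
  have hδε' : s.rreg 4 * ε * ε ≤ ε := by nlinarith
  have hnb : (!b) ≠ b := Bool.not_ne_self b
  have h10 : ∀ s : State, Env N ε X base u ids s → Env N ε X base u ids ((Instr.copy 10 20).run s) := fun s hs =>
    hs.congr (fun r hr => by simp [Instr.run, State.setReg, show r ≠ 10 by omega]) (fun _ => rfl) fun _ _ => rfl
  have hS10 : ∀ (s : State) {b st en dl o q0 c0}, SideInv b N (nb b) X ε False base o st en dl q0 c0 s →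
      SideInv b N (nb b) X ε False base o st en dl q0 c0 ((Instr.copy 10 20).run s) := fun s b _ _ _ _ _ _ hs =>
    hs.congr rfl rfl rfl rfl rfl rfl (by cases b <;> rfl)
  have e10 : ∀ s : State, ((Instr.copy 10 20).run s).reg 10 = s.reg 20 := fun _ => by
    simp [Instr.run, State.setReg]
  have er : ∀ (s : State) (r : ℕ), r ≠ 10 → ((Instr.copy 10 20).run s).reg r = s.reg r := fun s r hr =>
    Function.update_of_ne hr _ _
  simp only [run_seq, run_instr]
  have env0 := h10 s h.env
  have side0 := hS10 s (h.side b)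
  refine (run_place (N := N) (nb := nb b) env0.r3 env0.r4 (by rw [env0.r18]; decide) env0.x6 side0.two
    (fun v w hv hm hw => side0.marks_closed hv hm hw) ?_ ?_).mono ?_
  · rw [e10, h.env.r20]; exact h.u_lt
  · rw [e10, h.env.r20]; exact h.free b
  rintro t1 s1 ⟨z, m, hp, hn, ht1⟩
  rw [e10, h.env.r20] at hp
  rw [env0.x5] at hn
  change PlacedNear b (s.rreg 4 * ε) z m _ s1 at hn
  have env1 := h10 s1 (env0.placed hp)
  have side1 := side0.append K hp hn hδ hδε False.elim
  have side1' : SideInv (!b) N (nb !b) X ε False base (o !b) id id 0 (q0 !b) (c0 !b) s1 :=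
    (hS10 s (h.side !b)).placed_other (by rw [Bool.not_not]; exact hp)
  have side2' := hS10 s1 side1'
  have side2 := hS10 s1 side1
  have hlen0 : ∀ b, ((Instr.copy 10 20).run s).reg (rLen b) = o b := fun b => by
    rw [er _ _ (by cases b <;> decide), h.len]
  have hlen1 : s1.reg (rLen b) = o b + (m + 1) := by rw [hp.len, hlen0]
  have hlen1' : s1.reg (rLen !b) = o !b := by
    rw [hp.reg _ (by cases b <;> decide) (by cases b <;> decide) (by cases b <;> decide) (by cases b <;> decide)
      (by cases b <;> decide), hlen0]
  have hM1 : s1.arr (aMk (!b) true) = s.arr (aMk (!b) true) :=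
    hp.arr _ (by cases b <;> decide) (by cases b <;> decide)
  have h20 : s1.reg 20 = u := by rw [(env0.placed hp).r20]
  rw [hlen0] at side2
  refine (run_place (N := N) (nb := nb !b) env1.r3 env1.r4 (by rw [env1.r18]; decide) env1.x6 side2'.two
    (fun v w hv hm hw => side2'.marks_closed hv hm hw) ?_ ?_).mono ?_
  · rw [e10, h20]; exact h.u_lt
  · rw [e10, h20]; exact (congrFun hM1 u).trans (h.free !b)
  rintro t2 s2 ⟨z', m', hp', hn', ht2⟩
  rw [e10, h20] at hp'
  rw [env1.x5] at hn'
  change PlacedNear (!b) (s1.rreg 4 * ε) z' m' _ s2 at hn'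
  rw [hn.e] at hn'
  have env2 := env1.placed hp'
  have side3' := side2'.append K hp' hn' hδ' hδε' False.elim
  rw [er _ _ (by cases b <;> decide), hlen1'] at side3'
  have side3 := side2.placed_other hp'
  have hlen2 : s2.reg (rLen b) = o b + (m + 1) := by
    rw [hp'.reg _ (by cases b <;> decide) (by cases b <;> decide) (by cases b <;> decide) (by cases b <;> decide)
      (by cases b <;> decide), er _ _ (by cases b <;> decide), hlen1]
  have hlen2' : s2.reg (rLen !b) = o (!b) + (m' + 1) := by
    rw [hp'.len, er _ _ (by cases b <;> decide), hlen1']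
  have hptr : ∀ c, s2.reg (rPtr c) = o c := fun c => by
    rw [hp'.reg _ (by cases c <;> decide) (by cases c <;> decide) (by cases c <;> decide) (by cases c <;> decide)
      (by cases b <;> cases c <;> decide), er _ _ (by cases c <;> decide),
      hp.reg _ (by cases c <;> decide) (by cases c <;> decide) (by cases c <;> decide) (by cases c <;> decide)
      (by cases b <;> cases c <;> decide), er _ _ (by cases c <;> decide), h.ptr]
  have hq : ∀ i, i ≤ m → s2.arr (aQ b) (o b + i) = z i := fun i hi => by
    rw [hp'.arr _ (by cases b <;> decide) (by cases b <;> decide)]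
    have := hp.q_new i hi
    rwa [hlen0] at this
  have hq' : ∀ i, i ≤ m' → s2.arr (aQ !b) (o (!b) + i) = z' i := fun i hi => by
    have := hp'.q_new i hi
    rwa [er _ _ (by cases b <;> decide), hlen1'] at this
  have hF1 : s1.arr (aF !b) = s.arr (aF !b) := hp.arr _ (by cases b <;> decide) (by cases b <;> decide)
  have hG1 : s1.arr (aG !b) = s.arr (aG !b) := hp.arr _ (by cases b <;> decide) (by cases b <;> decide)
  have hzm : z m = s.arr (aG b) u := by rw [hp.last, hp.head]; rfl
  have hzm' : z' m' = s.arr (aG !b) u := by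
    rw [hp'.last, hp'.head]
    exact congrFun hG1 u
  have hz1' : z' 1 = s.arr (aF !b) u := by
    rw [hp'.second, hp'.head]
    exact congrFun hF1 u
  refine (and_assoc.1 ⟨Comp.init (z := Function.update (fun _ => z') b z) (m := Function.update (fun _ => m') b m)
    (δ := Function.update (fun _ => s.rreg 4 * ε * ε) b (s.rreg 4 * ε)) env2 (forall_bool_of b ?_ ?_)
    ?_ ?_ (forall_bool_of b ?_ ?_) (forall_bool_of b ?_ ?_) hptr (forall_bool_of b ?_ ?_) (forall_bool_of b ?_ ?_)
    (forall_bool_of b ?_ ?_) (fun _ => forall_bool_of b ?_ ?_) False.elim h.pre, ?_⟩) <;>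
    try simp only [Function.update_self, Function.update_of_ne hnb, Bool.not_not, hn'.e]
  · exact side3
  · exact side3'
  · exact hδ'
  · nlinarith
  · nlinarith
  · exact le_rfl
  · exact hlen2
  · exact hlen2'
  · exact hq
  · exact hq'
  · exact hp.head
  · exact hp'.head
  · exact hp.pos
  · exact hp'.pos
  · right
    have hlt : s.arr (aG b) u < N := (h.side b).two.lt _ _ h.u_lt ((h.side b).two.nb_g h.u_lt)
    obtain ⟨k, hk, e⟩ := (hp'.reachable_iff _).1 ((h.ids_iff (!b) _ _ h.u_lt hlt).1 hG.symm)
    refine ⟨k, hk, by rw [e, hzm], ?_⟩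
    rcases Nat.lt_or_eq_of_le hk with hk | rfl
    · exact Or.inl hk
    · right
      -- If the two last vertices coincide, both slots of the root in the other graph are equal, so
      -- the second vertex of that cycle is also its last.
      have := hp'.inj 1 k hp'.pos le_rfl (by rw [hz1', hzm']; exact hne (by rw [← hzm', e]))
      exact this.symm
  · left; rw [mul_comm]
  · rw [pot_eq N b s2, pot_eq N b s, hptr, hptr, h.ptr, h.ptr, h.len, h.len, hlen2, hlen2']
    have l1 := (hlen2 ▸ side3.len_le : _ ≤ N)
    have l2 := (hlen2' ▸ side3'.len_le : _ ≤ N)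
    have := hp.pos
    have := hp'.pos
    omega

/-- If the second neighbours of the root agree in both graphs, the slots of the other graph are
exchanged. Should they still agree, the root has a double edge there, the case of a cycle of length
two. -/
theorem run_rootNear (K : Consts N (3 * N) X ε) (h : Start N nb X ε base u ids o q0 c0 s) (b : Bool)
    (hG : ids (!b) (s.arr (aG b) u) = ids (!b) u) :
    Run (rootNear b) s fun t s' =>
      (∃ st en dl, Comp N nb X ε False base u ids o q0 c0 st en dl s') ∧ Processed o s' ∧
        t + 20 * pot N s' ≤ 20 * pot N s + 30 := by
  have h' := (h.setReg (r := 23) (by omega) (s.arr (aG b) u)).setReg (r := 24) (by omega) (s.arr (aG !b) u)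
  rw [rootNear, run_seq, run_instr, run_seq, run_instr, run_seq, run_branch]
  simp only [run_skip, Test.Holds]
  simp only [Instr.run, State.setReg, h.env.r20, Function.update_self, Function.update_of_ne, ne_eq,
    Nat.reduceEqDiff, not_false_eq_true]
  have hpot : ∀ {s1 s2 : State}, Start N nb X ε base u ids o q0 c0 s1 → Start N nb X ε base u ids o q0 c0 s2 →
      pot N s1 = pot N s2 := fun h1 h2 => by simp only [pot, h1.ptr, h1.len, h2.ptr, h2.len]
  constructor
  · intro e
    refine (run_exchange h' (!b)).mono ?_
    rintro t s' ⟨h1, rfl, h2, h3, h4, h5⟩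
    rw [Bool.not_not] at h4 h5
    refine (run_rootNear_aux K h1 b ?_ ?_).mono ?_
    · rw [h5]; exact hG
    · rw [h5, h2, h3]; intro e'; exact e.symm.trans e'
    · rintro t' s'' ⟨a1, a2, a3⟩
      rw [hpot h1 h] at a3
      exact ⟨a1, a2, by omega⟩
  · intro e
    refine (run_rootNear_aux K h' b hG fun e' => absurd e' e).mono ?_
    rintro t' s'' ⟨a1, a2, a3⟩
    rw [hpot h' h] at a3
    exact ⟨a1, a2, by omega⟩

end

end RealRAM

/-! ### First blocks of a component, placed far away -/

namespace RealRAM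

section

variable {N : ℕ} {nb : Bool → ℕ → ℕ → Prop} {X ε : ℝ} {base : ℝ} {u : ℕ}
  {ids : Bool → ℕ → ℕ} {o : Bool → ℕ} {q0 : Bool → ℕ → ℕ} {c0 : Bool → ℕ → ℝ}
  {s : State}

/-- Both neighbours of the root in each graph have a number different from the root's in the other
graph, so they avoid the other cycle. This is the `far` condition of `RootOK`. -/
theorem run_rootFar (K : Consts N (3 * N) X ε) (h : Start N nb X ε base u ids o q0 c0 s)
    (hF : ∀ b, ids (!b) (s.arr (aF b) u) ≠ ids (!b) u) (hG : ∀ b, ids (!b) (s.arr (aG b) u) ≠ ids (!b) u) :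
    Run (placeFar false ;; placeFar true) s fun t s' =>
      (∃ st en dl, Comp N nb X ε True base u ids o q0 c0 st en dl s') ∧ Processed o s' ∧
        t + 20 * pot N s' ≤ 20 * pot N s + 30 := by
  have hε := K.ε_pos
  have hε1 : ε ≤ 1 := K.le_one le_rfl
  have hE := h.e_pos
  have hE1 := h.e_le
  have hδ : 0 < s.rreg 4 * ε := mul_pos hE hε
  have hδε : s.rreg 4 * ε ≤ ε := by nlinarith
  have hδ' : 0 < s.rreg 4 * ε * ε := mul_pos hδ hε
  have hδε' : s.rreg 4 * ε * ε ≤ ε := by nlinarith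
  simp only [run_seq]
  refine (run_placeFar (N := N) (nb := nb false) h.env.r3 h.env.r4 (by rw [h.env.r18]; decide) h.env.x6 h.env.x12
    (h.side _).two (fun v w hv hm hw => (h.side _).marks_closed hv hm hw) ?_ ?_).mono ?_
  · rw [h.env.r20]; exact h.u_lt
  · rw [h.env.r20]; exact h.free _
  rintro t1 s1 ⟨z, m, hp, hn, ht1⟩
  rw [h.env.r20] at hp
  rw [h.env.x5] at hn
  have env1 := h.env.placed hp
  have side1 : SideInv false N (nb false) X ε True base _ _ _ _ (q0 false) (c0 false) s1 :=
    SideInv.append_far K h.env (by rw [h.len]; exact h.side false) hp hn hδ hδε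
  rw [h.len] at side1
  have side1' : SideInv true N (nb true) X ε False base (o true) id id 0 (q0 true) (c0 true) s1 :=
    (h.side true).placed_other hp
  have hlen1 : s1.reg (rLen false) = o false + (m + 1) := by rw [hp.len, h.len]
  have hlen1' : s1.reg (rLen true) = o true := by
    rw [hp.reg _ (by decide) (by decide) (by decide) (by decide) (by decide), h.len]
  refine (run_placeFar (N := N) (nb := nb true) env1.r3 env1.r4 (by rw [env1.r18]; decide) env1.x6 env1.x12
    side1'.two (fun v w hv hm hw => side1'.marks_closed hv hm hw) ?_ ?_).mono ?_
  · rw [env1.r20]; exact h.u_lt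
  · rw [env1.r20, hp.arr _ (by decide) (by decide)]; exact h.free _
  rintro t2 s2 ⟨z', m', hp', hn', ht2⟩
  rw [env1.r20] at hp'
  rw [env1.x5, hn.e] at hn'
  have env2 := env1.placed hp'
  have side2' : SideInv true N (nb true) X ε True base _ _ _ _ (q0 true) (c0 true) s2 :=
    SideInv.append_far K env1 (by rw [hlen1']; exact side1') hp' hn' hδ' hδε'
  rw [hlen1'] at side2'
  have side2 : SideInv false N (nb false) X ε True base _ _ _ _ (q0 false) (c0 false) s2 := side1.placed_other hp'
  have hlen2 : s2.reg (rLen false) = o false + (m + 1) := by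
    rw [hp'.reg _ (by decide) (by decide) (by decide) (by decide) (by decide), hlen1]
  have hlen2' : s2.reg (rLen true) = o true + (m' + 1) := by rw [hp'.len, hlen1']
  have hptr : ∀ c, s2.reg (rPtr c) = o c := fun c => by
    rw [hp'.reg _ (by cases c <;> decide) (by cases c <;> decide) (by cases c <;> decide) (by cases c <;> decide)
      (by cases c <;> decide), hp.reg _ (by cases c <;> decide) (by cases c <;> decide) (by cases c <;> decide)
      (by cases c <;> decide) (by cases c <;> decide), h.ptr]
  have hq : ∀ i, i ≤ m → s2.arr (aQ false) (o false + i) = z i := fun i hi => by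
    rw [hp'.arr _ (by decide) (by decide), ← h.len]
    exact hp.q_new i hi
  have hq' : ∀ i, i ≤ m' → s2.arr (aQ true) (o true + i) = z' i := fun i hi => by
    rw [← hlen1']
    exact hp'.q_new i hi
  have hz1 : z 1 = s.arr (aF false) u := by rw [hp.second, hp.head]
  have hzm : z m = s.arr (aG false) u := by rw [hp.last, hp.head]
  have hz1' : z' 1 = s.arr (aF true) u := by rw [hp'.second, hp'.head, hp.arr _ (by decide) (by decide)]
  have hzm' : z' m' = s.arr (aG true) u := by rw [hp'.last, hp'.head, hp.arr _ (by decide) (by decide)]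
  have hid : ∀ k, k ≤ m → ids false (z k) = ids false u := fun k hk =>
    ((h.ids_iff false _ _ h.u_lt (hp.lt k hk)).2 ((hp.reachable_iff _).2 ⟨k, hk, rfl⟩)).symm
  have hid' : ∀ k, k ≤ m' → ids true (z' k) = ids true u := fun k hk =>
    ((h.ids_iff true _ _ h.u_lt (hp'.lt k hk)).2 ((hp'.reachable_iff _).2 ⟨k, hk, rfl⟩)).symm
  refine (and_assoc.1 ⟨Comp.init (z := fun b => cond b z' z) (m := fun b => cond b m' m)
    (δ := fun b => cond b (s.rreg 4 * ε * ε) (s.rreg 4 * ε)) env2 (Bool.forall_bool.2 ⟨side2, side2'⟩)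
    (by rw [hn'.e]; exact hδ') (by rw [hn'.e]; nlinarith) (Bool.forall_bool.2 ⟨?_, ?_⟩)
    (Bool.forall_bool.2 ⟨hlen2, hlen2'⟩) hptr (Bool.forall_bool.2 ⟨hq, hq'⟩) (Bool.forall_bool.2 ⟨hp.head, hp'.head⟩)
    (Bool.forall_bool.2 ⟨hp.pos, hp'.pos⟩) (fun hf => absurd trivial hf) (fun _ => Bool.forall_bool.2 ⟨?_, ?_⟩) h.pre, ?_⟩)
  · simp only [hn'.e, cond]; nlinarith
  · simp only [hn'.e, cond]; exact le_rfl
  · simp only [cond, Bool.not_false, hz1, hzm]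
    exact fun k hk => ⟨fun e => hF false (e ▸ hid' k hk), fun e => hG false (e ▸ hid' k hk)⟩
  · simp only [cond, Bool.not_true, hz1', hzm']
    exact fun k hk => ⟨fun e => hF true (e ▸ hid k hk), fun e => hG true (e ▸ hid k hk)⟩
  · have l1 := (hlen2 ▸ side2.len_le : _ ≤ N)
    have l2 := (hlen2' ▸ side2'.len_le : _ ≤ N)
    have := hp.pos
    have := hp'.pos
    simp only [pot, hptr, h.ptr, h.len, hlen2, hlen2']
    omega

/-- Place the first blocks of the component of the vertex in register `20`. -/
def root : Program :=
  orient false ;; orient true ;; .instr (.load 23 (aG false) 20) ;; .instr (.load 24 (aMk true false) 23) ;;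
  .instr (.load 25 (aMk true false) 20) ;; .branch (.eq 24 25) (rootNear false) (
    .instr (.load 23 (aG true) 20) ;; .instr (.load 24 (aMk false false) 23) ;;
    .instr (.load 25 (aMk false false) 20) ;; .branch (.eq 24 25) (rootNear true) (placeFar false ;; placeFar true))

theorem run_root (K : Consts N (3 * N) X ε) (h : Start N nb X ε base u ids o q0 c0 s) :
    Run root s fun t s' => (∃ far st en dl, Comp N nb X ε far base u ids o q0 c0 st en dl s') ∧ Processed o s' ∧
        t + 20 * pot N s' ≤ 20 * pot N s + 54 := by
  have hpot : ∀ {s1 s2 : State}, Start N nb X ε base u ids o q0 c0 s1 → Start N nb X ε base u ids o q0 c0 s2 →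
      pot N s1 = pot N s2 := fun h1 h2 => by simp only [pot, h1.ptr, h1.len, h2.ptr, h2.len]
  rw [root, run_seq]
  refine (run_orient h false).mono ?_
  rintro t1 s1 ⟨h1, ht1, ho1, -, -⟩
  rw [run_seq]
  refine (run_orient h1 true).mono ?_
  rintro t2 s2 ⟨h2, ht2, ho2, eF, eG⟩
  have ho1' : Oriented ids u false s2 := by
    unfold Oriented at ho1 ⊢
    rw [show s2.arr (aF false) = s1.arr (aF false) from eF, show s2.arr (aG false) = s1.arr (aG false) from eG]
    exact ho1
  have h3 := ((h2.setReg (r := 23) (by omega) (s2.arr (aG false) u)).setReg (r := 24) (by omega)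
    (ids true (s2.arr (aG false) u))).setReg (r := 25) (by omega) (ids true u)
  have h4 := ((h3.setReg (r := 23) (by omega) (s2.arr (aG true) u)).setReg (r := 24) (by omega)
    (ids false (s2.arr (aG true) u))).setReg (r := 25) (by omega) (ids false u)
  have p3 := hpot h3 h
  have p4 := hpot h4 h
  simp only [run_seq (P := Program.instr _), run_instr, run_branch, Test.Holds]
  simp only [Instr.run, State.setReg, h2.env.r20, h2.env.id, Function.update_self, Function.update_of_ne, ne_eq,
    Nat.reduceEqDiff, not_false_eq_true]
  constructor
  · intro e
    refine (run_rootNear K h3 false e).mono ?_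
    rintro t s' ⟨a1, a2, a3⟩
    exact ⟨⟨_, a1⟩, a2, by omega⟩
  · intro e
    constructor
    · intro e'
      refine (run_rootNear K h4 true e').mono ?_
      rintro t s' ⟨a1, a2, a3⟩
      exact ⟨⟨_, a1⟩, a2, by omega⟩
    · intro e'
      -- Both tests on second neighbours have failed, and by the orientation the first neighbours
      -- are outside too.
      refine (run_rootFar K h4 (Bool.forall_bool.2 ⟨fun e2 => e (ho1' e2), fun e2 => e' (ho2 e2)⟩)
        (Bool.forall_bool.2 ⟨e, e'⟩)).mono ?_
      rintro t s' ⟨a1, a2, a3⟩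
      exact ⟨⟨_, a1⟩, a2, by omega⟩

end

end RealRAM

theorem Drawn.congr {V : Type*} {nb : V → V → Prop} {c d c' d' : V → ℝ} {P : Set V} (h : Drawn nb c d P)
    (hP : ∀ z ∈ P, ∀ w, nb z w → w ∈ P) (hc : ∀ z ∈ P, c' z = c z) (hd : ∀ z ∈ P, d' z = d z) :
    Drawn nb c' d' P := by
  refine ⟨fun v hv w hw e => h.inj hv hw (by rwa [← hc v hv, ← hc w hw]), fun a ha b hb hab hlt => ?_⟩
  rw [hc a ha, hc b hb] at hlt
  obtain ⟨s, hs⟩ := h.edge a ha b hb hab hlt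
  refine ⟨s, fun z hz h1 h2 => ?_⟩
  rw [hc z hz, hc a ha] at h1
  rw [hc z hz, hc b hb] at h2
  obtain ⟨h3, h4⟩ := hs z hz h1 h2
  refine ⟨fun w hw => ?_, ?_⟩
  · rw [hc a ha, hc b hb, hc w (hP z hz w hw)]; exact h3 w hw
  · rw [hc a ha, hc b hb, hc z hz, hd a ha, hd b hb, hd z hz]; exact h4

/-! ### From one component to the next -/

namespace RealRAM

/-- The state between two components. -/
structure Main (N : ℕ) (nb : Bool → ℕ → ℕ → Prop) (X ε : ℝ) (ids : Bool → ℕ → ℕ) (s : State) : Prop where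
  env : Env N ε X (s.rreg 8) (s.reg 20) ids s
  two : ∀ b, TwoRegular N (nb b) (s.arr (aF b)) (s.arr (aG b))
  ptr : ∀ b, s.reg (rPtr b) = s.reg (rLen b)
  mk_iff : ∀ b v, v < N → (s.arr (aMk b true) v ≠ 0 ↔ ∃ i, i < s.reg (rLen b) ∧ s.arr (aQ b) i = v)
  q_lt : ∀ b i, i < s.reg (rLen b) → s.arr (aQ b) i < N
  q_inj : ∀ b i j, i < s.reg (rLen b) → j < s.reg (rLen b) → s.arr (aQ b) i = s.arr (aQ b) j → i = j
  closed : ∀ b i w, i < s.reg (rLen b) → nb b (s.arr (aQ b) i) w → ∃ j, j < s.reg (rLen b) ∧ w = s.arr (aQ b) j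
  same : ∀ b i, i < s.reg (rLen b) → ∃ j, j < s.reg (rLen !b) ∧ s.arr (aQ !b) j = s.arr (aQ b) i
  e_pos : 0 < s.rreg 4
  e_le : s.rreg 4 ≤ 1
  ids_iff : ∀ b v w, v < N → w < N → (ids b v = ids b w ↔ Relation.ReflTransGen (nb b) v w)
  x_lt : ∀ b i, i < s.reg (rLen b) → s.rarr (rX b) (s.arr (aQ b) i) < s.rreg 8
  drawn : ∀ b, Drawn (nb b) (s.rarr (rX b)) (s.rarr (rX !b)) (Verts (s.arr (aQ b)) 0 (s.reg (rLen b)))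
  done : ∀ b v, v < s.reg 20 → s.arr (aMk b true) v ≠ 0
  le : s.reg 20 ≤ N

section

variable {N : ℕ} {nb : Bool → ℕ → ℕ → Prop} {X ε : ℝ} {ids : Bool → ℕ → ℕ} {s : State}

theorem Main.start (h : Main N nb X ε ids s) (hlt : s.reg 20 < N) (hfree : s.arr (aMk false true) (s.reg 20) = 0) :
    Start N nb X ε (s.rreg 8) (s.reg 20) ids (fun b => s.reg (rLen b)) (fun b => s.arr (aQ b))
      (fun b => s.rarr (rX b)) ((Instr.rcopy 1 8).run ((Instr.rcopy 0 8).run s)) := by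
  have hrr : ∀ r, 1 < r → ((Instr.rcopy 1 8).run ((Instr.rcopy 0 8).run s)).rreg r = s.rreg r := fun r hr => by
    simp [Instr.run, State.setRReg, show r ≠ 0 by omega, show r ≠ 1 by omega]
  have hx : ∀ b, ((Instr.rcopy 1 8).run ((Instr.rcopy 0 8).run s)).rreg (rX b) = s.rreg 8 := fun b => by
    cases b <;> simp [Instr.run, State.setRReg, rX]
  refine ⟨h.env.congr (fun _ _ => rfl) (fun _ => rfl) (fun r hr => hrr r (by omega)), fun b => ?_, fun _ => rfl, h.ptr, ?_,
    ?_, hlt, Bool.forall_bool.2 ⟨hfree, ?_⟩, h.same, h.ids_iff⟩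
  · refine ⟨h.two b, le_rfl, PreBlocks.empty .., Coords.empty .., h.mk_iff b, h.q_lt b, h.q_inj b,
      fun i h1 h2 => absurd h2 h1.not_gt, ?_, ?_, False.elim, h.closed b, fun i _ => ⟨rfl, rfl⟩⟩
    · rw [hx]
      change _ ≤ s.rreg 8 + 1 + 3 * ((s.reg (rLen b) : ℝ) - s.reg (rLen b))
      linarith
    · rw [hx]
  · rw [hrr _ (by decide)]; exact h.e_pos
  · rw [hrr _ (by decide)]; exact h.e_le
  -- Between components the two queues contain the same vertices, so testing one axis suffices.
  · by_contra hm
    obtain ⟨i, hi, e⟩ := (h.mk_iff true _ hlt).1 hm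
    obtain ⟨j, hj, e'⟩ := h.same true i hi
    exact (h.mk_iff false _ hlt).2 ⟨j, hj, e'.trans e⟩ hfree

/-- When both queues are exhausted, each queued vertex is marked on the other axis, and it cannot be
there as part of an earlier component. -/
theorem Comp.verts_eq {far : Prop} {base : ℝ} {u : ℕ} {o : Bool → ℕ} {q0 : Bool → ℕ → ℕ} {c0 : Bool → ℕ → ℝ}
    {st en : Bool → ℕ → ℕ} {dl : Bool → ℕ → ℝ} (h : Comp N nb X ε far base u ids o q0 c0 st en dl s)
    (hP : Processed o s) (hptr : ∀ b, s.reg (rPtr b) = s.reg (rLen b)) (b : Bool) :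
    Verts (s.arr (aQ b)) (o b) (s.reg (rLen b)) = Verts (s.arr (aQ !b)) (o !b) (s.reg (rLen !b)) := by
  have key : ∀ b, Verts (s.arr (aQ b)) (o b) (s.reg (rLen b)) ⊆ Verts (s.arr (aQ !b)) (o !b) (s.reg (rLen !b)) := by
    rintro b _ ⟨i, h1, h2, rfl⟩
    obtain ⟨j, hj, e⟩ := ((h.side !b).mk_iff _ ((h.side b).q_lt i h2)).1 (hP.done b i h1 (by rwa [hptr]))
    refine ⟨j, ?_, hj, e⟩
    by_contra hjo
    obtain ⟨k, hk, e'⟩ := h.pre (!b) j (by omega)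
    rw [Bool.not_not] at hk e'
    have := (h.side b).q_inj k i (by omega) h2 (e'.trans e)
    omega
  refine (key b).antisymm ?_
  have := key !b
  rwa [Bool.not_not] at this

theorem Comp.drawn (K : Consts N (3 * N) X ε) {far : Prop} {base : ℝ} {u : ℕ} {o : Bool → ℕ} {q0 : Bool → ℕ → ℕ}
    {c0 : Bool → ℕ → ℝ} {st en : Bool → ℕ → ℕ} {dl : Bool → ℕ → ℝ}
    (h : Comp N nb X ε far base u ids o q0 c0 st en dl s)
    (hP : Processed o s) (hptr : ∀ b, s.reg (rPtr b) = s.reg (rLen b)) (b : Bool) :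
    Drawn (nb b) (s.rarr (rX b)) (s.rarr (rX !b)) (Verts (s.arr (aQ b)) (o b) (s.reg (rLen b))) := by
  have h2 := h.opened !b
  rw [Bool.not_not] at h2
  exact drawn_component K (h.blocks b) (h.side b).coords (h.blocks !b) (h.side !b).coords (h.verts_eq hP hptr b)
    (by rw [h.head, h.head]) (h.opened b) h2 (h.root b)

theorem verts_union (q : ℕ → ℕ) {o L : ℕ} (h : o ≤ L) : Verts q 0 L = Verts q 0 o ∪ Verts q o L := by
  ext z
  constructor
  · rintro ⟨i, -, hi, rfl⟩
    rcases lt_or_ge i o with h1 | h1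
    · exact Or.inl ⟨i, Nat.zero_le _, h1, rfl⟩
    · exact Or.inr ⟨i, h1, hi, rfl⟩
  · rintro (⟨i, -, hi, rfl⟩ | ⟨i, -, hi, rfl⟩)
    · exact ⟨i, Nat.zero_le _, hi.trans_le h, rfl⟩
    · exact ⟨i, Nat.zero_le _, hi, rfl⟩

theorem verts_congr {q q' : ℕ → ℕ} {o L : ℕ} (h : ∀ i, o ≤ i → i < L → q' i = q i) : Verts q' o L = Verts q o L := by
  ext z
  constructor
  · rintro ⟨i, h1, h2, rfl⟩
    exact ⟨i, h1, h2, (h i h1 h2).symm⟩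
  · rintro ⟨i, h1, h2, rfl⟩
    exact ⟨i, h1, h2, h i h1 h2⟩

/-- All coordinates of the component are between `base` and `base + X` on both axes. Raising the
base by `X + 1` therefore separates it from the next component, and `Drawn.union` applies. -/
theorem Main.of_comp (K : Consts N (3 * N) X ε) (h : Main N nb X ε ids s) {s' : State} {far : Prop}
    {st en : Bool → ℕ → ℕ} {dl : Bool → ℕ → ℝ}
    (hC : Comp N nb X ε far (s.rreg 8) (s.reg 20) ids (fun b => s.reg (rLen b)) (fun b => s.arr (aQ b))
      (fun b => s.rarr (rX b)) st en dl s') (hP : Processed (fun b => s.reg (rLen b)) s')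
    (hptr : ∀ b, s'.reg (rPtr b) = s'.reg (rLen b)) (hlt : s.reg 20 < N) :
    Main N nb X ε ids ((Instr.succ 20 20).run ((Instr.radd 8 8 10).run s')) := by
  have e20 : ((Instr.succ 20 20).run ((Instr.radd 8 8 10).run s')).reg 20 = s.reg 20 + 1 := by
    simp [Instr.run, State.setReg, State.setRReg, hC.env.r20]
  have er : ∀ r, r ≠ 20 → ((Instr.succ 20 20).run ((Instr.radd 8 8 10).run s')).reg r = s'.reg r := fun r hr => by
    simp [Instr.run, State.setReg, State.setRReg, hr]
  have e8 : ((Instr.succ 20 20).run ((Instr.radd 8 8 10).run s')).rreg 8 = s.rreg 8 + (X + 1) := by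
    simp [Instr.run, State.setReg, State.setRReg, hC.env.x8, hC.env.x10]
  have err : ∀ r, r ≠ 8 → ((Instr.succ 20 20).run ((Instr.radd 8 8 10).run s')).rreg r = s'.rreg r := fun r hr => by
    simp [Instr.run, State.setReg, State.setRReg, hr]
  have ea : ((Instr.succ 20 20).run ((Instr.radd 8 8 10).run s')).arr = s'.arr := rfl
  have exa : ((Instr.succ 20 20).run ((Instr.radd 8 8 10).run s')).rarr = s'.rarr := rfl
  generalize (Instr.succ 20 20).run ((Instr.radd 8 8 10).run s') = s'' at *
  have eL : ∀ b, s''.reg (rLen b) = s'.reg (rLen b) := fun b => er _ (by cases b <;> decide)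
  have eP : ∀ b, s''.reg (rPtr b) = s'.reg (rPtr b) := fun b => er _ (by cases b <;> decide)
  have hE := hC.env
  have X0 : 0 < X := by nlinarith [K.S_add_two_le, K.two_le, K.N_le]
  have old : ∀ b i, i < s.reg (rLen b) → s'.arr (aQ b) i = s.arr (aQ b) i := fun b i hi => ((hC.side b).old i hi).1
  have xold : ∀ b i, i < s.reg (rLen b) → s'.rarr (rX b) (s.arr (aQ b) i) = s.rarr (rX b) (s.arr (aQ b) i) :=
    fun b i hi => by
      have := ((hC.side b).old i hi).2
      rwa [old b i hi] at this
  have closed : ∀ b i w, s.reg (rLen b) ≤ i → i < s'.reg (rLen b) → nb b (s'.arr (aQ b) i) w →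
      ∃ j, s.reg (rLen b) ≤ j ∧ j < s'.reg (rLen b) ∧ w = s'.arr (aQ b) j := fun b i w h1 h2 hw => by
    obtain ⟨j, j1, j2, rfl, -⟩ := (hC.side b).blocks.nbr i w h1 h2 hw
    exact ⟨j, ((hC.side b).blocks.le_st i h1 h2).trans j1, j2.trans_lt ((hC.side b).blocks.en_lt i h1 h2), rfl⟩
  have hpre : ∀ b, Verts (s'.arr (aQ b)) 0 (s.reg (rLen b)) = Verts (s.arr (aQ b)) 0 (s.reg (rLen b)) := fun b =>
    verts_congr fun i _ hi => old b i hi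
  constructor <;> (try simp only [eL, eP, ea, exa, e20, e8])
  · refine ⟨?_, ?_, ?_, ?_, e20, ?_, ?_, e8, ?_, ?_, ?_, fun b => by rw [ea, hE.id]⟩
    · rw [er _ (by decide), hE.r3]
    · rw [er _ (by decide), hE.r4]
    · rw [er _ (by decide), hE.r5]
    · rw [er _ (by decide), hE.r18]
    · rw [err _ (by decide), hE.x5]
    · rw [err _ (by decide), hE.x6]
    · rw [err _ (by decide), hE.x9]
    · rw [err _ (by decide), hE.x10]
    · rw [err _ (by decide), hE.x12]
  · exact fun b => (hC.side b).two
  · exact hptr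
  · exact fun b => (hC.side b).mk_iff
  · exact fun b => (hC.side b).q_lt
  · exact fun b => (hC.side b).q_inj
  · intro b i w hi hw
    rcases lt_or_ge i (s.reg (rLen b)) with h1 | h1
    · obtain ⟨j, hj, rfl⟩ := (hC.side b).closed i w h1 hw
      exact ⟨j, hj.trans (hC.lt b), rfl⟩
    · obtain ⟨j, -, hj, rfl⟩ := closed b i w h1 hi hw
      exact ⟨j, hj, rfl⟩
  · intro b i hi
    exact ((hC.side _).mk_iff _ ((hC.side b).q_lt i hi)).1 <| by
      rcases lt_or_ge i (s.reg (rLen b)) with h1 | h1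
      · obtain ⟨j, hj, e⟩ := hC.pre b i h1
        exact ((hC.side _).mk_iff _ ((hC.side b).q_lt i hi)).2 ⟨j, hj.trans (hC.lt _), e⟩
      · exact hP.done b i h1 (by rwa [hptr])
  · rw [err _ (by decide)]; exact hC.e_pos
  · rw [err _ (by decide)]; exact hC.e_le
  · exact h.ids_iff
  · intro b i hi
    rcases lt_or_ge i (s.reg (rLen b)) with h1 | h1
    · rw [old b i h1, xold b i h1]
      linarith [h.x_lt b i h1]
    · linarith [(hC.side b).coords.le_add_X K (hC.blocks b) h1 hi]
  · intro b
    rw [verts_union _ (hC.lt b).le]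
    refine Drawn.union ?_ (hC.drawn K hP hptr b) ?_ ?_ ?_
    · simp only [hpre]
      refine (h.drawn b).congr ?_ ?_ ?_
      · rintro _ ⟨i, -, hi, rfl⟩ w hw
        obtain ⟨j, hj, rfl⟩ := h.closed b i w hi hw
        exact ⟨j, Nat.zero_le _, hj, rfl⟩
      · rintro _ ⟨i, -, hi, rfl⟩
        exact xold b i hi
      · rintro _ ⟨i, -, hi, rfl⟩
        obtain ⟨j, hj, e⟩ := h.same b i hi
        rw [← e]; exact xold _ j hj
    · rintro _ ⟨i, -, hi, rfl⟩ w hw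
      obtain ⟨j, hj, rfl⟩ := (hC.side b).closed i w hi hw
      exact ⟨j, Nat.zero_le _, hj, rfl⟩
    · rintro _ ⟨i, h1, h2, rfl⟩ w hw
      obtain ⟨j, j1, j2, rfl⟩ := closed b i w h1 h2 hw
      exact ⟨j, j1, j2, rfl⟩
    · rintro _ ⟨i, -, hi, rfl⟩ _ ⟨j, j1, j2, rfl⟩
      rw [old b i hi, xold b i hi]
      exact (h.x_lt b i hi).trans_le ((hC.side b).coords.base_le j j1 j2)
  · intro b v hv
    rcases Nat.lt_succ_iff_lt_or_eq.1 hv with hv | rfl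
    · have hvN := hv.trans hlt
      obtain ⟨i, hi, e⟩ := (h.mk_iff b v hvN).1 (h.done b v hv)
      exact ((hC.side b).mk_iff v hvN).2 ⟨i, hi.trans (hC.lt b), by rw [old b i hi, e]⟩
    · exact ((hC.side b).mk_iff _ hlt).2 ⟨_, hC.lt b, hC.head b⟩
  · exact hlt

/-- Place all vertices. -/
def mainLoop : Program :=
  .loop (.lt 20 5) (
    .instr (.load 9 (aMk false true) 20) ;; .branch (.eq 9 3)
      (.instr (.rcopy 0 8) ;; .instr (.rcopy 1 8) ;; root ;; bfs ;; .instr (.radd 8 8 10)) .skip ;;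
    .instr (.succ 20 20))

theorem Main.congr (h : Main N nb X ε ids s) {s' : State}
    (hr : ∀ r, r = 3 ∨ r = 4 ∨ r = 5 ∨ r = 18 ∨ r = 14 ∨ r = 15 ∨ r = 16 ∨ r = 17 → s'.reg r = s.reg r)
    (ha : s'.arr = s.arr) (hx : s'.rreg = s.rreg) (hxa : s'.rarr = s.rarr) 
    (hdone : ∀ b v, v < s'.reg 20 → s.arr (aMk b true) v ≠ 0) (hle : s'.reg 20 ≤ N) : Main N nb X ε ids s' := by
  have hl : ∀ b, s'.reg (rLen b) = s.reg (rLen b) := fun b => hr _ (by cases b <;> decide)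
  have hp : ∀ b, s'.reg (rPtr b) = s.reg (rPtr b) := fun b => hr _ (by cases b <;> decide)
  have hE := h.env
  constructor <;> (try simp only [ha, hx, hxa, hl, hp])
  · refine ⟨?_, ?_, ?_, ?_, rfl, by rw [hx, hE.x5], by rw [hx, hE.x6], by rw [hx],
      by rw [hx, hE.x9], by rw [hx, hE.x10], by rw [hx, hE.x12], fun b => by rw [ha, hE.id]⟩
    · rw [hr _ (by simp), hE.r3]
    · rw [hr _ (by simp), hE.r4]
    · rw [hr _ (by simp), hE.r5]
    · rw [hr _ (by simp), hE.r18]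
  exacts [h.two, h.ptr, h.mk_iff, h.q_lt, h.q_inj, h.closed, h.same, h.e_pos, h.e_le, h.ids_iff, h.x_lt, h.drawn,
    hdone, hle]

theorem run_mainLoop (K : Consts N (3 * N) X ε) (h : Main N nb X ε ids s) :
    Run mainLoop s fun t s' => Main N nb X ε ids s' ∧ s'.reg 20 = N ∧ t ≤ 20 * (4 * N) + 80 * N + 1 := by
  -- Besides the potential of the search, an iteration pays at most 54 steps for the root, 10 for
  -- the search, and a few for its own instructions; 80 per vertex is enough.
  refine (run_loop (Main N nb X ε ids) (fun s => 20 * pot N s + 80 * (N - s.reg 20)) ?_ h).mono ?_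
  · intro s h hb
    have hlt : s.reg 20 < N := by rw [← h.env.r5]; exact hb
    have h1 : Main N nb X ε ids ((Instr.load 9 (aMk false true) 20).run s) := by
      refine h.congr (fun r hr => ?_) rfl rfl rfl h.done h.le
      simp [Instr.run, State.setReg, show r ≠ 9 by omega]
    have e9 : ((Instr.load 9 (aMk false true) 20).run s).reg 9 = s.arr (aMk false true) (s.reg 20) := by
      simp [Instr.run, State.setReg]
    have ea : ((Instr.load 9 (aMk false true) 20).run s).arr = s.arr := rfl
    have e20 : ((Instr.load 9 (aMk false true) 20).run s).reg 20 = s.reg 20 := by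
      simp [Instr.run, State.setReg]
    have hpot : pot N ((Instr.load 9 (aMk false true) 20).run s) = pot N s := rfl
    rw [run_seq, run_instr, run_seq, run_branch]
    generalize (Instr.load 9 (aMk false true) 20).run s = s1 at *
    simp only [Test.Holds, e9, h1.env.r3]
    constructor
    · intro hfree
      have hst := h1.start (by omega) (by rw [ea, e20, hfree])
      rw [run_seq, run_instr, run_seq, run_instr, run_seq]
      refine (run_root K hst).mono ?_
      rintro t2 s2 ⟨⟨far, st, en, dl, hC⟩, hP, ht2⟩
      rw [run_seq]
      refine (run_bfs K hC hP).mono ?_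
      rintro t3 s3 ⟨⟨st', en', dl', hC'⟩, hP', hptr, ht3⟩
      rw [run_instr, run_instr]
      refine ⟨h1.of_comp K hC' hP' hptr (by omega), ?_⟩
      have q1 : pot N ((Instr.succ 20 20).run ((Instr.radd 8 8 10).run s3)) = pot N s3 := rfl
      have q2 : pot N ((Instr.rcopy 1 8).run ((Instr.rcopy 0 8).run s1)) = pot N s1 := rfl
      have q3 : ((Instr.succ 20 20).run ((Instr.radd 8 8 10).run s3)).reg 20 = s1.reg 20 + 1 := by
        simp [Instr.run, State.setReg, State.setRReg, hC'.env.r20]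
      rw [q2] at ht2
      rw [q1, q3]
      omega
    · intro hm
      rw [run_skip, run_instr]
      have q3 : ((Instr.succ 20 20).run s1).reg 20 = s1.reg 20 + 1 := by
        simp [Instr.run, State.setReg]
      have q1 : pot N ((Instr.succ 20 20).run s1) = pot N s1 := rfl
      refine ⟨h1.congr (fun r hr => ?_) rfl rfl rfl (fun b v hv => ?_) (by omega), by rw [q1, q3]; omega⟩
      · simp [Instr.run, State.setReg, show r ≠ 20 by omega]
      · rw [q3] at hv
        rcases Nat.lt_succ_iff_lt_or_eq.1 hv with hv | rfl
        · exact h1.done b v hv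
        · rw [ea, e20]
          obtain ⟨i, hi, e⟩ := (h.mk_iff false _ hlt).1 hm
          obtain ⟨j, hj, e'⟩ := h.same false i hi
          cases b
          · exact hm
          · exact (h.mk_iff true _ hlt).2 ⟨j, hj, e'.trans e⟩
  · rintro t s' ⟨h1, h2, h3⟩
    have : ¬ s'.reg 20 < N := by rw [← h1.env.r5]; exact h2
    have := h1.le
    refine ⟨h1, by omega, ?_⟩
    have : pot N s ≤ 4 * N := by unfold pot; omega
    have : N - s.reg 20 ≤ N := Nat.sub_le _ _
    omega

end

end RealRAM

/-! ### Numbering the cycles -/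

namespace RealRAM

/-- Number the components of one graph. -/
def number (b : Bool) : Program :=
  .instr (.copy 21 3) ;; .loop (.lt 21 5) (
    .instr (.load 9 (aMk b false) 21) ;; .branch (.eq 9 3)
      (.instr (.succ 18 21) ;; .instr (.copy 10 21) ;; walk b false) .skip ;;
    .instr (.succ 21 21))

/-- The state after the components that meet the vertices below `s'.reg 21` have been numbered. -/
structure Numbered (b : Bool) (N : ℕ) (nb : ℕ → ℕ → Prop) (s s' : State) : Prop where
  reg : ∀ r, r ≠ 8 → r ≠ 9 → r ≠ 10 → r ≠ 13 → r ≠ 18 → r ≠ 21 → r ≠ rLen b → s'.reg r = s.reg r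
  arr : ∀ a, a ≠ aMk b false → a ≠ aQ b → s'.arr a = s.arr a
  rreg : ∀ r, r ≠ rX b → s'.rreg r = s.rreg r
  eq_iff : ∀ v w, v < N → w < N → s'.arr (aMk b false) v ≠ 0 →
    (s'.arr (aMk b false) v = s'.arr (aMk b false) w ↔ Relation.ReflTransGen nb v w)
  done : ∀ v, v < s'.reg 21 → s'.arr (aMk b false) v ≠ 0
  mk_le : ∀ v, v < N → s'.arr (aMk b false) v ≤ s'.reg 21
  le : s'.reg 21 ≤ N

/-- The number of vertices without a component number. -/
def unnumbered (b : Bool) (N : ℕ) (s : State) : ℕ :=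
  ((Finset.range N).filter fun v => s.arr (aMk b false) v = 0).card

theorem unnumbered_le (b : Bool) (N : ℕ) (s : State) : unnumbered b N s ≤ N :=
  (Finset.card_filter_le _ _).trans (Finset.card_range N).le

theorem WalkPost.unnumbered_add {b : Bool} {N : ℕ} {nb : ℕ → ℕ → Prop} {z : ℕ → ℕ} {s s' : State} {m : ℕ}
    (h : WalkPost b false N nb z s s' m) (h18 : s.reg 18 ≠ 0) :
    unnumbered b N s' + (m + 1) ≤ unnumbered b N s := by
  have hz : ((Finset.range (m + 1)).image z).card = m + 1 := by
    rw [Finset.card_image_of_injOn, Finset.card_range]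
    intro i hi j hj e
    simp only [Finset.coe_range, Set.mem_Iio] at hi hj
    exact h.inj i j (by omega) (by omega) e
  have hmk : ∀ v, s'.arr (aMk b false) v = 0 → (∀ i, i < m + 1 → z i ≠ v) := fun v hv i hi e => by
    rw [← e, h.mk_new i hi] at hv
    exact h18 hv
  rw [unnumbered, unnumbered, ← hz, ← Finset.card_union_of_disjoint]
  · refine Finset.card_le_card fun v hv => ?_
    simp only [Finset.mem_union, Finset.mem_filter, Finset.mem_range, Finset.mem_image] at hv ⊢
    rcases hv with ⟨h1, h2⟩ | ⟨i, hi, rfl⟩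
    · exact ⟨h1, by rw [← h.mk_old v (hmk v h2), h2]⟩
    · exact ⟨h.lt i (by omega), h.free i (by omega)⟩
  · rw [Finset.disjoint_left]
    intro v hv hv'
    simp only [Finset.mem_filter, Finset.mem_range, Finset.mem_image] at hv hv'
    obtain ⟨i, hi, e⟩ := hv'
    exact hmk v hv.2 i hi e

theorem WalkPost.reachable_iff {b p : Bool} {N : ℕ} {nb : ℕ → ℕ → Prop} {z : ℕ → ℕ} {s s' : State} {m : ℕ}
    (h : WalkPost b p N nb z s s' m) (hs : ∀ v w, v < N → nb v w → nb w v) {i : ℕ} (hi : i ≤ m) (w : ℕ) :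
    Relation.ReflTransGen nb (z i) w ↔ ∃ j, j ≤ m ∧ z j = w := by
  constructor
  · intro h'
    induction h' with
    | refl => exact ⟨i, hi, rfl⟩
    | tail _ hw ih =>
      obtain ⟨i, hi, rfl⟩ := ih
      obtain ⟨j, hj, rfl, -⟩ := h.nbr i _ hi hw
      exact ⟨j, hj, rfl⟩
  · rintro ⟨j, hj, rfl⟩
    have h1 : ∀ i, i ≤ m → Relation.ReflTransGen nb (z i) (z 0) := fun i hi => by
      induction i with
      | zero => exact .refl
      | succ i ih => exact (ih (by omega)).head (hs _ _ (h.lt i (by omega)) (h.succ i (by omega)))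
    have h2 : ∀ i, i ≤ m → Relation.ReflTransGen nb (z 0) (z i) := fun i hi => by
      induction i with
      | zero => exact .refl
      | succ i ih => exact (ih (by omega)).tail (h.succ i (by omega))
    exact (h1 i hi).trans (h2 j hj)

/-- The new number is one more than the loop counter, while all earlier numbers are at most the
counter. So it is nonzero and different from all others. -/
theorem Numbered.of_walk {b : Bool} {N : ℕ} {nb : ℕ → ℕ → Prop} {z : ℕ → ℕ} {s s1 s2 s3 : State} {m : ℕ}
    (h : Numbered b N nb s s1) (h2 : WalkPost b false N nb z s2 s3 m) (hs : ∀ v w, v < N → nb v w → nb w v)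
    (hr : ∀ r, r ≠ 10 → r ≠ 18 → s2.reg r = s1.reg r) (ha : s2.arr = s1.arr) (hx : s2.rreg = s1.rreg)
    (h10 : s2.reg 10 = s1.reg 21) (h18 : s2.reg 18 = s1.reg 21 + 1) (hlt : s1.reg 21 < N) :
    Numbered b N nb s ((Instr.succ 21 21).run s3) := by
  have e21 : s3.reg 21 = s1.reg 21 := by
    rw [h2.reg _ (by decide) (by decide) (by decide) (by decide) (by cases b <;> decide),
      hr _ (by decide) (by decide)]
  have e21' : ((Instr.succ 21 21).run s3).reg 21 = s1.reg 21 + 1 := by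
    simp [Instr.run, State.setReg, e21]
  have hnew : ∀ i, i ≤ m → s3.arr (aMk b false) (z i) = s1.reg 21 + 1 := fun i hi => by
    rw [h2.mk_new i (by omega), h18]
  have hold : ∀ w, (∀ i, i ≤ m → z i ≠ w) → s3.arr (aMk b false) w = s1.arr (aMk b false) w := fun w hw => by
    rw [h2.mk_old w fun i hi => hw i (by omega), ha]
  have hfree : ∀ i, i ≤ m → s1.arr (aMk b false) (z i) = 0 := fun i hi => by
    rw [← ha]; exact h2.free i hi
  have cases' : ∀ w, (∃ i, i ≤ m ∧ z i = w) ∨ ∀ i, i ≤ m → z i ≠ w := fun w => by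
    by_cases hw : ∃ i, i ≤ m ∧ z i = w
    · exact Or.inl hw
    · exact Or.inr fun i hi e => hw ⟨i, hi, e⟩
  refine ⟨fun r a1 a2 a3 a4 a5 a6 a7 => ?_, fun a a1 a2 => ?_, fun r a1 => ?_, fun v w hv hw hm => ?_, fun v hv => ?_,
    fun v hv => ?_, by omega⟩
  · simp only [Instr.run, State.setReg, Function.update_of_ne a6]
    rw [h2.reg r a1 a2 a3 a4 a7, hr r a3 a5, h.reg r a1 a2 a3 a4 a5 a6 a7]
  · exact (h2.arr a a1 a2).trans ((congrFun ha a).trans (h.arr a a1 a2))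
  · exact (h2.rreg r a1).trans ((congrFun hx r).trans (h.rreg r a1))
  · change s3.arr (aMk b false) v ≠ 0 at hm
    change s3.arr (aMk b false) v = s3.arr (aMk b false) w ↔ _
    rcases cases' v with ⟨i, hi, rfl⟩ | hv'
    · rw [h2.reachable_iff hs hi, hnew i hi]
      rcases cases' w with ⟨j, hj, rfl⟩ | hw'
      · exact ⟨fun _ => ⟨j, hj, rfl⟩, fun _ => (hnew j hj).symm⟩
      · rw [hold w hw']
        refine ⟨fun e => ?_, fun ⟨j, hj, e⟩ => absurd e (hw' j hj)⟩
        have := h.mk_le w hw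
        omega
    · rw [hold v hv'] at hm ⊢
      rcases cases' w with ⟨j, hj, rfl⟩ | hw'
      · rw [← h.eq_iff v _ hv hw hm, hnew j hj, hfree j hj]
        have := h.mk_le v hv
        omega
      · rw [hold w hw', h.eq_iff v w hv hw hm]
  · rw [e21'] at hv
    change s3.arr (aMk b false) v ≠ 0
    rcases cases' v with ⟨i, hi, rfl⟩ | hv'
    · rw [hnew i hi]; omega
    · rw [hold v hv']
      rcases Nat.lt_succ_iff_lt_or_eq.1 hv with hv | rfl
      · exact h.done v hv
      · exact absurd (h2.head.trans h10) (hv' 0 (Nat.zero_le _))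
  · rw [e21']
    change s3.arr (aMk b false) v ≤ _
    rcases cases' v with ⟨i, hi, rfl⟩ | hv'
    · rw [hnew i hi]
    · rw [hold v hv']
      exact (h.mk_le v hv).trans (Nat.le_succ _)

/-- The numbering reuses `walk`, which also writes to a queue and to coordinates. This does no harm:
the queue lengths are reset later, and `Numbered` makes no promise about those arrays. -/
theorem run_number {b : Bool} {N : ℕ} {nb : ℕ → ℕ → Prop} {s : State} (h3 : s.reg 3 = 0) (h4 : s.reg 4 = 1)
    (h5 : s.reg 5 = N) (hT : TwoRegular N nb (s.arr (aF b)) (s.arr (aG b)))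
    (hM : ∀ v, s.arr (aMk b false) v = 0) :
    Run (number b) s fun t s' => Numbered b N nb s s' ∧ s'.reg 21 = N ∧ t ≤ 24 * N + 2 := by
  rw [number, run_seq, run_instr]
  have e21 : ((Instr.copy 21 3).run s).reg 21 = 0 := by simp [Instr.run, State.setReg, h3]
  refine (run_loop (Numbered b N nb s) (fun s => 14 * unnumbered b N s + 10 * (N - s.reg 21)) ?_ ?_).mono ?_
  · intro s1 h hb
    have e3 : s1.reg 3 = 0 := by
      rw [h.reg _ (by decide) (by decide) (by decide) (by decide) (by decide) (by decide) (by cases b <;> decide), h3]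
    have e4 : s1.reg 4 = 1 := by
      rw [h.reg _ (by decide) (by decide) (by decide) (by decide) (by decide) (by decide) (by cases b <;> decide), h4]
    have e5 : s1.reg 5 = N := by
      rw [h.reg _ (by decide) (by decide) (by decide) (by decide) (by decide) (by decide) (by cases b <;> decide), h5]
    have hT1 : TwoRegular N nb (s1.arr (aF b)) (s1.arr (aG b)) := by
      rwa [h.arr _ (aF_ne_aMk _ _ _) (aF_ne_aQ _ _), h.arr _ (aG_ne_aMk _ _ _) (aG_ne_aQ _ _)]
    have hlt : s1.reg 21 < N := by rw [← e5]; exact hb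
    have hcl : ∀ v w, v < N → s1.arr (aMk b false) v ≠ 0 → nb v w → s1.arr (aMk b false) w ≠ 0 := by
      intro v w hv hm hw
      rwa [← (h.eq_iff v w hv (hT.lt v w hv hw) hm).2 (.single hw)]
    simp only [run_seq (P := Program.instr _), run_seq (P := Program.branch _ _ _), run_instr, run_branch, run_skip]
    have k9 : ((Instr.load 9 (aMk b false) 21).run s1).reg 9 = s1.arr (aMk b false) (s1.reg 21) := by
      simp [Instr.run, State.setReg]
    have k3 : ((Instr.load 9 (aMk b false) 21).run s1).reg 3 = 0 := by
      simp [Instr.run, State.setReg, e3]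
    simp only [Test.Holds, k9, k3]
    have k : Numbered b N nb s ((Instr.load 9 (aMk b false) 21).run s1) := by
      refine ⟨fun r a1 a2 a3 a4 a5 a6 a7 => ?_, h.arr, h.rreg, h.eq_iff, ?_, ?_, ?_⟩
      · simp only [Instr.run, State.setReg, Function.update_of_ne a2]
        exact h.reg r a1 a2 a3 a4 a5 a6 a7
      · simpa [Instr.run, State.setReg] using h.done
      · simpa [Instr.run, State.setReg] using h.mk_le
      · simpa [Instr.run, State.setReg] using h.le
    have k21 : ((Instr.load 9 (aMk b false) 21).run s1).reg 21 = s1.reg 21 := by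
      simp [Instr.run, State.setReg]
    have ka : ((Instr.load 9 (aMk b false) 21).run s1).arr = s1.arr := rfl
    have k4 : ((Instr.load 9 (aMk b false) 21).run s1).reg 4 = 1 := by
      simp [Instr.run, State.setReg, e4]
    generalize (Instr.load 9 (aMk b false) 21).run s1 = s2 at *
    constructor
    · intro hfree
      have j : ∀ r, r ≠ 10 → r ≠ 18 → ((Instr.copy 10 21).run ((Instr.succ 18 21).run s2)).reg r = s2.reg r :=
        fun r a1 a2 => by simp [Instr.run, State.setReg, a1, a2]
      have j10 : ((Instr.copy 10 21).run ((Instr.succ 18 21).run s2)).reg 10 = s2.reg 21 := by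
        simp [Instr.run, State.setReg]
      have j18 : ((Instr.copy 10 21).run ((Instr.succ 18 21).run s2)).reg 18 = s2.reg 21 + 1 := by
        simp [Instr.run, State.setReg]
      have ja : ((Instr.copy 10 21).run ((Instr.succ 18 21).run s2)).arr = s2.arr := rfl
      have jx : ((Instr.copy 10 21).run ((Instr.succ 18 21).run s2)).rreg = s2.rreg := rfl
      generalize (Instr.copy 10 21).run ((Instr.succ 18 21).run s2) = s3 at *
      refine (run_walk (b := b) (p := false) (s := s3) (N := N) (nb := nb) (by rw [j _ (by decide) (by decide), k3])
        (by rw [j _ (by decide) (by decide), k4]) (by omega) (by rwa [ja, ka]) (by rwa [ja, ka])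
        (by omega) (by rw [ja, ka, j10, k21, hfree])).mono ?_
      rintro t s4 ⟨z, m, hw, ht⟩
      refine ⟨k.of_walk hw hT.symm j ja jx j10 j18 (by omega), ?_⟩
      have q1 := hw.unnumbered_add (by omega)
      have q2 : unnumbered b N s3 = unnumbered b N s1 := by simp only [unnumbered, ja, ka]
      have q3 : unnumbered b N ((Instr.succ 21 21).run s4) = unnumbered b N s4 := rfl
      have q4 : ((Instr.succ 21 21).run s4).reg 21 = s1.reg 21 + 1 := by
        have := hw.reg 21 (by decide) (by decide) (by decide) (by decide) (by cases b <;> decide)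
        simp [Instr.run, State.setReg, this, j 21 (by decide) (by decide), k21]
      rw [q3, q4]
      omega
    · intro hm
      have q3 : unnumbered b N ((Instr.succ 21 21).run s2) = unnumbered b N s1 := by
        simp only [unnumbered, Instr.run, State.setReg, ka]
      have q4 : ((Instr.succ 21 21).run s2).reg 21 = s1.reg 21 + 1 := by
        simp [Instr.run, State.setReg, k21]
      refine ⟨⟨fun r a1 a2 a3 a4 a5 a6 a7 => ?_, k.arr, k.rreg, k.eq_iff, fun v hv => ?_, fun v hv => ?_, by omega⟩, ?_⟩
      · simp only [Instr.run, State.setReg, Function.update_of_ne a6]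
        exact k.reg r a1 a2 a3 a4 a5 a6 a7
      · rw [q4] at hv
        change s2.arr (aMk b false) v ≠ 0
        rcases Nat.lt_succ_iff_lt_or_eq.1 hv with hv | rfl
        · exact k.done v (by omega)
        · rwa [ka]
      · rw [q4]
        change s2.arr (aMk b false) v ≤ _
        have := k.mk_le v hv
        omega
      · rw [q3, q4]
        omega
  · refine ⟨fun r _ _ _ _ _ h _ => Function.update_of_ne h _ _, fun _ _ _ => rfl, fun _ _ => rfl,
      fun v w _ _ h => absurd (hM v) h, fun v hv => by omega, fun v _ => ?_, by omega⟩
    rw [e21]; exact (hM v).le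
  · rintro t s' ⟨h1, h2, h3⟩
    have e5 : s'.reg 5 = N := by
      rw [h1.reg _ (by decide) (by decide) (by decide) (by decide) (by decide) (by decide) (by cases b <;> decide), h5]
    have : ¬ s'.reg 21 < N := by rw [← e5]; exact h2
    have := h1.le
    refine ⟨h1, by omega, ?_⟩
    have := unnumbered_le b N ((Instr.copy 21 3).run s)
    omega

end RealRAM

/-! ### Neighbour slots -/

/-- `F v` and `G v` list the neighbours of `v < n` with respect to `R`; `n + v` stands for a free slot. -/
structure Slots (n : ℕ) (R : ℕ → ℕ → Prop) (F G : ℕ → ℕ) : Prop where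
  iff : ∀ v w, v < n → w < n → (R v w ↔ w = F v ∨ w = G v)
  f_or : ∀ v, v < n → F v = n + v ∨ F v < n
  g_or : ∀ v, v < n → G v = n + v ∨ G v < n
  g_free : ∀ v, v < n → F v = n + v → G v = n + v
  ne : ∀ v, v < n → F v = G v → F v = n + v

namespace Slots

variable {n : ℕ} {R R' : ℕ → ℕ → Prop} {F G F' G' : ℕ → ℕ}

theorem empty (hR : ∀ v w, ¬ R v w) (hF : ∀ v, v < n → F v = n + v) (hG : ∀ v, v < n → G v = n + v) :
    Slots n R F G := by
  refine ⟨fun v w hv hw => ⟨fun h => absurd h (hR v w), ?_⟩, fun v hv => Or.inl (hF v hv), fun v hv => Or.inl (hG v hv),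
    fun v hv _ => hG v hv, fun v hv _ => hF v hv⟩
  rw [hF v hv, hG v hv]
  omega

theorem congr (h : Slots n R F G) (hR : ∀ v w, v < n → w < n → (R' v w ↔ R v w)) (hF : ∀ v, v < n → F' v = F v)
    (hG : ∀ v, v < n → G' v = G v) : Slots n R' F' G' := by
  refine ⟨fun v w hv hw => ?_, fun v hv => ?_, fun v hv => ?_, fun v hv => ?_, fun v hv => ?_⟩
  · rw [hR v w hv hw, h.iff v w hv hw, hF v hv, hG v hv]
  · rw [hF v hv]; exact h.f_or v hv
  · rw [hG v hv]; exact h.g_or v hv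
  · rw [hF v hv, hG v hv]; exact h.g_free v hv
  · rw [hF v hv, hG v hv]; exact h.ne v hv

theorem add_f (h : Slots n R F G) {x y : ℕ} (hx : x < n) (hy : y < n) (hxF : F x = n + x) :
    Slots n (fun v w => R v w ∨ v = x ∧ w = y) (Function.update F x y) G := by
  have hxG := h.g_free x hx hxF
  have cases' : ∀ v, (v = x ∧ Function.update F x y v = y) ∨ (v ≠ x ∧ Function.update F x y v = F v) := fun v => by
    by_cases e : v = x
    · exact Or.inl ⟨e, by rw [e, Function.update_self]⟩
    · exact Or.inr ⟨e, Function.update_of_ne e _ _⟩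
  refine ⟨fun v w hv hw => ?_, fun v hv => ?_, h.g_or, fun v hv => ?_, fun v hv => ?_⟩ <;>
    rcases cases' v with ⟨rfl, e⟩ | ⟨hne, e⟩ <;> rw [e]
  · rw [h.iff v w hv hw]; omega
  · rw [h.iff v w hv hw]; simp [hne]
  · exact Or.inr hy
  · exact h.f_or v hv
  · omega
  · exact h.g_free v hv
  · omega
  · exact h.ne v hv

/-- The edge is new, so the second slot becomes different from the first, as required by `ne`. -/
theorem add_g (h : Slots n R F G) {x y : ℕ} (hx : x < n) (hy : y < n) (hR : ¬ R x y) (hxF : F x ≠ n + x)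
    (hxG : G x = n + x) : Slots n (fun v w => R v w ∨ v = x ∧ w = y) F (Function.update G x y) := by
  have cases' : ∀ v, (v = x ∧ Function.update G x y v = y) ∨ (v ≠ x ∧ Function.update G x y v = G v) := fun v => by
    by_cases e : v = x
    · exact Or.inl ⟨e, by rw [e, Function.update_self]⟩
    · exact Or.inr ⟨e, Function.update_of_ne e _ _⟩
  have hyF : y ≠ F x := fun e => hR ((h.iff x y hx hy).2 (Or.inl e))
  refine ⟨fun v w hv hw => ?_, h.f_or, fun v hv => ?_, fun v hv => ?_, fun v hv => ?_⟩ <;>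
    rcases cases' v with ⟨rfl, e⟩ | ⟨hne, e⟩ <;> rw [e]
  · rw [h.iff v w hv hw]; omega
  · rw [h.iff v w hv hw]; simp [hne]
  · exact Or.inr hy
  · exact h.g_or v hv
  · omega
  · exact h.g_free v hv
  · omega
  · exact h.ne v hv

/-- Joining two copies of the graph along the free slots gives a 2-regular multigraph. -/
theorem twoRegular (h : Slots n R F G) (hirr : ∀ v, ¬ R v v) (hsymm : ∀ v w, R v w → R w v) {prt : ℕ → ℕ}
    (hp : ∀ v, v < n → prt v = n + v) (hp' : ∀ v, v < n → prt (n + v) = v)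
    (hF : ∀ v, v < n → F (n + v) = prt (F v)) (hG : ∀ v, v < n → G (n + v) = prt (G v)) :
    TwoRegular (2 * n) (fun v w => v < 2 * n ∧ (w = F v ∨ w = G v)) F G := by
  have inst : ∀ v, v < n → (F v < n → R v (F v)) ∧ (G v < n → R v (G v)) := fun v hv =>
    ⟨fun hf => (h.iff v _ hv hf).2 (Or.inl rfl), fun hg => (h.iff v _ hv hg).2 (Or.inr rfl)⟩
  have cases' : ∀ v, v < 2 * n → v < n ∨ ∃ v', v' < n ∧ v = n + v' := fun v hv => by
    rcases lt_or_ge v n with h1 | h1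
    · exact Or.inl h1
    · exact Or.inr ⟨v - n, by omega, by omega⟩
  have slot : ∀ v, v < n → ∀ w, w = F v ∨ w = G v → w = n + v ∨ (w < n ∧ R v w ∧ w ≠ v) := by
    rintro v hv w (rfl | rfl)
    · exact (h.f_or v hv).imp_right fun h1 => ⟨h1, (inst v hv).1 h1, fun e => hirr v (by simpa [e] using (inst v hv).1 h1)⟩
    · exact (h.g_or v hv).imp_right fun h1 => ⟨h1, (inst v hv).2 h1, fun e => hirr v (by simpa [e] using (inst v hv).2 h1)⟩
  have slot' : ∀ v, v < n → ∀ w, w = F (n + v) ∨ w = G (n + v) ↔ ∃ w', w = prt w' ∧ (w' = F v ∨ w' = G v) := by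
    intro v hv w
    rw [hF v hv, hG v hv]
    constructor
    · rintro (e | e)
      · exact ⟨_, e, Or.inl rfl⟩
      · exact ⟨_, e, Or.inr rfl⟩
    · rintro ⟨w', e, rfl | rfl⟩
      · exact Or.inl e
      · exact Or.inr e
  refine ⟨fun v w hv => ⟨fun h => h.2, fun h => ⟨hv, h⟩⟩, ?_, ?_, ?_, ?_⟩
  · rintro v w - ⟨hv, hw⟩
    rcases cases' v hv with hv' | ⟨v', hv', rfl⟩
    · rcases slot v hv' w hw with rfl | ⟨h1, -⟩ <;> omega
    · obtain ⟨w', rfl, hw'⟩ := (slot' v' hv' w).1 hw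
      rcases slot v' hv' w' hw' with rfl | ⟨h1, -⟩
      · rw [hp' v' hv']; omega
      · rw [hp w' h1]; omega
  · rintro v - ⟨hv, hw⟩
    rcases cases' v hv with hv' | ⟨v', hv', rfl⟩
    · rcases slot v hv' v hw with h1 | ⟨-, -, h1⟩
      · omega
      · exact h1 rfl
    · obtain ⟨w', e, hw'⟩ := (slot' v' hv' _).1 hw
      rcases slot v' hv' w' hw' with rfl | ⟨h1, -, h2⟩
      · rw [hp' v' hv'] at e; omega
      · rw [hp w' h1] at e; omega
  · rintro v w - ⟨hv, hw⟩
    rcases cases' v hv with hv' | ⟨v', hv', rfl⟩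
    · rcases slot v hv' w hw with rfl | ⟨h1, h2, -⟩
      · exact ⟨by omega, (slot' v hv' v).2 ⟨n + v, (hp' v hv').symm, hw⟩⟩
      · exact ⟨by omega, (h.iff w v h1 hv').1 (hsymm _ _ h2)⟩
    · obtain ⟨w', rfl, hw'⟩ := (slot' v' hv' w).1 hw
      rcases slot v' hv' w' hw' with rfl | ⟨h1, h2, -⟩
      · rw [hp' v' hv']
        exact ⟨by omega, hw'⟩
      · rw [hp w' h1]
        exact ⟨by omega, (slot' w' h1 _).2 ⟨v', (hp v' hv').symm, (h.iff w' v' h1 hv').1 (hsymm _ _ h2)⟩⟩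
  -- Equal slots are both free slots. Thus the only double edges join an isolated vertex to its
  -- copy, and the copy sees the same double edge.
  · intro v hv e
    rcases cases' v hv with hv' | ⟨v', hv', rfl⟩
    · have e1 := h.ne v hv' e
      rw [e1, hF v hv', hG v hv', e]
    · rw [hF v' hv', hG v' hv'] at e
      have e1 : F v' = G v' := by
        rcases h.f_or v' hv' with h1 | h1 <;> rcases h.g_or v' hv' with h2 | h2
        · rw [h1, h2]
        · rw [h1, hp' v' hv', hp _ h2] at e; omega
        · rw [h2, hp' v' hv', hp _ h1] at e; omega
        · rw [hp _ h1, hp _ h2] at e; omega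
      have e2 := h.ne v' hv' e1
      rw [hF v' hv', e2, hp' v' hv', ← e1, e2]

end Slots

/-- An enumeration of the edges of a graph of maximum degree at most two on the vertices below `n`. -/
structure EdgeSeq (n : ℕ) (adj : ℕ → ℕ → Prop) (e f : ℕ → ℕ) (M : ℕ) : Prop where
  lt : ∀ v w, adj v w → v < n
  irrefl : ∀ v, ¬ adj v v
  symm : ∀ v w, adj v w → adj w v
  deg : ∀ v a b c, adj v a → adj v b → adj v c → a = b ∨ a = c ∨ b = c
  edge : ∀ i, i < M → adj (e i) (f i)
  exists_of_adj : ∀ v w, adj v w → ∃ i, i < M ∧ (v = e i ∧ w = f i ∨ v = f i ∧ w = e i)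
  ne : ∀ i j, i < j → j < M → ¬ (e i = e j ∧ f i = f j) ∧ ¬ (e i = f j ∧ f i = e j)
  le : M ≤ n

/-- Adjacency in the graph formed by the first `k` edges. -/
def AdjUpTo (e f : ℕ → ℕ) (k v w : ℕ) : Prop := ∃ i, i < k ∧ (v = e i ∧ w = f i ∨ v = f i ∧ w = e i)

theorem adjUpTo_succ {e f : ℕ → ℕ} {k v w : ℕ} :
    AdjUpTo e f (k + 1) v w ↔ (AdjUpTo e f k v w ∨ v = e k ∧ w = f k) ∨ v = f k ∧ w = e k := by
  constructor
  · rintro ⟨i, hi, h⟩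
    rcases Nat.lt_succ_iff_lt_or_eq.1 hi with hi | rfl
    · exact Or.inl (Or.inl ⟨i, hi, h⟩)
    · rcases h with h | h
      · exact Or.inl (Or.inr h)
      · exact Or.inr h
  · rintro ((⟨i, hi, h⟩ | h) | h)
    · exact ⟨i, by omega, h⟩
    · exact ⟨k, by omega, Or.inl h⟩
    · exact ⟨k, by omega, Or.inr h⟩

namespace EdgeSeq

variable {n : ℕ} {adj : ℕ → ℕ → Prop} {e f : ℕ → ℕ} {M : ℕ} (h : EdgeSeq n adj e f M)
include h

theorem adj_of_adjUpTo {k v w : ℕ} (hk : k ≤ M) (hvw : AdjUpTo e f k v w) : adj v w := by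
  obtain ⟨i, hi, ⟨rfl, rfl⟩ | ⟨rfl, rfl⟩⟩ := hvw
  · exact h.edge i (by omega)
  · exact h.symm _ _ (h.edge i (by omega))

theorem adjUpTo_iff (v w : ℕ) : AdjUpTo e f M v w ↔ adj v w :=
  ⟨h.adj_of_adjUpTo le_rfl, fun hvw => h.exists_of_adj v w hvw⟩

theorem not_adjUpTo {k : ℕ} (hk : k < M) : ¬ AdjUpTo e f k (e k) (f k) := by
  rintro ⟨i, hi, ⟨h1, h2⟩ | ⟨h1, h2⟩⟩
  · exact (h.ne i k hi hk).1 ⟨h1.symm, h2.symm⟩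
  · exact (h.ne i k hi hk).2 ⟨h2.symm, h1.symm⟩

theorem lt_right {v w : ℕ} (hvw : adj v w) : w < n := h.lt _ _ (h.symm _ _ hvw)

/-- A vertex with a missing edge has a free slot. -/
theorem g_free {R : ℕ → ℕ → Prop} {F G : ℕ → ℕ} (hS : Slots n R F G) (hR : ∀ v w, R v w → adj v w) {x y : ℕ}
    (hxy : adj x y) (hn : ¬ R x y) : G x = n + x := by
  have hx := h.lt _ _ hxy
  have hy := h.lt_right hxy
  rcases hS.g_or x hx with h1 | h1
  · exact h1
  rcases hS.f_or x hx with h2 | h2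
  · exact hS.g_free x hx h2
  exfalso
  have h3 := (hS.iff x _ hx h2).2 (Or.inl rfl)
  have h4 := (hS.iff x _ hx h1).2 (Or.inr rfl)
  rcases h.deg x _ _ _ (hR _ _ h3) (hR _ _ h4) hxy with e1 | e1 | e1
  · have := hS.ne x hx e1; omega
  · exact hn (e1 ▸ h3)
  · exact hn (e1 ▸ h4)

end EdgeSeq

/-! ### Filling the neighbour slots -/

namespace RealRAM

/-- The input arrays with the ends of the edges. -/
def aE (b c : Bool) : ℕ := cond b (cond c 3 2) (cond c 1 0)
/-- The registers with the numbers of edges. -/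
def rM (b : Bool) : ℕ := cond b 2 1

/-- Set up the constants and free slots; array `4` exchanges the two copies of a vertex. -/
def initSlots : Program :=
  .instr (.const 4 1) ;; .instr (.copy 5 0) ;; .instr (.rconst 6 1) ;; .loop (.lt 21 0) (
    .instr (.store 4 21 5) ;; .instr (.store 4 5 21) ;; .instr (.store (aF false) 21 5) ;;
    .instr (.store (aG false) 21 5) ;; .instr (.store (aF true) 21 5) ;; .instr (.store (aG true) 21 5) ;;
    .instr (.radd 11 11 6) ;; .instr (.radd 11 11 6) ;; .instr (.succ 5 5) ;; .instr (.succ 21 21))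

/-- The state after `s'.reg 21` vertices have been initialized. -/
structure Initialized (n : ℕ) (s s' : State) : Prop where
  reg : ∀ r, r < 20 → r ≠ 4 → r ≠ 5 → s'.reg r = s.reg r
  r4 : s'.reg 4 = 1
  r5 : s'.reg 5 = n + s'.reg 21
  le : s'.reg 21 ≤ n
  arr : ∀ a, a ≠ 4 → a < 6 ∨ 9 < a → s'.arr a = s.arr a
  partner : ∀ v, v < s'.reg 21 → s'.arr 4 v = n + v
  partner' : ∀ v, v < s'.reg 21 → s'.arr 4 (n + v) = v
  f : ∀ b v, v < s'.reg 21 → s'.arr (aF b) v = n + v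
  g : ∀ b v, v < s'.reg 21 → s'.arr (aG b) v = n + v
  rreg : ∀ r, r ≠ 6 → r ≠ 11 → s'.rreg r = s.rreg r
  x6 : s'.rreg 6 = 1
  x11 : s'.rreg 11 = s.rreg 11 + 2 * (s'.reg 21 : ℝ)

/-- Integers cannot be converted to reals, so real register `11` accumulates 2 for each vertex; in
the end it holds the size 2n of the doubled graph. -/
theorem run_initSlots {n : ℕ} {s : State} (h0 : s.reg 0 = n) (h21 : s.reg 21 = 0) :
    Run initSlots s fun t s' => Initialized n s s' ∧ s'.reg 21 = n ∧ t ≤ 11 * n + 4 := by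
  simp only [initSlots, run_seq (P := Program.instr (.const 4 1)), run_seq (P := Program.instr (.copy 5 0)),
    run_seq (P := Program.instr (.rconst 6 1)), run_instr]
  have k : Initialized n s ((Instr.rconst 6 1).run ((Instr.copy 5 0).run ((Instr.const 4 1).run s))) := by
    constructor <;> simp +contextual [Instr.run, State.setReg, State.setRReg, h0, h21]
  have k21 : ((Instr.rconst 6 1).run ((Instr.copy 5 0).run ((Instr.const 4 1).run s))).reg 21 = 0 := by
    simp [Instr.run, State.setReg, State.setRReg, h21]
  generalize (Instr.rconst 6 1).run ((Instr.copy 5 0).run ((Instr.const 4 1).run s)) = s1 at *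
  refine (run_loop (Initialized n s) (fun s => 11 * (n - s.reg 21)) ?_ k).mono ?_
  · intro s1 h hb
    have hlt : s1.reg 21 < n := by
      have : s1.reg 21 < s1.reg 0 := hb
      rwa [h.reg 0 (by decide) (by decide) (by decide), h0] at this
    simp only [run_seq, run_instr]
    have e5 := h.r5
    have key : ∀ s2 : State, s2 = (Instr.succ 21 21).run ((Instr.succ 5 5).run ((Instr.radd 11 11 6).run
        ((Instr.radd 11 11 6).run ((Instr.store (aG true) 21 5).run ((Instr.store (aF true) 21 5).run
        ((Instr.store (aG false) 21 5).run ((Instr.store (aF false) 21 5).run ((Instr.store 4 5 21).run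
        ((Instr.store 4 21 5).run s1))))))))) → Initialized n s s2 ∧ s2.reg 21 = s1.reg 21 + 1 := by
      intro s2 hs2
      have e21 : s2.reg 21 = s1.reg 21 + 1 := by
        rw [hs2]; simp [Instr.run, State.setReg, State.setRReg]
      have er : ∀ r, r ≠ 5 → r ≠ 21 → s2.reg r = s1.reg r := fun r h1 h2 => by
        rw [hs2]; simp [Instr.run, State.setReg, State.setRReg, h1, h2]
      have e5' : s2.reg 5 = s1.reg 5 + 1 := by
        rw [hs2]; simp [Instr.run, State.setReg, State.setRReg]
      have ea : ∀ a, a ≠ 4 → a < 6 ∨ 9 < a → s2.arr a = s1.arr a := fun a h1 h2 => by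
        rw [hs2]
        simp [Instr.run, State.setReg, State.setRReg, aF, aG, h1, show a ≠ 6 by omega, show a ≠ 7 by omega,
          show a ≠ 8 by omega, show a ≠ 9 by omega]
      have e4 : s2.arr 4 = Function.update (Function.update (s1.arr 4) (s1.reg 21) (s1.reg 5)) (s1.reg 5) (s1.reg 21) := by
        rw [hs2]
        simp [Instr.run, State.setReg, State.setRReg, aF, aG]
      have ef : ∀ b, s2.arr (aF b) = Function.update (s1.arr (aF b)) (s1.reg 21) (s1.reg 5) := fun b => by
        rw [hs2]
        cases b <;> simp [Instr.run, State.setReg, State.setRReg, aF, aG]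
      have eg : ∀ b, s2.arr (aG b) = Function.update (s1.arr (aG b)) (s1.reg 21) (s1.reg 5) := fun b => by
        rw [hs2]
        cases b <;> simp [Instr.run, State.setReg, State.setRReg, aF, aG]
      have ex : ∀ r, r ≠ 11 → s2.rreg r = s1.rreg r := fun r h1 => by
        rw [hs2]; simp [Instr.run, State.setReg, State.setRReg, h1]
      have ex11 : s2.rreg 11 = s1.rreg 11 + 1 + 1 := by
        rw [hs2]; simp [Instr.run, State.setReg, State.setRReg, h.x6]
      clear hs2
      refine ⟨⟨fun r h1 h2 h3 => ?_, ?_, by omega, by omega, fun a h1 h2 => ?_, fun v hv => ?_, fun v hv => ?_,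
        fun b v hv => ?_, fun b v hv => ?_, fun r h1 h2 => ?_, ?_, ?_⟩, e21⟩
      · rw [er r h3 (by omega), h.reg r h1 h2 h3]
      · rw [er _ (by decide) (by decide), h.r4]
      · rw [ea a h1 h2, h.arr a h1 h2]
      · rw [e4, Function.update_of_ne (by omega)]
        rcases Nat.lt_or_eq_of_le (show v ≤ s1.reg 21 by omega) with h1 | rfl
        · rw [Function.update_of_ne (by omega), h.partner v h1]
        · rw [Function.update_self, e5]
      · rw [e4]
        rcases Nat.lt_or_eq_of_le (show v ≤ s1.reg 21 by omega) with h1 | rfl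
        · rw [Function.update_of_ne (by omega), Function.update_of_ne (by omega), h.partner' v h1]
        · rw [← e5, Function.update_self]
      · rw [ef]
        rcases Nat.lt_or_eq_of_le (show v ≤ s1.reg 21 by omega) with h1 | rfl
        · rw [Function.update_of_ne (by omega), h.f b v h1]
        · rw [Function.update_self, e5]
      · rw [eg]
        rcases Nat.lt_or_eq_of_le (show v ≤ s1.reg 21 by omega) with h1 | rfl
        · rw [Function.update_of_ne (by omega), h.g b v h1]
        · rw [Function.update_self, e5]
      · rw [ex r h2, h.rreg r h1 h2]
      · rw [ex _ (by decide), h.x6]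
      · rw [ex11, h.x11, e21]; push_cast; ring
    obtain ⟨h1, h2⟩ := key _ rfl
    refine ⟨h1, ?_⟩
    rw [h2]
    omega
  · rintro t s' ⟨h1, h2, h3⟩
    have : ¬ s'.reg 21 < s'.reg 0 := h2
    rw [h1.reg 0 (by decide) (by decide) (by decide), h0] at this
    have := h1.le
    refine ⟨h1, by omega, by omega⟩

/-- Put the vertex in register `y` into a free slot of the vertex in register `x`. -/
def addSlot (b : Bool) (x y : ℕ) : Program :=
  .instr (.load 24 (aF b) x) ;; .instr (.load 25 4 x) ;;
  .branch (.eq 24 25) (.instr (.store (aF b) x y)) (.instr (.store (aG b) x y))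

/-- `s'` differs from `s` only in the slots of one graph and in temporary registers. -/
structure SlotFrame (b : Bool) (s s' : State) : Prop where
  reg : ∀ r, r < 20 → s'.reg r = s.reg r
  arr : ∀ a, a ≠ aF b → a ≠ aG b → s'.arr a = s.arr a
  rreg : s'.rreg = s.rreg

theorem SlotFrame.trans {b : Bool} {s s' s'' : State} (h : SlotFrame b s s') (h' : SlotFrame b s' s'') :
    SlotFrame b s s'' :=
  ⟨fun r hr => (h'.reg r hr).trans (h.reg r hr), fun a h1 h2 => (h'.arr a h1 h2).trans (h.arr a h1 h2),
    h'.rreg.trans h.rreg⟩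

theorem aF_ne_aG (b : Bool) : aF b ≠ aG b := by cases b <;> decide

theorem run_addSlot {b : Bool} {n x y : ℕ} {R : ℕ → ℕ → Prop} {s : State} (hx : x ≠ 24) (hx' : x ≠ 25) (hy : y ≠ 24)
    (hy' : y ≠ 25) (h4 : ∀ v, v < n → s.arr 4 v = n + v) (hS : Slots n R (s.arr (aF b)) (s.arr (aG b)))
    (hxn : s.reg x < n) (hyn : s.reg y < n) (hR : ¬ R (s.reg x) (s.reg y)) (hG : s.arr (aG b) (s.reg x) = n + s.reg x) :
    Run (addSlot b x y) s fun t s' => SlotFrame b s s' ∧ s'.reg 21 = s.reg 21 ∧ s'.reg 22 = s.reg 22 ∧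
      s'.reg 23 = s.reg 23 ∧
      Slots n (fun v w => R v w ∨ v = s.reg x ∧ w = s.reg y) (s'.arr (aF b)) (s'.arr (aG b)) ∧ t = 4 := by
  have hne := aF_ne_aG b
  simp only [addSlot, run_seq, run_instr, run_branch, Test.Holds]
  simp only [Instr.run, State.setReg, Function.update_self, Function.update_of_ne, ne_eq, hx, hx', hy, hy',
    Nat.reduceEqDiff, not_false_eq_true, h4 _ hxn]
  constructor
  · intro e
    refine ⟨⟨fun r hr => ?_, fun a h1 h2 => ?_, rfl⟩, trivial, trivial, trivial, ?_, trivial⟩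
    · simp [show r ≠ 24 by omega, show r ≠ 25 by omega]
    · simp [h1]
    · rw [Function.update_of_ne hne.symm]
      exact hS.add_f hxn hyn e
  · intro e
    refine ⟨⟨fun r hr => ?_, fun a h1 h2 => ?_, rfl⟩, trivial, trivial, trivial, ?_, trivial⟩
    · simp [show r ≠ 24 by omega, show r ≠ 25 by omega]
    · simp [h2]
    · rw [Function.update_of_ne hne]
      exact hS.add_g hxn hyn hR e hG

/-- Fill the slots from the list of edges. -/
def fillSlots (b : Bool) : Program :=
  .instr (.copy 21 3) ;; .loop (.lt 21 (rM b)) (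
    .instr (.load 22 (aE b false) 21) ;; .instr (.load 23 (aE b true) 21) ;; addSlot b 22 23 ;; addSlot b 23 22 ;;
    .instr (.succ 21 21))

/-- The slots always describe the graph of the edges read so far. The next edge is not among them,
so the degree bound leaves a free slot at each of its ends (`EdgeSeq.g_free`). -/
theorem run_fillSlots {b : Bool} {n M : ℕ} {adj : ℕ → ℕ → Prop} {s : State} (h3 : s.reg 3 = 0) (hM : s.reg (rM b) = M)
    (h4 : ∀ v, v < n → s.arr 4 v = n + v) (hF : ∀ v, v < n → s.arr (aF b) v = n + v)
    (hG : ∀ v, v < n → s.arr (aG b) v = n + v) (hE : EdgeSeq n adj (s.arr (aE b false)) (s.arr (aE b true)) M) :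
    Run (fillSlots b) s fun t s' => SlotFrame b s s' ∧ Slots n adj (s'.arr (aF b)) (s'.arr (aG b)) ∧ t ≤ 12 * n + 2 := by
  rw [fillSlots, run_seq, run_instr]
  have k21 : ((Instr.copy 21 3).run s).reg 21 = 0 := by simp [Instr.run, State.setReg, h3]
  refine (run_loop (fun s' => SlotFrame b s s' ∧ s'.reg 21 ≤ M ∧
    Slots n (AdjUpTo (s.arr (aE b false)) (s.arr (aE b true)) (s'.reg 21)) (s'.arr (aF b)) (s'.arr (aG b)))
    (fun s' => 12 * (M - s'.reg 21)) ?_ ?_).mono ?_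
  · rintro s1 ⟨hf, -, hS⟩ hb
    have hlt : s1.reg 21 < M := by
      have : s1.reg 21 < s1.reg (rM b) := hb
      rwa [hf.reg (rM b) (by cases b <;> decide), hM] at this
    have hadj := hE.edge _ hlt
    have hx := hE.lt _ _ hadj
    have hy := hE.lt_right hadj
    have hnot := hE.not_adjUpTo hlt
    have eE : ∀ c, s1.arr (aE b c) = s.arr (aE b c) := fun c =>
      hf.arr _ (by cases b <;> cases c <;> decide) (by cases b <;> cases c <;> decide)
    have e4 : s1.arr 4 = s.arr 4 := hf.arr _ (by cases b <;> decide) (by cases b <;> decide)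
    simp only [run_seq, run_instr]
    have j22 : ((Instr.load 23 (aE b true) 21).run ((Instr.load 22 (aE b false) 21).run s1)).reg 22 =
        s.arr (aE b false) (s1.reg 21) := by simp [Instr.run, State.setReg, eE]
    have j23 : ((Instr.load 23 (aE b true) 21).run ((Instr.load 22 (aE b false) 21).run s1)).reg 23 =
        s.arr (aE b true) (s1.reg 21) := by simp [Instr.run, State.setReg, eE]
    have j21 : ((Instr.load 23 (aE b true) 21).run ((Instr.load 22 (aE b false) 21).run s1)).reg 21 = s1.reg 21 := by
      simp [Instr.run, State.setReg]
    have ja : ((Instr.load 23 (aE b true) 21).run ((Instr.load 22 (aE b false) 21).run s1)).arr = s1.arr := rfl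
    have jf : SlotFrame b s1 ((Instr.load 23 (aE b true) 21).run ((Instr.load 22 (aE b false) 21).run s1)) :=
      ⟨fun r hr => by simp [Instr.run, State.setReg, show r ≠ 22 by omega, show r ≠ 23 by omega],
        fun _ _ _ => rfl, rfl⟩
    generalize (Instr.load 23 (aE b true) 21).run ((Instr.load 22 (aE b false) 21).run s1) = s2 at *
    refine (run_addSlot (n := n) (R := AdjUpTo (s.arr (aE b false)) (s.arr (aE b true)) (s1.reg 21)) (by decide)
      (by decide) (by decide) (by decide) (by rw [ja, e4]; exact h4) (by rw [ja]; exact hS) (by rw [j22]; exact hx)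
      (by rw [j23]; exact hy) (by rw [j22, j23]; exact hnot) ?_).mono ?_
    · rw [ja, j22]
      exact hE.g_free hS (fun v w => hE.adj_of_adjUpTo hlt.le) hadj hnot
    rintro _ s3 ⟨f3, l21, l22, l23, S3, rfl⟩
    rw [j22, j23] at S3
    have hsub : ∀ v w, AdjUpTo (s.arr (aE b false)) (s.arr (aE b true)) (s1.reg 21) v w ∨
        v = s.arr (aE b false) (s1.reg 21) ∧ w = s.arr (aE b true) (s1.reg 21) → adj v w := by
      rintro v w (h | ⟨rfl, rfl⟩)
      · exact hE.adj_of_adjUpTo hlt.le h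
      · exact hadj
    have hadj' := hE.symm _ _ hadj
    -- The second half of the edge is still missing: edges read before are symmetric, and the half
    -- just added could only coincide with it for a loop.
    have hnot' : ¬ (AdjUpTo (s.arr (aE b false)) (s.arr (aE b true)) (s1.reg 21)
        (s.arr (aE b true) (s1.reg 21)) (s.arr (aE b false) (s1.reg 21)) ∨
        s.arr (aE b true) (s1.reg 21) = s.arr (aE b false) (s1.reg 21) ∧
          s.arr (aE b false) (s1.reg 21) = s.arr (aE b true) (s1.reg 21)) := by
      rintro (⟨i, hi, h⟩ | ⟨e, -⟩)
      · exact hnot ⟨i, hi, h.symm.imp And.symm And.symm⟩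
      · rw [e] at hadj; exact hE.irrefl _ hadj
    refine (run_addSlot (n := n) (by decide) (by decide) (by decide) (by decide) ?_ S3 (by rw [l23, j23]; exact hy)
      (by rw [l22, j22]; exact hx) (by rw [l22, l23, j22, j23]; exact hnot') ?_).mono ?_
    · rw [f3.arr _ (by cases b <;> decide) (by cases b <;> decide), ja, e4]; exact h4
    · rw [l23, j23]
      exact hE.g_free S3 hsub hadj' hnot'
    rintro _ s4 ⟨f4, m21, -, -, S4, rfl⟩
    have p21 : ((Instr.succ 21 21).run s4).reg 21 = s1.reg 21 + 1 := by
      simp [Instr.run, State.setReg, m21, l21, j21]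
    have pf : SlotFrame b s4 ((Instr.succ 21 21).run s4) :=
      ⟨fun r hr => by simp [Instr.run, State.setReg, show r ≠ 21 by omega], fun _ _ _ => rfl, rfl⟩
    refine ⟨⟨hf.trans (jf.trans (f3.trans (f4.trans pf))), by omega, ?_⟩, by rw [p21]; omega⟩
    rw [p21]
    refine S4.congr (fun v w _ _ => ?_) (fun _ _ => rfl) (fun _ _ => rfl)
    rw [l22, l23, j22, j23, adjUpTo_succ]
  · refine ⟨⟨fun r hr => ?_, fun _ _ _ => rfl, rfl⟩, by omega, ?_⟩
    · simp [Instr.run, State.setReg, show r ≠ 21 by omega]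
    · rw [k21]
      exact Slots.empty (fun v w ⟨i, hi, _⟩ => by omega) hF hG
  · rintro t s' ⟨⟨hf, hle, hS⟩, hb, ht⟩
    have : ¬ s'.reg 21 < s'.reg (rM b) := hb
    rw [hf.reg (rM b) (by cases b <;> decide), hM] at this
    rw [show s'.reg 21 = M by omega] at hS
    have := hE.le
    exact ⟨hf, hS.congr (fun v w _ _ => (hE.adjUpTo_iff v w).symm) (fun _ _ => rfl) (fun _ _ => rfl), by omega⟩

/-- Fill the slots of the copies. -/
def copySlots (b : Bool) : Program :=
  .instr (.copy 21 3) ;; .loop (.lt 21 0) (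
    .instr (.load 22 4 21) ;; .instr (.load 23 (aF b) 21) ;; .instr (.load 24 4 23) ;; .instr (.store (aF b) 22 24) ;;
    .instr (.load 23 (aG b) 21) ;; .instr (.load 24 4 23) ;; .instr (.store (aG b) 22 24) ;; .instr (.succ 21 21))

/-- The slots of `s'.reg 21` copies have been filled. -/
structure Copied (b : Bool) (n : ℕ) (s s' : State) : Prop extends SlotFrame b s s' where
  le : s'.reg 21 ≤ n
  f : ∀ v, v < n → s'.arr (aF b) v = s.arr (aF b) v
  g : ∀ v, v < n → s'.arr (aG b) v = s.arr (aG b) v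
  f' : ∀ v, v < s'.reg 21 → s'.arr (aF b) (n + v) = s.arr 4 (s.arr (aF b) v)
  g' : ∀ v, v < s'.reg 21 → s'.arr (aG b) (n + v) = s.arr 4 (s.arr (aG b) v)

theorem run_copySlots {b : Bool} {n : ℕ} {s : State} (h3 : s.reg 3 = 0) (h0 : s.reg 0 = n)
    (h4 : ∀ v, v < n → s.arr 4 v = n + v) :
    Run (copySlots b) s fun t s' => Copied b n s s' ∧ s'.reg 21 = n ∧ t ≤ 9 * n + 2 := by
  have hne := aF_ne_aG b
  rw [copySlots, run_seq, run_instr]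
  have k21 : ((Instr.copy 21 3).run s).reg 21 = 0 := by simp [Instr.run, State.setReg, h3]
  refine (run_loop (Copied b n s) (fun s' => 9 * (n - s'.reg 21)) ?_ ?_).mono ?_
  · rintro s1 h hb
    have hlt : s1.reg 21 < n := by
      have : s1.reg 21 < s1.reg 0 := hb
      rwa [h.reg 0 (by decide), h0] at this
    have e4 : s1.arr 4 = s.arr 4 := h.arr _ (by cases b <;> decide) (by cases b <;> decide)
    have hb4 : 4 ≠ aF b ∧ 4 ≠ aG b := by cases b <;> decide
    simp only [run_seq, run_instr]
    have key : ∀ s2 : State, s2 = (Instr.succ 21 21).run ((Instr.store (aG b) 22 24).run ((Instr.load 24 4 23).run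
        ((Instr.load 23 (aG b) 21).run ((Instr.store (aF b) 22 24).run ((Instr.load 24 4 23).run
        ((Instr.load 23 (aF b) 21).run ((Instr.load 22 4 21).run s1))))))) →
        Copied b n s s2 ∧ s2.reg 21 = s1.reg 21 + 1 := by
      intro s2 hs2
      have e21 : s2.reg 21 = s1.reg 21 + 1 := by
        rw [hs2]; simp [Instr.run, State.setReg]
      have eF : s2.arr (aF b) = Function.update (s1.arr (aF b)) (n + s1.reg 21) (s.arr 4 (s.arr (aF b) (s1.reg 21))) := by
        rw [hs2]; simp [Instr.run, State.setReg, e4, h4 _ hlt, h.f _ hlt, hne]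
      have eG : s2.arr (aG b) = Function.update (s1.arr (aG b)) (n + s1.reg 21) (s.arr 4 (s.arr (aG b) (s1.reg 21))) := by
        rw [hs2]; simp [Instr.run, State.setReg, e4, h4 _ hlt, h.g _ hlt, hne.symm, hb4.1]
      have hfr : SlotFrame b s1 s2 := by
        rw [hs2]
        refine ⟨fun r hr => ?_, fun a h1 h2 => ?_, rfl⟩
        · simp [Instr.run, State.setReg, show r ≠ 21 by omega, show r ≠ 22 by omega, show r ≠ 23 by omega,
            show r ≠ 24 by omega]
        · simp [Instr.run, State.setReg, h1, h2]
      clear hs2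
      refine ⟨⟨h.toSlotFrame.trans hfr, by omega, fun v hv => ?_, fun v hv => ?_, fun v hv => ?_, fun v hv => ?_⟩, e21⟩
      · rw [eF, Function.update_of_ne (by omega), h.f v hv]
      · rw [eG, Function.update_of_ne (by omega), h.g v hv]
      · rw [eF]
        rcases Nat.lt_or_eq_of_le (show v ≤ s1.reg 21 by omega) with h1 | rfl
        · rw [Function.update_of_ne (by omega), h.f' v h1]
        · rw [Function.update_self]
      · rw [eG]
        rcases Nat.lt_or_eq_of_le (show v ≤ s1.reg 21 by omega) with h1 | rfl
        · rw [Function.update_of_ne (by omega), h.g' v h1]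
        · rw [Function.update_self]
    obtain ⟨h1, h2⟩ := key _ rfl
    refine ⟨h1, ?_⟩
    rw [h2]
    omega
  · refine ⟨⟨fun r hr => ?_, fun _ _ _ => rfl, rfl⟩, by omega, fun _ _ => rfl, fun _ _ => rfl, fun v hv => by omega,
      fun v hv => by omega⟩
    simp [Instr.run, State.setReg, show r ≠ 21 by omega]
  · rintro t s' ⟨h1, h2, h3⟩
    have : ¬ s'.reg 21 < s'.reg 0 := h2
    rw [h1.reg 0 (by decide), h0] at this
    have := h1.le
    exact ⟨h1, by omega, by omega⟩

/-- The neighbour relation provided is that of the doubled graph; it contains the original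
adjacency. -/
theorem run_slots {b : Bool} {n M : ℕ} {adj : ℕ → ℕ → Prop} {s : State} (h3 : s.reg 3 = 0) (h0 : s.reg 0 = n)
    (hM : s.reg (rM b) = M) (h4 : ∀ v, v < n → s.arr 4 v = n + v) (h4' : ∀ v, v < n → s.arr 4 (n + v) = v)
    (hF : ∀ v, v < n → s.arr (aF b) v = n + v) (hG : ∀ v, v < n → s.arr (aG b) v = n + v)
    (hE : EdgeSeq n adj (s.arr (aE b false)) (s.arr (aE b true)) M) :
    Run (fillSlots b ;; copySlots b) s fun t s' => SlotFrame b s s' ∧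
      (∃ nb : ℕ → ℕ → Prop, TwoRegular (2 * n) nb (s'.arr (aF b)) (s'.arr (aG b)) ∧ ∀ v w, adj v w → nb v w) ∧
      t ≤ 21 * n + 4 := by
  rw [run_seq]
  refine (run_fillSlots h3 hM h4 hF hG hE).mono ?_
  rintro t1 s1 ⟨f1, S1, ht1⟩
  have e4 : s1.arr 4 = s.arr 4 := f1.arr _ (by cases b <;> decide) (by cases b <;> decide)
  refine (run_copySlots (n := n) (by rw [f1.reg _ (by decide), h3]) (by rw [f1.reg _ (by decide), h0])
    (by rwa [e4])).mono ?_
  rintro t2 s2 ⟨h, h21, ht2⟩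
  have S2 := S1.congr (fun _ _ _ _ => Iff.rfl) h.f h.g
  refine ⟨f1.trans h.toSlotFrame, ⟨_, S2.twoRegular hE.irrefl hE.symm h4 h4' (fun v hv => ?_) (fun v hv => ?_),
    fun v w hvw => ?_⟩, by omega⟩
  · rw [h.f' v (by omega), e4, h.f v hv]
  · rw [h.g' v (by omega), e4, h.g v hv]
  · have hv := hE.lt _ _ hvw
    exact ⟨by omega, (S2.iff v w hv (hE.lt_right hvw)).1 hvw⟩

end RealRAM

/-! ### The whole program -/

namespace RealRAM

/-- Set up the real constants. -/
def setConstants : Program :=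
  .instr (.copy 14 3) ;; .instr (.copy 15 3) ;; .instr (.copy 18 4) ;; .instr (.copy 20 3) ;; .instr (.rcopy 4 6) ;;
  .instr (.rconst 9 9) ;; .instr (.rmul 9 9 11) ;; .instr (.rmul 9 9 11) ;; .instr (.radd 9 9 6) ;;
  .instr (.radd 9 9 6) ;; .instr (.radd 10 9 6) ;; .instr (.rmul 5 11 9) ;; .instr (.radd 5 5 5) ;;
  .instr (.rdiv 5 6 5)

/-- The program that computes a simultaneous embedding. -/
def embed : Program :=
  initSlots ;; (fillSlots false ;; copySlots false) ;; (fillSlots true ;; copySlots true) ;; number false ;;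
  number true ;; setConstants ;; mainLoop

theorem run_setConstants {s : State} (h3 : s.reg 3 = 0) (h4 : s.reg 4 = 1) (h6 : s.rreg 6 = 1) :
    Run setConstants s fun t s' => t = 14 ∧ s'.reg 14 = 0 ∧ s'.reg 15 = 0 ∧ s'.reg 18 = 1 ∧ s'.reg 20 = 0 ∧
      (∀ r, r ≠ 14 → r ≠ 15 → r ≠ 18 → r ≠ 20 → s'.reg r = s.reg r) ∧ s'.arr = s.arr ∧
      (∀ r, r ≠ 4 → r ≠ 9 → r ≠ 10 → r ≠ 5 → s'.rreg r = s.rreg r) ∧ s'.rreg 4 = 1 ∧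
      s'.rreg 9 = 9 * s.rreg 11 * s.rreg 11 + 2 ∧ s'.rreg 10 = s'.rreg 9 + 1 ∧
      s'.rreg 5 = 1 / (s.rreg 11 * s'.rreg 9 + s.rreg 11 * s'.rreg 9) := by
  simp only [setConstants, run_seq, run_instr]
  refine ⟨trivial, ?_, ?_, ?_, ?_, fun r h1 h2 h3 h4 => ?_, rfl, fun r h1 h2 h3 h4 => ?_, ?_, ?_, ?_, ?_⟩
  · simp [Instr.run, State.setReg, State.setRReg, h3]
  · simp [Instr.run, State.setReg, State.setRReg, h3]
  · simp [Instr.run, State.setReg, State.setRReg, h4]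
  · simp [Instr.run, State.setReg, State.setRReg, h3]
  · simp [Instr.run, State.setReg, State.setRReg, h1, h2, h3, h4]
  · simp [Instr.run, State.setReg, State.setRReg, h1, h2, h3, h4]
  · simp [Instr.run, State.setReg, State.setRReg, h6]
  · simp [Instr.run, State.setReg, State.setRReg, h6]; ring
  · simp [Instr.run, State.setReg, State.setRReg, h6]
  · simp [Instr.run, State.setReg, State.setRReg, h6]

/-- The program works with N = 2n vertices, S = 3N, X = S² + 2 and ε = 1/(2NX). The conclusion keeps
only a drawing of a supergraph on a set containing the original vertices. -/
theorem run_embed {n : ℕ} {adj : Bool → ℕ → ℕ → Prop} {M : Bool → ℕ} {s : State} (h0 : s.reg 0 = n)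
    (hM : ∀ b, s.reg (rM b) = M b) (hr : ∀ r, 3 ≤ r → s.reg r = 0) (ha : ∀ a, 4 ≤ a → ∀ i, s.arr a i = 0)
    (hx : ∀ r, s.rreg r = 0) (hE : ∀ b, EdgeSeq n (adj b) (s.arr (aE b false)) (s.arr (aE b true)) (M b)) :
    Run embed s fun t s' => t ≤ 500 * (n + 1) ∧ ∀ b, ∃ (nb : ℕ → ℕ → Prop) (P : Set ℕ),
      Drawn nb (s'.rarr (rX b)) (s'.rarr (rX !b)) P ∧ (∀ v, v < n → v ∈ P) ∧ ∀ v w, adj b v w → nb v w := by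
  rw [embed, run_seq]
  refine (run_initSlots h0 (hr _ (by decide))).mono ?_
  rintro t1 s1 ⟨i1, e21, ht1⟩
  rw [run_seq]
  have hE1 : ∀ b, EdgeSeq n (adj b) (s1.arr (aE b false)) (s1.arr (aE b true)) (M b) := fun b => by
    rw [i1.arr _ (by cases b <;> decide) (by cases b <;> decide), i1.arr _ (by cases b <;> decide) (by cases b <;> decide)]
    exact hE b
  refine (run_slots (b := false) (n := n) (M := M false) (adj := adj false) ?_ ?_ ?_ (fun v hv => i1.partner v (by omega))
    (fun v hv => i1.partner' v (by omega)) (fun v hv => i1.f _ v (by omega)) (fun v hv => i1.g _ v (by omega))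
    (hE1 _)).mono ?_
  · rw [i1.reg _ (by decide) (by decide) (by decide), hr _ (by decide)]
  · rw [i1.reg _ (by decide) (by decide) (by decide), h0]
  · rw [i1.reg _ (by decide) (by decide) (by decide), hM]
  rintro t2 s2 ⟨f2, ⟨nbA, hA2, hadjA⟩, ht2⟩
  have a2 : ∀ a, a ≠ 6 → a ≠ 7 → s2.arr a = s1.arr a := fun a h1 h2 => f2.arr a h1 h2
  rw [run_seq]
  refine (run_slots (b := true) (n := n) (M := M true) (adj := adj true) ?_ ?_ ?_ (fun v hv => ?_)
    (fun v hv => ?_) (fun v hv => ?_) (fun v hv => ?_) ?_).mono ?_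
  · rw [f2.reg _ (by decide), i1.reg _ (by decide) (by decide) (by decide), hr _ (by decide)]
  · rw [f2.reg _ (by decide), i1.reg _ (by decide) (by decide) (by decide), h0]
  · rw [f2.reg _ (by decide), i1.reg _ (by decide) (by decide) (by decide), hM]
  · rw [a2 _ (by decide) (by decide)]; exact i1.partner v (by omega)
  · rw [a2 _ (by decide) (by decide)]; exact i1.partner' v (by omega)
  · rw [a2 _ (by decide) (by decide)]; exact i1.f _ v (by omega)
  · rw [a2 _ (by decide) (by decide)]; exact i1.g _ v (by omega)
  · rw [a2 _ (by decide) (by decide), a2 _ (by decide) (by decide)]; exact hE1 _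
  rintro t3 s3 ⟨f3, ⟨nbB, hB3, hadjB⟩, ht3⟩
  have a3 : ∀ a, 10 ≤ a → ∀ i, s3.arr a i = 0 := fun a h i => by
    rw [f3.arr a (by simp [aF]; omega) (by simp [aG]; omega), a2 a (by omega) (by omega),
      i1.arr a (by omega) (by omega), ha a (by omega)]
  have r3 : ∀ r, r < 20 → r ≠ 4 → r ≠ 5 → s3.reg r = s.reg r := fun r h1 h2 h3 => by
    rw [f3.reg r h1, f2.reg r h1, i1.reg r h1 h2 h3]
  have x3 : s3.rreg = s1.rreg := f3.rreg.trans f2.rreg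
  have e34 : s3.reg 4 = 1 := by rw [f3.reg _ (by decide), f2.reg _ (by decide), i1.r4]
  have e35 : s3.reg 5 = 2 * n := by rw [f3.reg _ (by decide), f2.reg _ (by decide), i1.r5]; omega
  have e33 : s3.reg 3 = 0 := by rw [r3 _ (by decide) (by decide) (by decide), hr _ (by decide)]
  have hA3 : TwoRegular (2 * n) nbA (s3.arr (aF false)) (s3.arr (aG false)) := by
    rwa [f3.arr _ (by decide) (by decide), f3.arr _ (by decide) (by decide)]
  rw [run_seq]
  refine (run_number (b := false) e33 e34 e35 hA3 (a3 _ (by decide))).mono ?_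
  rintro t4 s4 ⟨n4, m4, ht4⟩
  have r4 : ∀ r, r ≠ 8 → r ≠ 9 → r ≠ 10 → r ≠ 13 → r ≠ 18 → r ≠ 21 → r ≠ 14 → s4.reg r = s3.reg r := n4.reg
  rw [run_seq]
  refine (run_number (b := true) (N := 2 * n) (nb := nbB) ?_ ?_ ?_ ?_ ?_).mono ?_
  · rw [r4 _ (by decide) (by decide) (by decide) (by decide) (by decide) (by decide) (by decide), e33]
  · rw [r4 _ (by decide) (by decide) (by decide) (by decide) (by decide) (by decide) (by decide), e34]
  · rw [r4 _ (by decide) (by decide) (by decide) (by decide) (by decide) (by decide) (by decide), e35]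
  · rwa [n4.arr _ (by decide) (by decide), n4.arr _ (by decide) (by decide)]
  · rw [n4.arr _ (by decide) (by decide)]; exact a3 _ (by decide)
  rintro t5 s5 ⟨n5, m5, ht5⟩
  have r5 : ∀ r, r ≠ 8 → r ≠ 9 → r ≠ 10 → r ≠ 13 → r ≠ 18 → r ≠ 21 → r ≠ 14 → r ≠ 15 → s5.reg r = s3.reg r :=
    fun r b1 b2 b3 b4 b5 b6 b7 b8 => by rw [n5.reg r b1 b2 b3 b4 b5 b6 b8, r4 r b1 b2 b3 b4 b5 b6 b7]
  have x5 : ∀ r, 1 < r → s5.rreg r = s1.rreg r := fun r h => by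
    rw [n5.rreg r (by simp [rX]; omega), n4.rreg r (by simp [rX]; omega), x3]
  have e6 : s5.rreg 6 = 1 := by rw [x5 _ (by decide), i1.x6]
  have e11 : s5.rreg 11 = ((2 * n : ℕ) : ℝ) := by
    rw [x5 _ (by decide), i1.x11, hx, e21]; push_cast; ring
  have e53 : s5.reg 3 = 0 := by
    rw [r5 _ (by decide) (by decide) (by decide) (by decide) (by decide) (by decide) (by decide) (by decide), e33]
  have e54 : s5.reg 4 = 1 := by
    rw [r5 _ (by decide) (by decide) (by decide) (by decide) (by decide) (by decide) (by decide) (by decide), e34]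
  have e55 : s5.reg 5 = 2 * n := by
    rw [r5 _ (by decide) (by decide) (by decide) (by decide) (by decide) (by decide) (by decide) (by decide), e35]
  have hptr : ∀ b, s5.reg (rPtr b) = 0 := fun b => by
    rw [r5 _ (by cases b <;> decide) (by cases b <;> decide) (by cases b <;> decide) (by cases b <;> decide)
      (by cases b <;> decide) (by cases b <;> decide) (by cases b <;> decide) (by cases b <;> decide),
      r3 _ (by cases b <;> decide) (by cases b <;> decide) (by cases b <;> decide), hr _ (by cases b <;> decide)]
  have hmk : ∀ b i, s5.arr (aMk b true) i = 0 := fun b i => by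
    rw [n5.arr _ (by cases b <;> decide) (by cases b <;> decide), n4.arr _ (by cases b <;> decide) (by cases b <;> decide),
      a3 _ (by cases b <;> decide)]
  have hid : ∀ b v w, v < 2 * n → w < 2 * n → (s5.arr (aMk b false) v = s5.arr (aMk b false) w ↔
      Relation.ReflTransGen (cond b nbB nbA) v w) := by
    rintro (_ | _) v w hv hw
    · rw [n5.arr _ (by decide) (by decide)]
      exact n4.eq_iff v w hv hw (n4.done v (by omega))
    · exact n5.eq_iff v w hv hw (n5.done v (by omega))
  have htwo : ∀ b, TwoRegular (2 * n) (cond b nbB nbA) (s5.arr (aF b)) (s5.arr (aG b)) := by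
    rintro (_ | _)
    · rw [n5.arr _ (by decide) (by decide), n4.arr _ (by decide) (by decide), n5.arr _ (by decide) (by decide),
        n4.arr _ (by decide) (by decide)]
      exact hA3
    · rw [n5.arr _ (by decide) (by decide), n4.arr _ (by decide) (by decide), n5.arr _ (by decide) (by decide),
        n4.arr _ (by decide) (by decide)]
      exact hB3
  rw [run_seq]
  refine (run_setConstants e53 e54 e6).mono ?_
  rintro _ s6 ⟨rfl, c14, c15, c18, c20, c21, c1, c2, c3, c4, c5, c6⟩
  have c65 : s6.reg 5 = 2 * n := by rw [c21 _ (by decide) (by decide) (by decide) (by decide), e55]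
  rcases Nat.eq_zero_or_pos n with hn | hn
  -- Without vertices the constants are degenerate (ε comes from a division by 0), but the main loop
  -- is not entered.
  · refine run_loop_false (show ¬ s6.reg 20 < s6.reg 5 by omega) ⟨by omega, fun b => ⟨fun _ _ => True, ∅, ?_, ?_, ?_⟩⟩
    · exact ⟨fun v hv => absurd hv (Set.notMem_empty _), fun a ha => absurd ha (Set.notMem_empty _)⟩
    · intro v hv; omega
    · exact fun _ _ _ => trivial
  have hn1 : (1 : ℝ) ≤ n := by exact_mod_cast hn
  rw [e11] at c4 c6
  have K : Consts ((2 * n : ℕ) : ℝ) (3 * (2 * n : ℕ)) (s6.rreg 9) (s6.rreg 5) := by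
    have hX : 0 < s6.rreg 9 := by rw [c4]; positivity
    have hNX : 0 < ((2 * n : ℕ) : ℝ) * s6.rreg 9 := mul_pos (by positivity) hX
    refine ⟨by push_cast; linarith, by linarith [Nat.cast_nonneg (α := ℝ) (2 * n)], by rw [c4]; linarith, ?_, ?_⟩
    · rw [c6]; positivity
    · rw [c6, div_mul_eq_mul_div, one_mul, div_lt_one (by positivity)]
      linarith
  have hlen : ∀ b, s6.reg (rLen b) = 0 := Bool.forall_bool.2 ⟨c14, c15⟩
  have cx : ∀ r, 1 < r → r ≠ 4 → r ≠ 9 → r ≠ 10 → r ≠ 5 → s6.rreg r = s1.rreg r := fun r h h1 h2 h3 h4 => by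
    rw [c2 r h1 h2 h3 h4, x5 r h]
  have hmain : Main (2 * n) (fun b => cond b nbB nbA) (s6.rreg 9) (s6.rreg 5) (fun b => s5.arr (aMk b false)) s6 := by
    refine ⟨⟨?_, ?_, c65, c18, rfl, rfl, ?_, rfl, rfl, c5, ?_, fun b => by rw [c1]⟩, by rw [c1]; exact htwo, fun b => ?_,
      fun b v hv => ?_, ?_, ?_, ?_, ?_, by rw [c3]; exact one_pos, c3.le, hid, ?_, fun b => ?_, ?_, by omega⟩
    · rw [c21 _ (by decide) (by decide) (by decide) (by decide), e53]
    · rw [c21 _ (by decide) (by decide) (by decide) (by decide), e54]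
    · rw [cx _ (by decide) (by decide) (by decide) (by decide) (by decide), i1.x6]
    · rw [cx _ (by decide) (by decide) (by decide) (by decide) (by decide), i1.rreg _ (by decide) (by decide), hx]
    · rw [hlen, c21 _ (by cases b <;> decide) (by cases b <;> decide) (by cases b <;> decide)
        (by cases b <;> decide), hptr]
    · rw [c1, hlen]
      exact ⟨fun h => absurd (hmk b v) h, fun ⟨i, hi, _⟩ => absurd hi (Nat.not_lt_zero _)⟩
    · intro b i hi; rw [hlen] at hi; omega
    · intro b i j hi; rw [hlen] at hi; omega
    · intro b i w hi; rw [hlen] at hi; omega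
    · intro b i hi; rw [hlen] at hi; omega
    · intro b i hi; rw [hlen] at hi; omega
    · rw [hlen]
      refine ⟨fun v hv => ?_, fun v hv => ?_⟩ <;>
      · obtain ⟨i, -, hi, -⟩ := hv
        omega
    · intro b v hv; omega
  refine (run_mainLoop K hmain).mono ?_
  rintro t7 s7 ⟨h7, k7, ht7⟩
  -- The bounds of the phases add up to 469n + 31 steps.
  refine ⟨by omega, fun b => ⟨_, _, h7.drawn b, fun v hv => ?_, ?_⟩⟩
  · obtain ⟨i, hi, e⟩ := (h7.mk_iff b v (by omega)).1 (h7.done b v (by omega))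
    exact ⟨i, Nat.zero_le _, hi, e⟩
  · cases b
    · exact hadjA
    · exact hadjB

end RealRAM

/-! ### Edge lists and conclusion -/

namespace RealRAM

theorem edgeEntry_of_lt {n : ℕ} {L : List (Fin n × Fin n)} {i : ℕ} (hi : i < L.length) :
    edgeEntry L i = (L[i].1.val, L[i].2.val) := by
  simp [edgeEntry, List.getElem?_eq_getElem hi]

end RealRAM

theorem SimpleGraph.eq_or_eq_or_eq_of_degree_le_two {V : Type*} [Fintype V] {G : SimpleGraph V} [DecidableRel G.Adj]
    (hG : G.maxDegree ≤ 2) {v a b c : V} (ha : G.Adj v a) (hb : G.Adj v b) (hc : G.Adj v c) :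
    a = b ∨ a = c ∨ b = c := by
  classical
  by_contra! h
  have h1 : ({a, b, c} : Finset V) ⊆ G.neighborFinset v := by
    intro x hx
    simp only [Finset.mem_insert, Finset.mem_singleton] at hx
    rw [SimpleGraph.mem_neighborFinset]
    rcases hx with rfl | rfl | rfl <;> assumption
  have h2 := Finset.card_le_card h1
  rw [Finset.card_eq_three.2 ⟨a, b, c, h.1, h.2.1, h.2.2, rfl⟩, G.card_neighborFinset_eq_degree] at h2
  have := G.degree_le_maxDegree v
  omega

/-- By the handshake lemma, twice the number of edges is at most 2n. Without this bound, reading the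
edge list would not be linear in n. -/
theorem IsEdgeList.length_le {n : ℕ} {G : SimpleGraph (Fin n)} [DecidableRel G.Adj] (hG : G.maxDegree ≤ 2)
    {L : List (Fin n × Fin n)} (hL : IsEdgeList G L) : L.length ≤ n := by
  have h1 : (L.map fun e => s(e.1, e.2)).toFinset = G.edgeFinset := by
    ext e
    induction e using Sym2.ind with
    | _ u v => rw [List.mem_toFinset, hL.2, SimpleGraph.mem_edgeFinset, SimpleGraph.mem_edgeSet]
  have h2 := List.toFinset_card_of_nodup hL.1
  rw [h1, List.length_map] at h2
  have h3 := G.sum_degrees_eq_twice_card_edges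
  have h4 : ∑ v, G.degree v ≤ ∑ _v : Fin n, 2 := Finset.sum_le_sum fun v _ => (G.degree_le_maxDegree v).trans hG
  simp only [Finset.sum_const, Finset.card_univ, Fintype.card_fin, smul_eq_mul] at h4
  omega

theorem IsEdgeList.edgeSeq {n : ℕ} {G : SimpleGraph (Fin n)} [DecidableRel G.Adj] (hG : G.maxDegree ≤ 2)
    {L : List (Fin n × Fin n)} (hL : IsEdgeList G L) :
    EdgeSeq n (fun v w => ∃ (hv : v < n) (hw : w < n), G.Adj ⟨v, hv⟩ ⟨w, hw⟩) (fun i => (edgeEntry L i).1)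
      (fun i => (edgeEntry L i).2) L.length := by
  refine ⟨fun v w h => h.1, fun v ⟨_, _, h⟩ => h.ne rfl, fun v w ⟨h1, h2, h⟩ => ⟨h2, h1, h.symm⟩, ?_, fun i hi => ?_,
    ?_, fun i j hij hj => ?_, hL.length_le hG⟩
  · rintro v a b c ⟨_, _, ha⟩ ⟨_, _, hb⟩ ⟨_, _, hc⟩
    simpa using SimpleGraph.eq_or_eq_or_eq_of_degree_le_two hG ha hb hc
  · simp only [RealRAM.edgeEntry_of_lt hi]
    exact ⟨Fin.isLt _, Fin.isLt _, (hL.2 _ _).1 (List.mem_map.2 ⟨L[i], List.getElem_mem hi, rfl⟩)⟩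
  · rintro v w ⟨hv, hw, h⟩
    obtain ⟨e, he, heq⟩ := List.mem_map.1 ((hL.2 _ _).2 h)
    obtain ⟨i, hi, rfl⟩ := List.getElem_of_mem he
    refine ⟨i, hi, ?_⟩
    simp only [RealRAM.edgeEntry_of_lt hi]
    rcases Sym2.eq_iff.1 heq with ⟨h1, h2⟩ | ⟨h1, h2⟩
    · exact Or.inl ⟨by rw [h1], by rw [h2]⟩
    · exact Or.inr ⟨by rw [h2], by rw [h1]⟩
  · have hi := hij.trans hj
    have key : s(L[i].1, L[i].2) ≠ s(L[j].1, L[j].2) := fun e => by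
      have := (hL.1.getElem_inj_iff (i := i) (j := j) (hi := by simpa) (hj := by simpa)).1 (by simpa using e)
      omega
    simp only [RealRAM.edgeEntry_of_lt hi, RealRAM.edgeEntry_of_lt hj, ← Fin.ext_iff]
    exact ⟨fun h => key (Sym2.eq_iff.2 (Or.inl h)), fun h => key (Sym2.eq_iff.2 (Or.inr h))⟩

/-- The roles of the axes are exchanged for the second graph, whence the final reflection. -/
theorem RealRAM.exists_exec_embed {n : ℕ} {A B : SimpleGraph (Fin n)} [DecidableRel A.Adj] [DecidableRel B.Adj]
    (hA : A.maxDegree ≤ 2) (hB : B.maxDegree ≤ 2) {LA LB : List (Fin n × Fin n)} (hLA : IsEdgeList A LA)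
    (hLB : IsEdgeList B LB) :
    ∃ (t : ℕ) (s : State), Exec embed (inputState n LA LB) t s ∧ t ≤ 500 * (n + 1) ∧
      IsSimultaneousEmbedding A B (outputPlacement n s) := by
  obtain ⟨t, s, h1, h2, h3⟩ := run_embed (n := n)
    (adj := fun b v w => ∃ (hv : v < n) (hw : w < n), (cond b B A).Adj ⟨v, hv⟩ ⟨w, hw⟩)
    (M := fun b => cond b LB.length LA.length) (s := inputState n LA LB) rfl (fun b => by cases b <;> rfl)
    (fun r hr => by obtain ⟨r, rfl⟩ := Nat.exists_eq_add_of_le' hr; rfl)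
    (fun a ha i => by obtain ⟨a, rfl⟩ := Nat.exists_eq_add_of_le' ha; rfl) (fun _ => rfl)
    (Bool.forall_bool.2 ⟨hLA.edgeSeq hA, hLB.edgeSeq hB⟩)
  refine ⟨t, s, h1, h2, ?_, ?_⟩
  · obtain ⟨nb, P, hd, hP, hnb⟩ := h3 false
    exact (hd.comap (nb' := A.Adj) Fin.val Fin.val_injective (fun v => hP v v.isLt)
      fun v w h => hnb v w ⟨v.isLt, w.isLt, h⟩).isStraightLineEmbedding
  · obtain ⟨nb, P, hd, hP, hnb⟩ := h3 true
    exact (hd.comap (nb' := B.Adj) Fin.val Fin.val_injective (fun v => hP v v.isLt)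
      fun v w h => hnb v w ⟨v.isLt, w.isLt, h⟩).isStraightLineEmbedding.swap

theorem IsStraightLineEmbedding.comp {V W : Type*} {G : SimpleGraph V} {H : SimpleGraph W} {p : W → ℝ × ℝ}
    (h : IsStraightLineEmbedding H p) {f : V → W} (hf : Function.Injective f)
    (hGH : ∀ u v, G.Adj u v → H.Adj (f u) (f v)) : IsStraightLineEmbedding G fun v => p (f v) := by
  refine ⟨h.injective.comp hf, fun u v w huv hu hv =>
    h.vertex_notMem_edge _ _ _ (hGH u v huv) (hf.ne hu) (hf.ne hv), fun a b c d hab hcd hne => ?_⟩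
  refine (h.edge_inter_edge _ _ _ _ (hGH a b hab) (hGH c d hcd) fun e => hne ?_).trans ?_
  · exact Sym2.map.injective hf (by simpa using e)
  · rintro _ ⟨w, ⟨h1, h2⟩, rfl⟩
    simp only [Set.mem_insert_iff, Set.mem_singleton_iff] at h1 h2
    obtain ⟨u, rfl⟩ : ∃ u, f u = w := by rcases h1 with h1 | h1 <;> exact ⟨_, h1.symm⟩
    exact ⟨u, ⟨h1.imp (fun e => hf e) fun e => hf e, h2.imp (fun e => hf e) fun e => hf e⟩, rfl⟩

theorem exists_isEdgeList {n : ℕ} (G : SimpleGraph (Fin n)) : ∃ L, IsEdgeList G L := by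
  classical
  have e : (G.edgeFinset.toList.map Quot.out).map (fun e => s(e.1, e.2)) = G.edgeFinset.toList := by
    rw [List.map_map]
    exact (List.map_congr_left fun e _ => Quot.out_eq e).trans (List.map_id _)
  refine ⟨G.edgeFinset.toList.map Quot.out, ?_, fun u v => ?_⟩ <;> rw [e]
  · exact Finset.nodup_toList _
  · rw [Finset.mem_toList, SimpleGraph.mem_edgeFinset, SimpleGraph.mem_edgeSet]

theorem SimpleGraph.maxDegree_comap_equiv_le {V W : Type*} [Fintype V] [Fintype W] (G : SimpleGraph V)
    [DecidableRel G.Adj] (e : W ≃ V) [DecidableRel (G.comap e).Adj] {k : ℕ} (h : G.maxDegree ≤ k) :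
    (G.comap e).maxDegree ≤ k := by
  refine SimpleGraph.maxDegree_le_of_forall_degree_le _ _ fun v => ?_
  rw [← (SimpleGraph.Iso.comap e G).degree_eq v]
  exact (G.degree_le_maxDegree _).trans h

theorem mainTheorem2 :
    (∀ (V : Type*) [Fintype V] (A B : SimpleGraph V) [DecidableRel A.Adj] [DecidableRel B.Adj],
      A.maxDegree ≤ 2 → B.maxDegree ≤ 2 → ∃ p : V → ℝ × ℝ, IsSimultaneousEmbedding A B p) ∧
    ∃ (P : RealRAM.Program) (C : ℕ),
      ∀ (n : ℕ) (A B : SimpleGraph (Fin n)) [DecidableRel A.Adj] [DecidableRel B.Adj],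
        A.maxDegree ≤ 2 → B.maxDegree ≤ 2 →
        ∀ LA LB : List (Fin n × Fin n), IsEdgeList A LA → IsEdgeList B LB →
          ∃ (t : ℕ) (s : RealRAM.State),
            RealRAM.Exec P (inputState n LA LB) t s ∧ t ≤ C * (n + 1) ∧
              IsSimultaneousEmbedding A B (outputPlacement n s) := by
  refine ⟨fun V _ A B _ _ hA hB => ?_, RealRAM.embed, 500, fun n A B _ _ hA hB LA LB hLA hLB =>
    RealRAM.exists_exec_embed hA hB hLA hLB⟩
  -- Existence on an arbitrary finite vertex set follows from the algorithm: number the vertices,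
  -- choose any edge lists and pull the output back.
  classical
  let e := Fintype.equivFin V
  obtain ⟨LA, hLA⟩ := exists_isEdgeList (A.comap e.symm)
  obtain ⟨LB, hLB⟩ := exists_isEdgeList (B.comap e.symm)
  obtain ⟨t, s, -, -, h1, h2⟩ := RealRAM.exists_exec_embed (A.maxDegree_comap_equiv_le e.symm hA)
    (B.maxDegree_comap_equiv_le e.symm hB) hLA hLB
  exact ⟨fun v => outputPlacement _ s (e v), h1.comp e.injective fun u v h => by simpa using h,
    h2.comp e.injective fun u v h => by simpa using h⟩
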